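/- For $s\in\mathbb{C}$ let $\mathrm{Li}_s$ be the principal branch of the polylogarithm, that is, the holomorphic continuation of $\sum_{n\ge1} z^n/n^s$ from the unit disc to $\mathbb{C}\setminus[1,\infty)$. Put $S_n(s)=\sum_{k=0}^{n-1}(-1)^k\binom{n-1}{k}(k+1)^{-s}$ and let $Z(s,x)=\sum_{n\ge1}\frac{S_n(s)}{n+1}x^{n+1}$ for $|x|<1$ and for $x=1$, extended holomorphically in $x$ to $\mathbb{C}\setminus[1,\infty)$. Both continuations exist. Let $\mathbb{C}^*=\mathbb{C}\setminus((-\infty,0]\cup[1,\infty))$. Theorem. Let $s\in\mathbb{C}$. For every $x\in\mathbb{C}\setminus((-\infty,0)\cup(1,\infty))$ we have $$Z(s,x)=(s-1)\zeta(s)+\int_x^1\mathrm{Li}_s\!\left(\frac{z}{z-1}\right)dz,$$ where $(s-1)\zeta(s)$ is given its limit value $1$ at $s=1$, and where the integral is taken along any continuous path of finite length from $x$ to $1$ that lies in $\mathbb{C}^*$ except possibly for its endpoints. Such paths exist, and the integral, understood as an improper line integral at the endpoints, exists and does not depend on the path. Moreover, if $s\notin\{-1,-2,-3,\dots\}$,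 then $$\int_x^1\mathrm{Li}_s\!\left(\frac{z}{z-1}\right)dz\;\sim\;\frac{-1}{\Gamma(1+s)}\,(1-x)\left[-\log\left(\frac1x-1\right)\right]^s$$ as $x\to1$ with $x\in\mathbb{C}\setminus(1,\infty)$, where the logarithm and the power are principal branches. -/

import Mathlib

open Filter Topology Asymptotics

namespace ZetaParam

noncomputable section

/-- The plane cut along `[1, ∞)`. -/
def cutAtOne : Set ℂ := (Complex.ofReal '' Set.Ici 1)ᶜ

/-- The plane `ℂ*` cut along `(-∞, 0] ∪ [1, ∞)`. -/
def cutPlane : Set ℂ := (Complex.ofReal '' (Set.Iic 0 ∪ Set.Ici 1))ᶜ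

/-- `ℂ ∖ ((-∞, 0) ∪ (1, ∞))`: the cut plane together with the points `0` and `1`. -/
def cutPlaneWithEnds : Set ℂ := (Complex.ofReal '' (Set.Iio 0 ∪ Set.Ioi 1))ᶜ

/-- `F` is the holomorphic continuation to the plane cut along `[1, ∞)` of the function `f`, given on
the open unit disc. Such an `F` is unique on the cut plane (which is open and connected). -/
def IsContinuation (f F : ℂ → ℂ) : Prop :=
  DifferentiableOn ℂ F cutAtOne ∧ Set.EqOn F f (Metric.ball 0 1)

/-- The holomorphic continuation to the plane cut along `[1, ∞)`, when there is one. -/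
def continuation (f : ℂ → ℂ) : ℂ → ℂ := Classical.epsilon (IsContinuation f)

/-- `∑_{n ≥ 1} z ^ n / n ^ s`, for `|z| < 1`. -/
def polylogSeries (s z : ℂ) : ℂ := ∑' n : ℕ, z ^ (n + 1) / ((n : ℂ) + 1) ^ s

/-- The principal branch of the polylogarithm `Li_s`, on the plane cut along `[1, ∞)`. -/
def polylog (s : ℂ) : ℂ → ℂ := continuation (polylogSeries s)

/-- `S_n(s) = ∑_{k=0}^{n-1} (-1)^k C(n-1, k) (k+1)^{-s}`, for `n ≥ 1`; the value at `n = 0` is `0`. -/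
def S (n : ℕ) (s : ℂ) : ℂ :=
  ∑ k ∈ Finset.range n, (-1 : ℂ) ^ k * ((n - 1).choose k : ℂ) * ((k : ℂ) + 1) ^ (-s)

/-- `∑_{n ≥ 1} S_n(s) / (n+1) x^{n+1}`; the term `n = 0` vanishes because `S 0 s = 0`. -/
def zetaSeries (s x : ℂ) : ℂ := ∑' n : ℕ, S n s / ((n : ℂ) + 1) * x ^ (n + 1)

open Classical in
/-- The parametrized zeta function `Z(s, x)`: the sum of its series at `x = 1`, and the holomorphic
continuation of the sum of the series from the unit disc to the plane cut along `[1, ∞)`. -/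
def Z (s x : ℂ) : ℂ := if x = 1 then zetaSeries s 1 else continuation (zetaSeries s) x

open Classical in
/-- The entire function `(s - 1) ζ(s)`, whose value at `s = 1` is `1`. -/
def subOneMulZeta (s : ℂ) : ℂ := if s = 1 then 1 else (s - 1) * riemannZeta s

/-- `I` is the line integral of `f` along the restriction of the curve `γ` to `[a, b]`: the limit of
the Riemann sums `∑ f(γ(τ_i)) (γ(t_{i+1}) - γ(t_i))` as the mesh of the tagged partition
`a = t_0 ≤ τ_0 ≤ t_1 ≤ ... ≤ t_n = b` tends to `0`. -/
def HasLineIntegral (f : ℂ → ℂ) (γ : ℝ → ℂ) (a b : ℝ) (I : ℂ) : Prop :=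
  ∀ ε : ℝ, 0 < ε → ∃ δ : ℝ, 0 < δ ∧
    ∀ (n : ℕ) (t τ : ℕ → ℝ), t 0 = a → t n = b →
      (∀ i < n, t i ≤ τ i ∧ τ i ≤ t (i + 1) ∧ t (i + 1) - t i < δ) →
      ‖∑ i ∈ Finset.range n, f (γ (τ i)) * (γ (t (i + 1)) - γ (t i)) - I‖ < ε

/-- `I` is the line integral of `f` along the path `γ`, improper at both endpoints: the limit of the
line integrals along `γ` restricted to `[a, b]` as `a → 0+` and `b → 1-`. -/
def HasPathIntegral (f : ℂ → ℂ) {x y : ℂ} (γ : Path x y) (I : ℂ) : Prop :=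
  ∃ J : ℝ → ℝ → ℂ,
    (∀ a b : ℝ, 0 < a → a < b → b < 1 → HasLineIntegral f γ.extend a b (J a b)) ∧
    Tendsto (fun p : ℝ × ℝ => J p.1 p.2) (𝓝[>] 0 ×ˢ 𝓝[<] 1) (𝓝 I)

/-- A continuous path of finite length that stays in the cut plane `ℂ*`, except possibly at its
endpoints. -/
def IsAdmissible {x y : ℂ} (γ : Path x y) : Prop :=
  BoundedVariationOn γ Set.univ ∧ ∀ t : unitInterval, t ≠ 0 → t ≠ 1 → γ t ∈ cutPlane

end

end ZetaParam

/-! Differentiating the series of `Z` term by term gives `∑ S_n(s) x^n`, which by Euler's series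
transformation equals `-Li_s(x/(x-1))` (`hasSum_S_mul_pow`). The map `x ↦ x/(x-1)` preserves the
plane cut along `[1,∞)`, so `-Z` is a primitive of the integrand there (`hasDerivAt_Z`). The
integral from `x` to `1` is therefore `Z(s,x) - Z(s,1)` along every path, as soon as `Z` tends to
`Z(s,1)` at the branch point and `Z(s,1) = (s-1)ζ(s)`.

All representations valid for every complex `s` come from one device: pick `k` with `Re(s+k) > 0`,
write `n^{-s} = n^k n^{-(s+k)}`, and use the Gamma integral for the second factor. For `Li_s` this
leaves a Mellin integral of the rational function `kern k`, which continues the series and may be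
taken along a rotated ray. For `S_n` it leaves the integral of a combination of Bernstein
polynomials, whence `S_n(s) = O(n^{-1/2})` locally uniformly in `s`. So `Z(s,1)` converges
absolutely and is entire in `s`; it is computed for real `s > 1` by Mellin transforms and then
everywhere by the identity theorem (`zetaSeries_one_eq`).

At `x = 1` the argument `x/(x-1) = -e^L`, with `L = -log(1/x-1)`, goes to infinity with `|Im L| <
π`. Along the ray of direction `L` the kernel becomes a Fermi–Dirac function, which tends to a step
at `v = 1`; integrating by parts gives `Li_s(-e^L) ~ -L^s/Γ(1+s)`, uniformly up to both sides of the
cut (`tendsto_polylog_neg_exp_div_cpow`). This makes the singularity of the integrand at `1`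
integrable, hence `Z` continuous there. Since `L^s` varies slowly on the segment from `x` to `1`, it
also gives the asymptotics of the integral (`tendsto_integral_pullback_div`). -/

namespace ZetaParam

open MeasureTheory Set

noncomputable section

/-! ### The rational kernel and its Newton expansion -/

/-- Coefficients of the Newton expansion `(m + 1) ^ k = ∑ i, newtonCoeff k i * m.choose i`. -/
def newtonCoeff : ℕ → ℕ → ℂ
  | 0, i => if i = 0 then 1 else 0
  | k + 1, i => (i + 1) * newtonCoeff k i + i * newtonCoeff k (i - 1)

lemma newtonCoeff_eq_zero {k i : ℕ} (h : k < i) : newtonCoeff k i = 0 := by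
  induction k generalizing i with
  | zero => simp [newtonCoeff]; omega
  | succ k ih => simp [newtonCoeff, ih (show k < i by omega), ih (show k < i - 1 by omega)]

/-- Summation by parts moves the recursion from the coefficients to `b`. It is used with binomial
coefficients and with powers. The truncated `i - 1` at `i = 0` is harmless because its factor `i`
vanishes. -/
lemma sum_newtonCoeff_succ (k : ℕ) (b : ℕ → ℂ) :
    ∑ i ∈ Finset.range (k + 2), newtonCoeff (k + 1) i * b i =
      ∑ i ∈ Finset.range (k + 1), newtonCoeff k i * ((i + 1) * (b i + b (i + 1))) := by
  have h1 : ∑ i ∈ Finset.range (k + 2), newtonCoeff (k + 1) i * b i =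
      ∑ i ∈ Finset.range (k + 2), (i + 1) * newtonCoeff k i * b i +
      ∑ i ∈ Finset.range (k + 2), i * newtonCoeff k (i - 1) * b i := by
    rw [← Finset.sum_add_distrib]
    exact Finset.sum_congr rfl fun i _ => by simp only [newtonCoeff]; ring
  rw [h1, Finset.sum_range_succ, newtonCoeff_eq_zero (Nat.lt_succ_self k),
    Finset.sum_range_succ' (n := k + 1)]
  simp only [mul_zero, zero_mul, add_zero, Nat.cast_zero, Nat.add_sub_cancel]
  rw [← Finset.sum_add_distrib]
  exact Finset.sum_congr rfl fun i _ => by push_cast; ring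

lemma sum_newtonCoeff_choose (k m : ℕ) :
    ∑ i ∈ Finset.range (k + 1), newtonCoeff k i * (m.choose i : ℂ) = ((m : ℂ) + 1) ^ k := by
  induction k with
  | zero => simp [newtonCoeff]
  | succ k ih =>
    rw [sum_newtonCoeff_succ, pow_succ, ← ih, Finset.sum_mul]
    refine Finset.sum_congr rfl fun i _ => ?_
    -- Hence `(i+1)(C(m,i) + C(m,i+1)) = (m+1) C(m,i)`, which supplies the extra factor `m + 1`.
    have h : ((i : ℂ) + 1) * (m.choose (i + 1) : ℂ) = ((m : ℂ) - i) * m.choose i := by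
      rcases le_or_gt i m with him | him
      · have := Nat.choose_succ_right_eq m i
        rw [← Nat.cast_sub him]
        exact_mod_cast (by rw [mul_comm, this, mul_comm])
      · simp [Nat.choose_eq_zero_of_lt him, Nat.choose_eq_zero_of_lt (show m < i + 1 by omega)]
    rw [mul_add, h]
    ring

/-- The rational function `∑ m, (m + 1) ^ k * w ^ (m + 1)`, written in powers of `w / (1 - w)`. -/
def kern (k : ℕ) (w : ℂ) : ℂ :=
  ∑ i ∈ Finset.range (k + 1), newtonCoeff k i * (w / (1 - w)) ^ (i + 1)

/-- The series `∑ C(m+i,i) r^m = (1-r)^{-(i+1)}`, reindexed; the terms with `m < i` vanish. -/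
lemma hasSum_choose_mul_pow (i : ℕ) {r : ℂ} (hr : ‖r‖ < 1) :
    HasSum (fun m : ℕ => (m.choose i : ℂ) * r ^ (m + 1)) ((r / (1 - r)) ^ (i + 1)) := by
  have h := (hasSum_choose_mul_geometric_of_norm_lt_one i hr).mul_left (r ^ (i + 1))
  have h2 : HasSum (fun m : ℕ => ((m + i).choose i : ℂ) * r ^ (m + i + 1))
      ((r / (1 - r)) ^ (i + 1)) := by
    rw [div_pow, div_eq_mul_one_div (r ^ (i + 1))]
    exact h.congr_fun fun m => by ring
  have h3 := (hasSum_nat_add_iff (f := fun m : ℕ => (m.choose i : ℂ) * r ^ (m + 1)) i).1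
    (by simpa using h2)
  rwa [Finset.sum_eq_zero, add_zero] at h3
  intro j hj
  simp [Nat.choose_eq_zero_of_lt (Finset.mem_range.1 hj)]

lemma hasSum_kern (k : ℕ) {w : ℂ} (hw : ‖w‖ < 1) :
    HasSum (fun m : ℕ => ((m : ℂ) + 1) ^ k * w ^ (m + 1)) (kern k w) := by
  have h := hasSum_sum (s := Finset.range (k + 1)) fun i _ =>
    (hasSum_choose_mul_pow i hw).mul_left (newtonCoeff k i)
  refine h.congr_fun fun m => ?_
  rw [← sum_newtonCoeff_choose, Finset.sum_mul]
  exact Finset.sum_congr rfl fun i _ => by ring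

lemma differentiableOn_kern (k : ℕ) : DifferentiableOn ℂ (kern k) {1}ᶜ := by
  unfold kern
  refine DifferentiableOn.fun_sum fun i _ => ?_
  refine DifferentiableOn.const_mul (DifferentiableOn.pow (DifferentiableOn.div (by fun_prop)
    (by fun_prop) ?_) _) _
  intro w hw
  exact sub_ne_zero.2 (Ne.symm hw)

/-- On discs around `0` with a neighbourhood of `1` removed, `kern k w` is `O(w)`. -/
lemma norm_kern_le (k : ℕ) {δ : ℝ} (M : ℝ) (hδ : 0 < δ) :
    ∃ C, 0 ≤ C ∧ ∀ w : ℂ, ‖w‖ ≤ M → δ ≤ ‖1 - w‖ →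
      ‖kern k w‖ ≤ C * ‖w‖ ∧ ‖deriv (kern k) w‖ ≤ C := by
  -- The two sums bound `kern k w / w` and the derivative respectively; their total serves for both.
  refine ⟨(∑ i ∈ Finset.range (k + 1), ‖newtonCoeff k i‖ * (|M| / δ) ^ i / δ) +
    (∑ i ∈ Finset.range (k + 1), ‖newtonCoeff k i‖ * ((i + 1) * (|M| / δ) ^ i / δ ^ 2)),
    by positivity, fun w hw hw1 => ?_⟩
  have hY : ‖w / (1 - w)‖ ≤ |M| / δ := by
    rw [norm_div]
    exact div_le_div₀ (abs_nonneg _) (hw.trans (le_abs_self _)) hδ hw1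
  have h0 : 0 ≤ ∑ i ∈ Finset.range (k + 1), ‖newtonCoeff k i‖ * (|M| / δ) ^ i / δ := by
    positivity
  have h0' : 0 ≤ ∑ i ∈ Finset.range (k + 1),
      ‖newtonCoeff k i‖ * ((i + 1) * (|M| / δ) ^ i / δ ^ 2) := by positivity
  have hne : 1 - w ≠ 0 := norm_pos_iff.1 (hδ.trans_le hw1)
  constructor
  · refine le_trans ?_ (mul_le_mul_of_nonneg_right (le_add_of_nonneg_right h0') (norm_nonneg _))
    rw [Finset.sum_mul]
    refine norm_sum_le_of_le _ fun i _ => ?_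
    rw [pow_succ, norm_mul, norm_mul, norm_pow, norm_div w]
    rw [norm_div] at hY
    calc ‖newtonCoeff k i‖ * ((‖w‖ / ‖1 - w‖) ^ i * (‖w‖ / ‖1 - w‖))
        ≤ ‖newtonCoeff k i‖ * ((|M| / δ) ^ i * (‖w‖ / δ)) := by gcongr
      _ = _ := by ring
  · refine le_trans ?_ (le_add_of_nonneg_left h0)
    have hd : HasDerivAt (kern k) (∑ i ∈ Finset.range (k + 1), newtonCoeff k i *
        (((i + 1 : ℕ) : ℂ) * (w / (1 - w)) ^ i * ((1 - w)⁻¹ ^ 2))) w := by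
      refine HasDerivAt.fun_sum fun i _ => ?_
      have h1 : HasDerivAt (fun w : ℂ => w / (1 - w)) ((1 - w)⁻¹ ^ 2) w := by
        refine ((hasDerivAt_id w).div ((hasDerivAt_id w).const_sub 1) hne).congr_deriv ?_
        simp
      exact (h1.pow (i + 1)).const_mul _
    rw [hd.deriv]
    refine norm_sum_le_of_le _ fun i _ => ?_
    rw [norm_mul, norm_mul, norm_mul, norm_pow, norm_pow, norm_inv]
    have : ‖((i + 1 : ℕ) : ℂ)‖ = i + 1 := by rw [Complex.norm_natCast]; push_cast; ring
    rw [this]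
    calc ‖newtonCoeff k i‖ * ((i + 1) * ‖w / (1 - w)‖ ^ i * (‖1 - w‖⁻¹) ^ 2)
        ≤ ‖newtonCoeff k i‖ * ((i + 1) * (|M| / δ) ^ i * (δ⁻¹) ^ 2) := by gcongr
      _ = _ := by rw [inv_pow]; ring

/-! ### Integrals along rays and their holomorphy -/

/-- If the ray `w * exp (-α u)` avoids `1` then it stays away from `1`. -/
lemma exists_le_norm_one_sub {α w : ℂ} (hα : 0 < α.re)
    (hw : ∀ u : ℝ, 0 ≤ u → w * Complex.exp (-α * u) ≠ 1) :
    ∃ δ, 0 < δ ∧ ∀ u : ℝ, 0 ≤ u → δ ≤ ‖1 - w * Complex.exp (-α * u)‖ := by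
  have hlim : Tendsto (fun u : ℝ => ‖1 - w * Complex.exp (-α * u)‖) atTop (𝓝 1) := by
    have h : Tendsto (fun u : ℝ => Complex.exp (-α * u)) atTop (𝓝 0) := by
      rw [tendsto_zero_iff_norm_tendsto_zero]
      simp only [Complex.norm_exp]
      refine Real.tendsto_exp_atBot.comp ?_
      have : (fun u : ℝ => (-α * u).re) = fun u => -(α.re * u) := by ext u; simp
      rw [this]
      exact tendsto_neg_atTop_atBot.comp (tendsto_id.const_mul_atTop hα)
    have := ((h.const_mul w).const_sub 1).norm
    simpa using this
  -- The ray runs into `0`, so its distance to `1` exceeds `1/2` from some point on; before that,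
  -- compactness gives a positive minimum.
  have hev := hlim.eventually (lt_mem_nhds (show (1 / 2 : ℝ) < 1 by norm_num))
  obtain ⟨u0, hu0⟩ := eventually_atTop.1 hev
  have hc : ContinuousOn (fun u : ℝ => ‖1 - w * Complex.exp (-α * u)‖) (Icc 0 (max u0 0)) := by
    fun_prop
  obtain ⟨x, hx, hmin⟩ := isCompact_Icc.exists_isMinOn (nonempty_Icc.2 (le_max_right u0 0)) hc
  refine ⟨min (1 / 2) ‖1 - w * Complex.exp (-α * x)‖,
    lt_min (by norm_num) (norm_pos_iff.2 (sub_ne_zero.2 (hw x hx.1).symm)), fun u hu => ?_⟩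
  rcases le_or_gt u (max u0 0) with h | h
  · exact (min_le_right _ _).trans (hmin ⟨hu, h⟩)
  · exact (min_le_left _ _).trans (hu0 u ((le_max_left _ _).trans h.le)).le

/-- The Mellin type integral `∫ u ^ (a - 1) * kern k (w * exp (-α u))`. -/
def rayIntegral (k : ℕ) (a α w : ℂ) : ℂ :=
  ∫ u in Ioi (0 : ℝ), (u : ℂ) ^ (a - 1) * kern k (w * Complex.exp (-α * u))

lemma integrableOn_rpow_mul_exp {b r : ℝ} (hb : 0 < b) (hr : 0 < r) :
    IntegrableOn (fun u : ℝ => u ^ (b - 1) * Real.exp (-r * u)) (Ioi 0) := by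
  have := integrableOn_rpow_mul_exp_neg_mul_rpow (p := 1) (s := b - 1) (b := r) (by linarith)
    (by norm_num) hr
  simpa using this

lemma continuousOn_cpow_sub_one (a : ℂ) :
    ContinuousOn (fun u : ℝ => (u : ℂ) ^ (a - 1)) (Ioi 0) := by
  intro u hu
  exact (Complex.continuousAt_ofReal_cpow_const u _ (Or.inr (ne_of_gt hu))).continuousWithinAt

lemma continuousOn_ray {k : ℕ} {α w : ℂ}
    (hw : ∀ u : ℝ, 0 ≤ u → w * Complex.exp (-α * u) ≠ 1) :
    ContinuousOn (fun u : ℝ => kern k (w * Complex.exp (-α * u))) (Ioi 0) :=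
  (differentiableOn_kern k).continuousOn.comp (by fun_prop) fun u hu => hw u (le_of_lt hu)

lemma norm_exp_neg_mul (α : ℂ) (u : ℝ) :
    ‖Complex.exp (-α * u)‖ = Real.exp (-α.re * u) := by
  simp [Complex.norm_exp]

lemma norm_exp_neg_mul_le {α : ℂ} (hα : 0 < α.re) {u : ℝ} (hu : 0 ≤ u) :
    ‖Complex.exp (-α * u)‖ ≤ 1 := by
  rw [norm_exp_neg_mul, Real.exp_le_one_iff]
  nlinarith

/-- Differentiation under the integral sign. Since `|exp(-αu)| ≤ 1`, moving `w` by less than `δ/2`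
moves no point of its ray by more than that, so all nearby rays stay `δ/2` away from `1`. The
estimate `kern k w = O(w)` brings the exponential decay of the integrand. A whole neighbourhood is
needed to conclude analyticity later. -/
lemma differentiableAt_rayIntegral (k : ℕ) {a α w : ℂ} (ha : 0 < a.re) (hα : 0 < α.re)
    (hw : ∀ u : ℝ, 0 ≤ u → w * Complex.exp (-α * u) ≠ 1) :
    ∀ᶠ v in 𝓝 w, DifferentiableAt ℂ (rayIntegral k a α) v := by
  obtain ⟨δ, hδ, hδw⟩ := exists_le_norm_one_sub hα hw
  have hball : ∀ v ∈ Metric.ball w (δ / 2), ∀ u : ℝ, 0 ≤ u →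
      δ / 2 ≤ ‖1 - v * Complex.exp (-α * u)‖ := by
    intro v hv u hu
    have h1 := hδw u hu
    have h2 : ‖(v - w) * Complex.exp (-α * u)‖ ≤ δ / 2 := by
      rw [norm_mul]
      have := norm_exp_neg_mul_le hα hu
      have h3 : ‖v - w‖ < δ / 2 := by simpa [dist_eq_norm] using hv
      calc _ ≤ δ / 2 * 1 := by gcongr
        _ = _ := mul_one _
    have h3 : 1 - w * Complex.exp (-α * u) =
      (1 - v * Complex.exp (-α * u)) + (v - w) * Complex.exp (-α * u) := by ring
    have h4 := norm_add_le (1 - v * Complex.exp (-α * u)) ((v - w) * Complex.exp (-α * u))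
    rw [← h3] at h4
    linarith
  have hne : ∀ v ∈ Metric.ball w (δ / 2), ∀ u : ℝ, 0 ≤ u → v * Complex.exp (-α * u) ≠ 1 := by
    intro v hv u hu h
    have := hball v hv u hu
    rw [h] at this
    simp at this
    linarith
  obtain ⟨C, hC0, hC⟩ := norm_kern_le k (‖w‖ + δ / 2) (half_pos hδ)
  have hM : ∀ v ∈ Metric.ball w (δ / 2), ∀ u : ℝ, 0 ≤ u →
      ‖v * Complex.exp (-α * u)‖ ≤ ‖w‖ + δ / 2 := by
    intro v hv u hu
    rw [norm_mul]
    have h3 : ‖v - w‖ < δ / 2 := by simpa [dist_eq_norm] using hv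
    have h4 : ‖v‖ ≤ ‖w‖ + δ / 2 := by
      calc ‖v‖ = ‖w + (v - w)‖ := by ring_nf
        _ ≤ _ := (norm_add_le _ _).trans (by linarith)
    calc _ ≤ (‖w‖ + δ / 2) * 1 := by gcongr; exact norm_exp_neg_mul_le hα hu
      _ = _ := mul_one _
  refine eventually_of_mem (Metric.ball_mem_nhds w (half_pos hδ)) fun v hv => ?_
  have hnhds : Metric.ball w (δ / 2) ∈ 𝓝 v := Metric.isOpen_ball.mem_nhds hv
  have hmeas : ∀ v ∈ Metric.ball w (δ / 2), AEStronglyMeasurable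
      (fun u : ℝ => (u : ℂ) ^ (a - 1) * kern k (v * Complex.exp (-α * u)))
      (volume.restrict (Ioi 0)) := fun v hv =>
    ((continuousOn_cpow_sub_one a).mul (continuousOn_ray (hne v hv))).aestronglyMeasurable
      measurableSet_Ioi
  have hdom := integrableOn_rpow_mul_exp ha hα
  refine (hasDerivAt_integral_of_dominated_loc_of_deriv_le (μ := volume.restrict (Ioi (0 : ℝ)))
    (F := fun v (u : ℝ) => (u : ℂ) ^ (a - 1) * kern k (v * Complex.exp (-α * u)))
    (F' := fun v (u : ℝ) => (u : ℂ) ^ (a - 1) * (deriv (kern k) (v * Complex.exp (-α * u)) *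
      Complex.exp (-α * u)))
    (bound := fun u => C * (u ^ (a.re - 1) * Real.exp (-α.re * u))) hnhds ?_ ?_ ?_ ?_ ?_
    ?_).2.differentiableAt
  · exact eventually_of_mem hnhds hmeas
  · refine Integrable.mono' (hdom.const_mul (C * ‖v‖)) (hmeas v hv) ?_
    refine (ae_restrict_iff' measurableSet_Ioi).2 (ae_of_all _ fun u (hu : 0 < u) => ?_)
    have := (hC _ (hM v hv u hu.le) (hball v hv u hu.le)).1
    rw [norm_mul v, norm_exp_neg_mul] at this
    rw [norm_mul]
    rw [Complex.norm_cpow_eq_rpow_re_of_pos hu]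
    simp only [Complex.sub_re, Complex.one_re]
    calc _ ≤ u ^ (a.re - 1) * (C * (‖v‖ * Real.exp (-α.re * u))) := by gcongr
      _ = _ := by ring
  · refine ((continuousOn_cpow_sub_one a).mul (ContinuousOn.mul ?_ (by fun_prop))).aestronglyMeasurable
      measurableSet_Ioi
    have : ContinuousOn (deriv (kern k)) {1}ᶜ :=
      ((differentiableOn_kern k).deriv isOpen_compl_singleton).continuousOn
    exact this.comp (by fun_prop) fun u hu => hne v hv u (le_of_lt hu)
  · refine (ae_restrict_iff' measurableSet_Ioi).2 (ae_of_all _ fun u (hu : 0 < u) v hv => ?_)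
    have := (hC _ (hM v hv u hu.le) (hball v hv u hu.le)).2
    rw [norm_mul, norm_mul, norm_exp_neg_mul]
    rw [Complex.norm_cpow_eq_rpow_re_of_pos hu]
    simp only [Complex.sub_re, Complex.one_re]
    calc _ ≤ u ^ (a.re - 1) * (C * (Real.exp (-α.re * u))) := by gcongr
      _ = _ := by ring
  · exact hdom.const_mul C
  · refine (ae_restrict_iff' measurableSet_Ioi).2 (ae_of_all _ fun u (hu : 0 < u) v hv => ?_)
    have h1 : DifferentiableAt ℂ (kern k) (v * Complex.exp (-α * u)) :=
      (differentiableOn_kern k).differentiableAt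
        (isOpen_compl_singleton.mem_nhds (hne v hv u hu.le))
    have h2 : HasDerivAt (fun v : ℂ => v * Complex.exp (-α * u)) (Complex.exp (-α * u)) v := by
      simpa using (hasDerivAt_id v).mul_const (Complex.exp (-α * u))
    exact (h1.hasDerivAt.comp v h2).const_mul _

/-! ### The Gamma integral and the polylogarithm series -/

/-- The Gamma integral along a rotated ray. -/
lemma integral_cpow_mul_exp_neg_mul_Ioi_of_re_pos {a α : ℂ} (ha : 0 < a.re) (hα : 0 < α.re) :
    ∫ u in Ioi (0 : ℝ), (u : ℂ) ^ (a - 1) * Complex.exp (-α * u) = Complex.Gamma a / α ^ a := by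
  set U : Set ℂ := {z | 0 < z.re} with hU
  have hUo : IsOpen U := isOpen_lt continuous_const Complex.continuous_re
  have hUc : IsPreconnected U := (convex_halfSpace_re_gt 0).isPreconnected
  have hne : ∀ z ∈ U, z ≠ 0 := by rintro z hz rfl; simp [hU] at hz
  have hslit : ∀ z ∈ U, z ∈ Complex.slitPlane := fun z hz => Or.inl hz
  have hf : DifferentiableOn ℂ
      (fun α : ℂ => ∫ u in Ioi (0 : ℝ), (u : ℂ) ^ (a - 1) * Complex.exp (-α * u)) U := by
    intro z hz
    have hz' : 0 < z.re := hz
    have hmeas : ∀ v : ℂ, AEStronglyMeasurable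
        (fun u : ℝ => (u : ℂ) ^ (a - 1) * Complex.exp (-v * u)) (volume.restrict (Ioi 0)) :=
      fun v => ((continuousOn_cpow_sub_one a).mul (by fun_prop)).aestronglyMeasurable
        measurableSet_Ioi
    have hnorm : ∀ (v : ℂ) (u : ℝ), 0 < u → ‖(u : ℂ) ^ (a - 1) * Complex.exp (-v * u)‖ =
        u ^ (a.re - 1) * Real.exp (-v.re * u) := by
      intro v u hu
      rw [norm_mul, Complex.norm_cpow_eq_rpow_re_of_pos hu, norm_exp_neg_mul]
      simp
    have hnhds : {v : ℂ | z.re / 2 < v.re} ∈ 𝓝 z :=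
      (isOpen_lt continuous_const Complex.continuous_re).mem_nhds (show z.re / 2 < z.re by linarith)
    refine (hasDerivAt_integral_of_dominated_loc_of_deriv_le (μ := volume.restrict (Ioi (0 : ℝ)))
      (F := fun v (u : ℝ) => (u : ℂ) ^ (a - 1) * Complex.exp (-v * u))
      (F' := fun v (u : ℝ) => (u : ℂ) ^ (a - 1) * (Complex.exp (-v * u) * (-u)))
      (bound := fun u => u ^ (a.re + 1 - 1) * Real.exp (-(z.re / 2) * u)) hnhds
      (Eventually.of_forall hmeas) ?_ ?_ ?_ ?_ ?_).2.differentiableAt.differentiableWithinAt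
    · refine Integrable.mono' (integrableOn_rpow_mul_exp ha hz') (hmeas z) ?_
      exact (ae_restrict_iff' measurableSet_Ioi).2 (ae_of_all _ fun u hu => (hnorm z u hu).le)
    · exact ((continuousOn_cpow_sub_one a).mul (by fun_prop)).aestronglyMeasurable
        measurableSet_Ioi
    · refine (ae_restrict_iff' measurableSet_Ioi).2 (ae_of_all _ fun u (hu : 0 < u) v hv => ?_)
      have hv' : z.re / 2 < v.re := hv
      rw [← mul_assoc, norm_mul, hnorm v u hu, norm_neg, Complex.norm_real, Real.norm_of_nonneg hu.le,
        add_sub_right_comm, Real.rpow_add_one hu.ne']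
      have : Real.exp (-v.re * u) ≤ Real.exp (-(z.re / 2) * u) := by
        apply Real.exp_le_exp.2; nlinarith
      calc _ = u ^ (a.re - 1) * u * Real.exp (-v.re * u) := by ring
        _ ≤ _ := by gcongr
    · exact integrableOn_rpow_mul_exp (by linarith) (by linarith)
    · refine ae_of_all _ fun u v _ => ?_
      refine HasDerivAt.const_mul _ ?_
      have h1 : HasDerivAt (fun v : ℂ => -v * (u : ℂ)) (-(u : ℂ)) v := by
        simpa using (hasDerivAt_id v).neg.mul_const (u : ℂ)
      exact h1.cexp
  have hg : DifferentiableOn ℂ (fun α : ℂ => Complex.Gamma a / α ^ a) U := by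
    intro z hz
    refine (DifferentiableAt.div (differentiableAt_const _)
      (differentiableAt_id.cpow_const (hslit z hz)) ?_).differentiableWithinAt
    simp [Complex.cpow_eq_zero_iff, hne z hz]
  -- Both sides are holomorphic in `α` on the right half-plane and agree at the real points `1 +
  -- 1/(n+1)`, which accumulate at `1`.
  refine (hf.analyticOnNhd hUo).eqOn_of_preconnected_of_frequently_eq (hg.analyticOnNhd hUo) hUc
    (z₀ := 1) (by simp [hU]) ?_ hα
  have hreal : ∀ r : ℝ, 0 < r → ∫ u in Ioi (0 : ℝ), (u : ℂ) ^ (a - 1) * Complex.exp (-(r : ℂ) * u) =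
      Complex.Gamma a / (r : ℂ) ^ a := by
    intro r hr
    have := Complex.integral_cpow_mul_exp_neg_mul_Ioi ha hr
    simp only [neg_mul] at this ⊢
    rw [this, one_div, Complex.inv_cpow_ofReal_nonneg hr.le]
    ring
  have hseq : Tendsto (fun n : ℕ => (((1 : ℝ) + 1 / ((n : ℝ) + 1) : ℝ) : ℂ)) atTop (𝓝[≠] 1) := by
    refine tendsto_nhdsWithin_iff.2 ⟨?_, Eventually.of_forall fun n => ?_⟩
    · have := (tendsto_one_div_add_atTop_nhds_zero_nat (𝕜 := ℝ)).const_add 1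
      rw [add_zero] at this
      exact (Complex.continuous_ofReal.tendsto' 1 1 (by simp)).comp this
    · have : (0 : ℝ) < 1 / ((n : ℝ) + 1) := by positivity
      simp only [mem_compl_iff, mem_singleton_iff]
      intro h
      have h2 : (1 : ℝ) + 1 / ((n : ℝ) + 1) = 1 := by exact_mod_cast h
      linarith
  exact hseq.frequently (Frequently.of_forall fun n => hreal _ (by positivity))

/-- Because `m + 1 > 0`, `log((m+1)α) = log(m+1) + log α` holds without branch correction and the
power splits. -/
lemma integral_cpow_mul_exp_nat {a α : ℂ} (ha : 0 < a.re) (hα : 0 < α.re) (m : ℕ) :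
    ∫ u in Ioi (0 : ℝ), (u : ℂ) ^ (a - 1) * Complex.exp (-(((m : ℂ) + 1) * α) * u) =
      ((m : ℂ) + 1) ^ (-a) * (Complex.Gamma a / α ^ a) := by
  have hm : (0 : ℝ) < (m : ℝ) + 1 := by positivity
  have hα0 : α ≠ 0 := by rintro rfl; simp at hα
  have hcast : ((m : ℂ) + 1) = (((m : ℝ) + 1 : ℝ) : ℂ) := by push_cast; rfl
  have hre : 0 < (((m : ℂ) + 1) * α).re := by rw [hcast, Complex.re_ofReal_mul]; positivity
  have h0 : ((m : ℂ) + 1) ≠ 0 := by rw [hcast]; exact_mod_cast hm.ne'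
  rw [integral_cpow_mul_exp_neg_mul_Ioi_of_re_pos ha hre,
    Complex.cpow_def_of_ne_zero (mul_ne_zero h0 hα0), hcast, Complex.log_ofReal_mul hm hα0,
    add_mul, Complex.exp_add, Complex.cpow_neg, Complex.cpow_def_of_ne_zero hα0,
    Complex.cpow_def_of_ne_zero (by rw [← hcast]; exact h0), Complex.ofReal_log hm.le]
  field_simp

/-- On the unit disc the ray integral is the polylogarithm series. -/
lemma rayIntegral_eq_polylogSeries (k : ℕ) {s α w : ℂ} (ha : 0 < (s + k).re) (hα : 0 < α.re)
    (hw : ‖w‖ < 1) :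
    α ^ (s + k) / Complex.Gamma (s + k) * rayIntegral k (s + k) α w = polylogSeries s w := by
  have hα0 : α ≠ 0 := by rintro rfl; simp at hα
  set a := s + k with haa
  have hG : Complex.Gamma a ≠ 0 := Complex.Gamma_ne_zero_of_re_pos ha
  have hαa : α ^ a ≠ 0 := by simp [Complex.cpow_eq_zero_iff, hα0]
  have hnorm : ∀ u : ℝ, 0 ≤ u → ‖w * Complex.exp (-α * u)‖ < 1 := by
    intro u hu
    rw [norm_mul]
    calc _ ≤ ‖w‖ * 1 := by gcongr; exact norm_exp_neg_mul_le hα hu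
      _ < 1 := by simpa
  have hterm : ∀ (m : ℕ) (u : ℝ), (u : ℂ) ^ (a - 1) * (((m : ℂ) + 1) ^ k *
      (w * Complex.exp (-α * u)) ^ (m + 1)) = (((m : ℂ) + 1) ^ k * w ^ (m + 1)) *
      ((u : ℂ) ^ (a - 1) * Complex.exp (-(((m : ℂ) + 1) * α) * u)) := by
    intro m u
    rw [mul_pow, ← Complex.exp_nat_mul]
    push_cast
    ring_nf
  have hnormterm : ∀ (m : ℕ) (u : ℝ), 0 < u → ‖(u : ℂ) ^ (a - 1) * (((m : ℂ) + 1) ^ k *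
      (w * Complex.exp (-α * u)) ^ (m + 1))‖ ≤ (((m : ℝ) + 1) ^ k * ‖w‖ ^ (m + 1)) *
      (u ^ (a.re - 1) * Real.exp (-α.re * u)) := by
    intro m u hu
    have h1 : ‖((m : ℂ) + 1)‖ = (m : ℝ) + 1 := by
      have : ((m : ℂ) + 1) = ((m + 1 : ℕ) : ℂ) := by push_cast; rfl
      rw [this, Complex.norm_natCast]; push_cast; rfl
    rw [norm_mul, norm_mul, norm_pow, norm_pow, h1, norm_mul, mul_pow,
      Complex.norm_cpow_eq_rpow_re_of_pos hu]
    have h2 : ‖Complex.exp (-α * u)‖ ^ (m + 1) ≤ Real.exp (-α.re * u) := by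
      rw [← norm_exp_neg_mul]
      exact pow_le_of_le_one (norm_nonneg _) (norm_exp_neg_mul_le hα hu.le) (by omega)
    simp only [Complex.sub_re, Complex.one_re]
    calc _ ≤ u ^ (a.re - 1) * (((m : ℝ) + 1) ^ k * (‖w‖ ^ (m + 1) * Real.exp (-α.re * u))) := by
          gcongr
      _ = _ := by ring
  have hdom := integrableOn_rpow_mul_exp ha hα
  have hsummable : Summable fun m : ℕ => ((m : ℝ) + 1) ^ k * ‖w‖ ^ (m + 1) := by
    have := (summable_pow_mul_geometric_of_norm_lt_one (R := ℝ) k (r := ‖w‖) (by simpa using hw))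
    have h2 := (summable_nat_add_iff 1).2 this
    simpa using h2
  have hS : HasSum (fun m : ℕ => ∫ u in Ioi (0 : ℝ), (u : ℂ) ^ (a - 1) * (((m : ℂ) + 1) ^ k *
      (w * Complex.exp (-α * u)) ^ (m + 1))) (rayIntegral k a α w) := by
    refine hasSum_integral_of_dominated_convergence (fun m u => (((m : ℝ) + 1) ^ k *
      ‖w‖ ^ (m + 1)) * (u ^ (a.re - 1) * Real.exp (-α.re * u))) ?_ ?_ ?_ ?_ ?_
    · intro m
      refine ((continuousOn_cpow_sub_one a).mul (by fun_prop)).aestronglyMeasurable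
        measurableSet_Ioi
    · intro m
      exact (ae_restrict_iff' measurableSet_Ioi).2 (ae_of_all _ fun u (hu : 0 < u) =>
        hnormterm m u hu)
    · exact ae_of_all _ fun u => hsummable.mul_right _
    · simp_rw [tsum_mul_right]
      exact hdom.const_mul _
    · exact (ae_restrict_iff' measurableSet_Ioi).2 (ae_of_all _ fun u (hu : 0 < u) =>
        (hasSum_kern k (hnorm u hu.le)).mul_left _)
  have hS2 := hS.mul_left (α ^ a / Complex.Gamma a)
  rw [polylogSeries, ← hS2.tsum_eq]
  refine tsum_congr fun m => ?_
  simp_rw [hterm]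
  rw [integral_const_mul, integral_cpow_mul_exp_nat ha hα]
  have h0 : ((m : ℂ) + 1) ≠ 0 := by exact_mod_cast (Nat.succ_ne_zero m)
  -- The factor `(m+1)^k` of the kernel undoes the shift of the exponent from `s` to `s + k`.
  have h3 : ((m : ℂ) + 1) ^ (-a) = (((m : ℂ) + 1) ^ s)⁻¹ * (((m : ℂ) + 1) ^ k)⁻¹ := by
    rw [haa, Complex.cpow_neg, Complex.cpow_add _ _ h0, Complex.cpow_natCast, mul_inv]
  rw [h3]
  have h4 : ((m : ℂ) + 1) ^ s ≠ 0 := by simp [Complex.cpow_eq_zero_iff, h0]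
  field_simp

/-! ### The polylogarithm on the cut plane -/

lemma mem_cutAtOne {w : ℂ} : w ∈ cutAtOne ↔ ∀ r : ℝ, 1 ≤ r → (r : ℂ) ≠ w := by
  simp [cutAtOne]

lemma isOpen_cutAtOne : IsOpen cutAtOne :=
  ((Complex.isUniformEmbedding_ofReal.isClosedEmbedding.isClosedMap _) isClosed_Ici).isOpen_compl

lemma smul_mem_cutAtOne {w : ℂ} (hw : w ∈ cutAtOne) {r : ℝ} (hr0 : 0 ≤ r) (hr1 : r ≤ 1) :
    (r : ℂ) * w ∈ cutAtOne := by
  rw [mem_cutAtOne] at hw ⊢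
  intro t ht h
  rcases hr0.eq_or_lt with rfl | hr
  · simp at h; linarith
  · refine hw (t / r) ((one_le_div hr).2 (hr1.trans ht)) ?_
    rw [Complex.ofReal_div, h]
    field_simp [hr.ne']

lemma ball_subset_cutAtOne : Metric.ball (0 : ℂ) 1 ⊆ cutAtOne := by
  intro w hw
  rw [mem_cutAtOne]
  rintro r hr rfl
  simp at hw
  linarith [le_abs_self r]

lemma starConvex_cutAtOne : StarConvex ℝ (0 : ℂ) cutAtOne := by
  rw [starConvex_zero_iff]
  intro w hw r hr0 hr1
  simpa using smul_mem_cutAtOne hw hr0 hr1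

lemma isPreconnected_cutAtOne : IsPreconnected cutAtOne :=
  (starConvex_cutAtOne.isPathConnected (ball_subset_cutAtOne (by simp))).isConnected.isPreconnected

lemma ray_ne_one_of_mem_cutAtOne {w : ℂ} (hw : w ∈ cutAtOne) (u : ℝ) (hu : 0 ≤ u) :
    w * Complex.exp (-1 * u) ≠ 1 := by
  intro h
  refine mem_cutAtOne.1 hw (Real.exp u) (Real.one_le_exp hu) ?_
  have h1 : ((Real.exp u : ℝ) : ℂ) * Complex.exp (-1 * u) = 1 := by
    rw [Complex.ofReal_exp, ← Complex.exp_add]; simp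
  exact mul_right_cancel₀ (Complex.exp_ne_zero _) (h1.trans h.symm)

/-- `Re(s+k) > 0` makes the Mellin integral converge at `0`. `1 ≤ k` is for the behaviour at
infinity, where the kernel must be a derivative. -/
lemma exists_shift (s : ℂ) : ∃ k : ℕ, 1 ≤ k ∧ 0 < (s + k).re := by
  obtain ⟨n, hn⟩ := exists_nat_gt (-s.re)
  refine ⟨n + 1, by omega, ?_⟩
  simp
  linarith

/-- One continuation suffices for `Classical.epsilon`: the ray integral with `α = 1`, whose ray `w
e^{-u}` hits `1` only if `w = e^u ≥ 1`. -/
lemma isContinuation_polylog (s : ℂ) : IsContinuation (polylogSeries s) (polylog s) := by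
  refine Classical.epsilon_spec (p := IsContinuation (polylogSeries s)) ?_
  obtain ⟨k, -, hk⟩ := exists_shift s
  refine ⟨fun w => 1 ^ (s + k) / Complex.Gamma (s + k) * rayIntegral k (s + k) 1 w, ?_, ?_⟩
  · intro w hw
    exact ((differentiableAt_rayIntegral k hk (by simp)
      (ray_ne_one_of_mem_cutAtOne hw)).self_of_nhds.const_mul _).differentiableWithinAt
  · intro w hw
    exact rayIntegral_eq_polylogSeries k hk (by simp) (by simpa using hw)

/-- The polylogarithm as a ray integral, as long as the ray never meets the cut. -/
lemma polylog_eq_rayIntegral (k : ℕ) {s α w : ℂ} (ha : 0 < (s + k).re) (hα : 0 < α.re)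
    (hw : w ∈ cutAtOne) (hray : ∀ r : ℝ, 0 ≤ r → r ≤ 1 → ∀ u : ℝ, 0 ≤ u →
      r * w * Complex.exp (-α * u) ≠ 1) :
    polylog s w = α ^ (s + k) / Complex.Gamma (s + k) * rayIntegral k (s + k) α w := by
  have hf : AnalyticOnNhd ℂ (polylog s) (segment ℝ 0 w) := by
    intro z hz
    refine (isContinuation_polylog s).1.analyticAt (isOpen_cutAtOne.mem_nhds ?_)
    exact starConvex_cutAtOne.segment_subset hw hz
  have hg : AnalyticOnNhd ℂ (fun w => α ^ (s + k) / Complex.Gamma (s + k) *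
      rayIntegral k (s + k) α w) (segment ℝ 0 w) := by
    rw [segment_eq_image]
    rintro _ ⟨r, hr, rfl⟩
    refine analyticAt_const.mul (Complex.analyticAt_iff_eventually_differentiableAt.2
      (differentiableAt_rayIntegral k ha hα ?_))
    intro u hu
    simpa using hray r hr.1 hr.2 u hu
  -- The identity theorem is applied on neighbourhoods of the segment `[0, w]` alone, as the rays
  -- are only controlled from the points `r * w`.
  refine hf.eqOn_of_preconnected_of_eventuallyEq hg (convex_segment _ _).isPreconnected
    (left_mem_segment ℝ 0 w) ?_ (right_mem_segment ℝ 0 w)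
  refine eventually_of_mem (Metric.ball_mem_nhds 0 one_pos) fun z hz => ?_
  simp only [(isContinuation_polylog s).2 hz]
  rw [rayIntegral_eq_polylogSeries k ha hα (by simpa using hz)]

/-! ### The polylogarithm at infinity -/

/-- Real part tending to `+∞` inside the strip `|Im L| < π`. -/
def stripFilter : Filter ℂ := comap Complex.re atTop ⊓ 𝓟 {L | |L.im| < Real.pi}

instance : IsCountablyGenerated stripFilter := by
  unfold stripFilter; infer_instance

lemma tendsto_re_stripFilter : Tendsto Complex.re stripFilter atTop :=
  tendsto_comap.mono_left inf_le_left

lemma eventually_stripFilter (B : ℝ) : ∀ᶠ L in stripFilter, B ≤ L.re ∧ |L.im| < Real.pi :=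
  (tendsto_re_stripFilter.eventually (eventually_ge_atTop B)).and
    (mem_inf_of_right (mem_principal_self _))

/-- The kernel in the logarithmic variable. -/
def foldKern (k : ℕ) (u : ℂ) : ℂ := kern k (-Complex.exp u)

lemma foldKern_eq (k : ℕ) (u : ℂ) : foldKern k u = ∑ i ∈ Finset.range (k + 1),
    newtonCoeff k i * (-Complex.exp u / (1 + Complex.exp u)) ^ (i + 1) := by
  simp [foldKern, kern]

lemma foldKern_zero_eq (u : ℂ) : foldKern 0 u = -Complex.exp u / (1 + Complex.exp u) := by
  simp [foldKern_eq, newtonCoeff]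

/-- With `Y = -e^u/(1+e^u)` one has `1/(1+e^u) = 1 + Y`. The exposed factor `Y(1+Y) = Y'` gives the
derivative formula, and its second half gives decay as `Re u → +∞`, which `foldKern 0` lacks. -/
lemma foldKern_succ_eq (k : ℕ) (u : ℂ) (hu : 1 + Complex.exp u ≠ 0) :
    foldKern (k + 1) u = (∑ i ∈ Finset.range (k + 1), newtonCoeff k i * ((i + 1) *
      (-Complex.exp u / (1 + Complex.exp u)) ^ i)) *
      ((-Complex.exp u / (1 + Complex.exp u)) * (1 / (1 + Complex.exp u))) := by
  rw [foldKern_eq, sum_newtonCoeff_succ k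
    (fun i => (-Complex.exp u / (1 + Complex.exp u)) ^ (i + 1)), Finset.sum_mul]
  refine Finset.sum_congr rfl fun i _ => ?_
  have : 1 / (1 + Complex.exp u) = 1 + (-Complex.exp u / (1 + Complex.exp u)) := by
    field_simp; ring
  rw [this]
  ring

/-- For `w = -e^u`, `d/du` is `w d/dw`, which raises the exponent in `∑ (m+1)^k w^{m+1}` by one. -/
lemma hasDerivAt_foldKern (k : ℕ) {u : ℂ} (hu : 1 + Complex.exp u ≠ 0) :
    HasDerivAt (foldKern k) (foldKern (k + 1) u) u := by
  rw [foldKern_succ_eq k u hu, Finset.sum_mul]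
  have : foldKern k = fun u => ∑ i ∈ Finset.range (k + 1),
    newtonCoeff k i * (-Complex.exp u / (1 + Complex.exp u)) ^ (i + 1) := funext (foldKern_eq k)
  rw [this]
  refine HasDerivAt.fun_sum fun i _ => ?_
  have h1 : HasDerivAt (fun u => -Complex.exp u / (1 + Complex.exp u))
      ((-Complex.exp u / (1 + Complex.exp u)) * (1 / (1 + Complex.exp u))) u := by
    refine ((Complex.hasDerivAt_exp u).neg.div ((Complex.hasDerivAt_exp u).const_add 1)
      hu).congr_deriv ?_
    field_simp
    simp only [Pi.neg_apply]
    ring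
  refine ((h1.pow (i + 1)).const_mul (newtonCoeff k i)).congr_deriv ?_
  push_cast
  ring_nf

/-- For `|x| ≤ 1/2` the imaginary part of `Lx` is at most `π/2` in size, so `e^{Lx}` has nonnegative
real part. For `|x| > 1/2`, `Re L ≥ 2` forces `|e^{Lx}| ≥ e` or `|e^{Lx}| ≤ 1/e`. The bound is thus
uniform up to the edges of the strip. -/
lemma half_le_norm_one_add_exp {L : ℂ} (hre : 2 ≤ L.re) (him : |L.im| < Real.pi) (x : ℝ) :
    1 / 2 ≤ ‖1 + Complex.exp (L * x)‖ := by
  have hr : (L * x).re = L.re * x := by simp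
  have hi : (L * x).im = L.im * x := by simp
  have hn : ‖Complex.exp (L * x)‖ = Real.exp (L.re * x) := by rw [Complex.norm_exp, hr]
  have he1 : (2 : ℝ) ≤ Real.exp 1 := by linarith [Real.add_one_le_exp (1 : ℝ)]
  rcases le_or_gt |x| (1 / 2) with hx | hx
  · have h1 : |(L * x).im| ≤ Real.pi / 2 := by
      rw [hi, abs_mul]
      have := mul_le_mul him.le hx (abs_nonneg _) Real.pi_pos.le
      linarith
    have h2 : 0 ≤ (Complex.exp (L * x)).re := by
      rw [Complex.exp_re]
      exact mul_nonneg (Real.exp_pos _).le (Real.cos_nonneg_of_mem_Icc (abs_le.1 h1 |>.imp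
        (by intro h; linarith) id))
    have h3 := Complex.re_le_norm (1 + Complex.exp (L * x))
    simp only [Complex.add_re, Complex.one_re] at h3
    linarith
  · rcases lt_abs.1 hx with h | h
    · have h1 : Real.exp 1 ≤ Real.exp (L.re * x) := Real.exp_le_exp.2 (by nlinarith)
      have h2 := norm_sub_norm_le (Complex.exp (L * x)) (-1)
      simp only [sub_neg_eq_add, norm_neg, norm_one, hn] at h2
      rw [add_comm]
      linarith
    · have h1 : Real.exp (L.re * x) ≤ Real.exp (-1) := Real.exp_le_exp.2 (by nlinarith)
      have h3 : Real.exp (-1) ≤ 1 / 2 := by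
        rw [Real.exp_neg, one_div]
        exact inv_anti₀ (by norm_num) he1
      have h2 := norm_sub_norm_le (1 : ℂ) (-Complex.exp (L * x))
      simp only [sub_neg_eq_add, norm_neg, norm_one, hn] at h2
      linarith

lemma one_add_exp_ne_zero {L : ℂ} (hre : 2 ≤ L.re) (him : |L.im| < Real.pi) (x : ℝ) :
    1 + Complex.exp (L * x) ≠ 0 := by
  rw [← norm_pos_iff]
  linarith [half_le_norm_one_add_exp hre him x]

lemma norm_inv_one_add_exp_le {L : ℂ} (hre : 2 ≤ L.re) (him : |L.im| < Real.pi) (x : ℝ) :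
    ‖1 / (1 + Complex.exp (L * x))‖ ≤ 2 ∧
    ‖1 / (1 + Complex.exp (L * x))‖ ≤ 2 * Real.exp (-(L.re * x)) := by
  have h1 := half_le_norm_one_add_exp hre him x
  have h2 := half_le_norm_one_add_exp hre him (-x)
  have h3 : 1 + Complex.exp (L * x) = Complex.exp (L * x) * (1 + Complex.exp (L * (-x : ℝ))) := by
    rw [mul_add, ← Complex.exp_add]
    simp
    ring
  constructor
  · rw [norm_div, norm_one, div_le_iff₀ (by linarith)]
    linarith
  · rw [h3, norm_div, norm_mul, norm_one, Complex.norm_exp, Real.exp_neg]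
    have : (L * x).re = L.re * x := by simp
    rw [this, one_div, mul_inv, mul_comm]
    gcongr
    rw [inv_le_comm₀ (by linarith) (by norm_num)]
    linarith

lemma norm_exp_div_one_add_exp_le {L : ℂ} (hre : 2 ≤ L.re) (him : |L.im| < Real.pi) (x : ℝ) :
    ‖-Complex.exp (L * x) / (1 + Complex.exp (L * x))‖ ≤ 2 ∧
    ‖-Complex.exp (L * x) / (1 + Complex.exp (L * x))‖ ≤ 2 * Real.exp (L.re * x) := by
  have h := norm_inv_one_add_exp_le hre him (-x)
  have h1 := one_add_exp_ne_zero hre him (-x)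
  have h2 := one_add_exp_ne_zero hre him x
  have h3 : -Complex.exp (L * x) / (1 + Complex.exp (L * x)) =
      -(1 / (1 + Complex.exp (L * (-x : ℝ)))) := by
    rw [neg_div, neg_inj, div_eq_div_iff h2 h1, mul_add, ← Complex.exp_add]
    simp
    ring
  rw [h3, norm_neg]
  refine ⟨h.1, h.2.trans (by simp)⟩

/-- The rate `2` is the least admitted `Re L`, so the bound does not depend on `L` and can dominate
integrals in `v = 1 - x`. -/
lemma norm_foldKern_le (k : ℕ) : ∃ C, 0 ≤ C ∧ ∀ L : ℂ, 2 ≤ L.re → |L.im| < Real.pi → ∀ x : ℝ,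
    ‖foldKern k (L * x)‖ ≤ C * Real.exp (2 * x) := by
  refine ⟨∑ i ∈ Finset.range (k + 1), ‖newtonCoeff k i‖ * (2 ^ i * 2), by positivity,
    fun L hre him x => ?_⟩
  obtain ⟨h1, h2⟩ := norm_exp_div_one_add_exp_le hre him x
  have h3 : ‖-Complex.exp (L * x) / (1 + Complex.exp (L * x))‖ ≤ 2 * Real.exp (2 * x) := by
    rcases le_total 0 x with hx | hx
    · exact h1.trans (by linarith [Real.one_le_exp (show 0 ≤ 2 * x by linarith)])
    · refine h2.trans (mul_le_mul_of_nonneg_left (Real.exp_le_exp.2 ?_) (by norm_num))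
      nlinarith
  rw [foldKern_eq, Finset.sum_mul]
  refine norm_sum_le_of_le _ fun i _ => ?_
  rw [norm_mul, norm_pow, pow_succ]
  calc _ ≤ ‖newtonCoeff k i‖ * (2 ^ i * (2 * Real.exp (2 * x))) := by gcongr
    _ = _ := by ring

lemma norm_foldKern_succ_le (k : ℕ) : ∃ C, 0 ≤ C ∧ ∀ L : ℂ, 2 ≤ L.re → |L.im| < Real.pi →
    ∀ x : ℝ, 0 ≤ x → ‖foldKern (k + 1) (L * x)‖ ≤ C * Real.exp (-(L.re * x)) := by
  refine ⟨(∑ i ∈ Finset.range (k + 1), ‖newtonCoeff k i‖ * ((i + 1) * 2 ^ i)) * 4, by positivity,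
    fun L hre him x hx => ?_⟩
  obtain ⟨h1, -⟩ := norm_exp_div_one_add_exp_le hre him x
  obtain ⟨-, h2⟩ := norm_inv_one_add_exp_le hre him x
  rw [foldKern_succ_eq k _ (one_add_exp_ne_zero hre him x), norm_mul, norm_mul, mul_assoc]
  refine mul_le_mul (norm_sum_le_of_le _ fun i _ => ?_) ?_ (by positivity) (by positivity)
  · rw [norm_mul, norm_mul, norm_pow]
    have : ‖((i : ℂ) + 1)‖ = (i : ℝ) + 1 := by
      rw [show ((i : ℂ) + 1) = ((i + 1 : ℕ) : ℂ) by push_cast; rfl, Complex.norm_natCast]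
      push_cast; rfl
    rw [this]
    gcongr
  · calc _ ≤ 2 * (2 * Real.exp (-(L.re * x))) := by gcongr
      _ = _ := by ring

lemma hasDerivAt_foldKern_ray (k : ℕ) {L : ℂ} (hre : 2 ≤ L.re) (him : |L.im| < Real.pi) (v : ℝ) :
    HasDerivAt (fun v : ℝ => foldKern k (L * (1 - v : ℝ)))
      (-L * foldKern (k + 1) (L * (1 - v : ℝ))) v := by
  have h1 := hasDerivAt_foldKern k (one_add_exp_ne_zero hre him (1 - v))
  have h2 : HasDerivAt (fun v : ℝ => L * ((1 - v : ℝ) : ℂ)) (-L) v := by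
    have := (((hasDerivAt_id v).const_sub 1).ofReal_comp).const_mul L
    simpa using this
  exact (h1.comp v h2).congr_deriv (mul_comm _ _)

lemma continuous_foldKern_ray (k : ℕ) {L : ℂ} (hre : 2 ≤ L.re) (him : |L.im| < Real.pi) :
    Continuous fun v : ℝ => foldKern k (L * (1 - v : ℝ)) :=
  continuous_iff_continuousAt.2 fun v => (hasDerivAt_foldKern_ray k hre him v).continuousAt

lemma integrableOn_rpow_mul_exp_Ioi (β : ℝ) :
    IntegrableOn (fun v : ℝ => v ^ β * Real.exp (2 * (1 - v))) (Ioi (1 / 2)) := by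
  have h0 : IntegrableOn (fun v : ℝ => v ^ (|β| + 1 - 1) * Real.exp (-2 * v)) (Ioi (1 / 2)) :=
    (integrableOn_rpow_mul_exp (by positivity) (by norm_num)).mono_set
      (Ioi_subset_Ioi (by norm_num))
  refine Integrable.mono' (h0.const_mul (2 ^ (-β) * 2 ^ |β| * Real.exp 2)) ?_ ?_
  · refine ContinuousOn.aestronglyMeasurable ?_ measurableSet_Ioi
    refine ContinuousOn.mul (fun v hv => ?_) (by fun_prop)
    exact (Real.continuousAt_rpow_const v β (Or.inl (ne_of_gt
      (lt_trans (by norm_num) (mem_Ioi.1 hv))))).continuousWithinAt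
  · refine (ae_restrict_iff' measurableSet_Ioi).2 (ae_of_all _ fun v (hv : 1 / 2 < v) => ?_)
    have hv0 : 0 < v := lt_trans (by norm_num) hv
    rw [Real.norm_of_nonneg (by positivity)]
    -- As `2v > 1`, the exponent `β` can be raised to `|β|`, which is integrable at `0`.
    have h1 : v ^ β = 2 ^ (-β) * (2 * v) ^ β := by
      rw [Real.mul_rpow (by norm_num) hv0.le, ← mul_assoc, ← Real.rpow_add (by norm_num)]
      simp
    have h2 : (2 * v) ^ β ≤ 2 ^ |β| * v ^ |β| := by
      rw [← Real.mul_rpow (by norm_num) hv0.le]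
      exact Real.rpow_le_rpow_of_exponent_le (by linarith) (le_abs_self β)
    have h3 : Real.exp (2 * (1 - v)) = Real.exp 2 * Real.exp (-2 * v) := by
      rw [← Real.exp_add]; ring_nf
    rw [h1, h3, add_sub_cancel_right]
    calc _ ≤ 2 ^ (-β) * (2 ^ |β| * v ^ |β|) * (Real.exp 2 * Real.exp (-2 * v)) := by gcongr
      _ = _ := by ring

/-- The part of the ray integral near and beyond the turning point `v = 1`. -/
def tailIntegral (k : ℕ) (b L : ℂ) : ℂ :=
  ∫ v in Ioi (1 / 2 : ℝ), (v : ℂ) ^ (b - 1) * foldKern k (L * (1 - v : ℝ))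

lemma continuousOn_cpow_Ioi_half (b : ℂ) :
    ContinuousOn (fun v : ℝ => (v : ℂ) ^ (b - 1)) (Ioi (1 / 2)) :=
  (continuousOn_cpow_sub_one b).mono (Ioi_subset_Ioi (by norm_num))

lemma norm_cpow_mul_foldKern_le (k : ℕ) (b : ℂ) : ∃ C, 0 ≤ C ∧ ∀ L : ℂ, 2 ≤ L.re →
    |L.im| < Real.pi → ∀ v : ℝ, 0 < v → ‖(v : ℂ) ^ (b - 1) * foldKern k (L * (1 - v : ℝ))‖ ≤
      C * (v ^ (b.re - 1) * Real.exp (2 * (1 - v))) := by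
  obtain ⟨C, hC0, hC⟩ := norm_foldKern_le k
  refine ⟨C, hC0, fun L hre him v hv => ?_⟩
  rw [norm_mul, Complex.norm_cpow_eq_rpow_re_of_pos hv, Complex.sub_re, Complex.one_re]
  calc _ ≤ v ^ (b.re - 1) * (C * Real.exp (2 * (1 - v))) := by gcongr; exact hC L hre him _
    _ = _ := by ring

lemma integrableOn_tail (k : ℕ) (b : ℂ) {L : ℂ} (hre : 2 ≤ L.re) (him : |L.im| < Real.pi) :
    IntegrableOn (fun v : ℝ => (v : ℂ) ^ (b - 1) * foldKern k (L * (1 - v : ℝ))) (Ioi (1 / 2)) := by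
  obtain ⟨C, hC0, hC⟩ := norm_cpow_mul_foldKern_le k b
  refine Integrable.mono' ((integrableOn_rpow_mul_exp_Ioi (b.re - 1)).const_mul C)
    (((continuousOn_cpow_Ioi_half b).mul
      (continuous_foldKern_ray k hre him).continuousOn).aestronglyMeasurable measurableSet_Ioi) ?_
  exact (ae_restrict_iff' measurableSet_Ioi).2 (ae_of_all _ fun v (hv : 1 / 2 < v) =>
    hC L hre him v (lt_trans (by norm_num) hv))

/-- Integration by parts. The boundary term at infinity vanishes because the function and its
derivative are both integrable. Starting at `1/2` instead of `0` keeps this valid for every `b`,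
although each use lowers `b` by one. -/
lemma mul_tailIntegral_succ (k : ℕ) (b : ℂ) {L : ℂ} (hre : 2 ≤ L.re) (him : |L.im| < Real.pi) :
    L * tailIntegral (k + 1) b L = (b - 1) * tailIntegral k (b - 1) L +
      ((1 / 2 : ℝ) : ℂ) ^ (b - 1) * foldKern k (L * (1 - (1 / 2) : ℝ)) := by
  have hd : ∀ v : ℝ, 0 < v → HasDerivAt
      (fun v : ℝ => (v : ℂ) ^ (b - 1) * foldKern k (L * (1 - v : ℝ)))
      ((b - 1) * ((v : ℂ) ^ (b - 1 - 1) * foldKern k (L * (1 - v : ℝ))) -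
        L * ((v : ℂ) ^ (b - 1) * foldKern (k + 1) (L * (1 - v : ℝ)))) v := by
    intro v hv
    have h1 : HasDerivAt (fun v : ℝ => (v : ℂ) ^ (b - 1)) ((b - 1) * (v : ℂ) ^ (b - 1 - 1)) v := by
      have := ((hasDerivAt_id (v : ℂ)).cpow_const (c := b - 1)
        (Complex.ofReal_mem_slitPlane.2 hv)).comp_ofReal
      simpa using this
    refine (h1.mul (hasDerivAt_foldKern_ray k hre him v)).congr_deriv ?_
    ring
  have hi1 := (integrableOn_tail k (b - 1) hre him).const_mul (b - 1)
  have hi2 := (integrableOn_tail (k + 1) b hre him).const_mul L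
  have hi := hi1.sub hi2
  have hlim := tendsto_zero_of_hasDerivAt_of_integrableOn_Ioi (a := 1 / 2)
    (fun v hv => hd v (lt_trans (by norm_num) hv)) hi (integrableOn_tail k b hre him)
  have h := integral_Ioi_of_hasDerivAt_of_tendsto
    (hd (1 / 2) (by norm_num)).continuousAt.continuousWithinAt
    (fun v hv => hd v (lt_trans (by norm_num) hv)) hi hlim
  rw [integral_sub hi1 hi2, integral_const_mul, integral_const_mul] at h
  unfold tailIntegral
  linear_combination -h

lemma norm_le_re_add_pi {L : ℂ} (h0 : 0 ≤ L.re) (him : |L.im| < Real.pi) :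
    ‖L‖ ≤ L.re + Real.pi := by
  refine (Complex.norm_le_abs_re_add_abs_im L).trans ?_
  rw [abs_of_nonneg h0]
  linarith

lemma tendsto_pow_mul_exp_stripFilter (k : ℕ) :
    Tendsto (fun L : ℂ => ‖L‖ ^ k * Real.exp (-(L.re / 2))) stripFilter (𝓝 0) := by
  have h1 : Tendsto (fun x : ℝ => (2 ^ k * Real.exp (Real.pi / 2)) *
      (((x + Real.pi) / 2) ^ k * Real.exp (-((x + Real.pi) / 2)))) atTop (𝓝 0) := by
    have := (Real.tendsto_pow_mul_exp_neg_atTop_nhds_zero k).comp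
      ((tendsto_atTop_add_const_right atTop Real.pi tendsto_id).atTop_div_const two_pos)
    simpa using this.const_mul (2 ^ k * Real.exp (Real.pi / 2))
  refine squeeze_zero' (Eventually.of_forall fun L => by positivity) ?_
    (h1.comp tendsto_re_stripFilter)
  filter_upwards [eventually_stripFilter 0] with L hL
  have h2 : Real.exp (-(L.re / 2)) = Real.exp (Real.pi / 2) *
      Real.exp (-((L.re + Real.pi) / 2)) := by
    rw [← Real.exp_add]; ring_nf
  have h3 : (2 : ℝ) ^ k * ((L.re + Real.pi) / 2) ^ k = (L.re + Real.pi) ^ k := by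
    rw [← mul_pow]; ring_nf
  have h4 : ‖L‖ ^ k ≤ (L.re + Real.pi) ^ k :=
    pow_le_pow_left₀ (norm_nonneg _) (norm_le_re_add_pi hL.1 hL.2) k
  rw [← h3] at h4
  simp only [Function.comp]
  rw [h2]
  calc _ ≤ (2 ^ k * ((L.re + Real.pi) / 2) ^ k) * (Real.exp (Real.pi / 2) *
      Real.exp (-((L.re + Real.pi) / 2))) := by gcongr
    _ = _ := by ring

lemma tendsto_exp_mul_stripFilter {x : ℝ} (hx : x < 0) :
    Tendsto (fun L : ℂ => Complex.exp (L * x)) stripFilter (𝓝 0) := by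
  rw [tendsto_zero_iff_norm_tendsto_zero]
  simp only [Complex.norm_exp, Complex.re_mul_ofReal]
  exact Real.tendsto_exp_atBot.comp (tendsto_re_stripFilter.atTop_mul_const_of_neg hx)

lemma tendsto_foldKern_zero_of_neg {x : ℝ} (hx : x < 0) :
    Tendsto (fun L : ℂ => foldKern 0 (L * x)) stripFilter (𝓝 0) := by
  simp only [foldKern_zero_eq]
  have h := tendsto_exp_mul_stripFilter hx
  have h1 := h.neg.div (h.const_add 1) (by simp)
  rw [neg_zero, zero_div] at h1
  exact h1

lemma tendsto_foldKern_zero_of_pos {x : ℝ} (hx : 0 < x) :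
    Tendsto (fun L : ℂ => foldKern 0 (L * x)) stripFilter (𝓝 (-1)) := by
  have h := tendsto_exp_mul_stripFilter (neg_lt_zero.2 hx)
  have h2 := (h.const_add 1).inv₀ (by simp)
  have h3 := h2.neg
  simp only [add_zero, inv_one] at h3
  refine h3.congr' ?_
  filter_upwards [eventually_stripFilter 2] with L hL
  have h4 := one_add_exp_ne_zero hL.1 hL.2 (-x)
  have h5 := one_add_exp_ne_zero hL.1 hL.2 x
  rw [foldKern_zero_eq, neg_div, inv_eq_one_div, neg_inj, div_eq_div_iff h4 h5, mul_add (Complex.exp _),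
    ← Complex.exp_add]
  simp
  ring

/-- The kernel tends to `-1` for `v < 1` and to `0` for `v > 1`, leaving `-b ∫ v^{b-1}` over `[1/2,
1]`. The factor `b` covers the case `b = 0` as well. -/
lemma tendsto_mul_tailIntegral_zero (b : ℂ) :
    Tendsto (fun L => b * tailIntegral 0 b L) stripFilter
      (𝓝 (-(1 - ((1 / 2 : ℝ) : ℂ) ^ b))) := by
  obtain ⟨C, hC0, hC⟩ := norm_cpow_mul_foldKern_le 0 b
  have hlim : Tendsto (tailIntegral 0 b) stripFilter
      (𝓝 (∫ v in Ioi (1 / 2 : ℝ), (Iic (1 : ℝ)).indicator (fun v : ℝ => -(v : ℂ) ^ (b - 1)) v)) := by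
    refine tendsto_integral_filter_of_dominated_convergence
      (fun v => C * (v ^ (b.re - 1) * Real.exp (2 * (1 - v)))) ?_ ?_ ?_ ?_
    · filter_upwards [eventually_stripFilter 2] with L hL
      exact (integrableOn_tail 0 b hL.1 hL.2).aestronglyMeasurable
    · filter_upwards [eventually_stripFilter 2] with L hL
      exact (ae_restrict_iff' measurableSet_Ioi).2 (ae_of_all _ fun v (hv : 1 / 2 < v) =>
        hC L hL.1 hL.2 v (lt_trans (by norm_num) hv))
    · exact (integrableOn_rpow_mul_exp_Ioi _).const_mul C
    · have hne : ∀ᵐ v : ℝ ∂(volume.restrict (Ioi (1 / 2))), v ≠ 1 :=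
        ae_restrict_of_ae (measure_mono_null (by intro v hv; simpa using hv) (Real.volume_singleton (a := 1)))
      filter_upwards [hne] with v hv
      rcases hv.lt_or_gt with h | h
      · rw [indicator_of_mem (show v ∈ Iic 1 from h.le)]
        simpa using (tendsto_foldKern_zero_of_pos (sub_pos.2 h)).const_mul ((v : ℂ) ^ (b - 1))
      · rw [indicator_of_notMem (show v ∉ Iic 1 from not_le.2 h)]
        simpa using (tendsto_foldKern_zero_of_neg (sub_neg.2 h)).const_mul ((v : ℂ) ^ (b - 1))
  rw [setIntegral_indicator measurableSet_Iic, Ioi_inter_Iic, integral_neg,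
    ← intervalIntegral.integral_of_le (by norm_num)] at hlim
  have h2 := hlim.const_mul b
  convert h2 using 2
  rcases eq_or_ne b 0 with rfl | hb
  · simp
  · rw [integral_cpow (Or.inr ⟨by simpa [sub_eq_iff_eq_add] using hb, by
      rw [uIcc_of_le (by norm_num)]; simp⟩)]
    simp only [sub_add_cancel, Complex.ofReal_one, Complex.one_cpow]
    field_simp

/-- Repeated integration by parts down to the step function. Each factor `b - 1` is absorbed by
`1/Γ(b-1) = (b-1)/Γ(b)`; working with `1/Γ` avoids exceptions at the poles. The boundary terms at
`1/2` are exponentially small, except in the last integration, where the term cancels the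
`2^{-(b-1)}` from the step function. -/
lemma tendsto_tailIntegral (k : ℕ) (b : ℂ) :
    Tendsto (fun L => (Complex.Gamma b)⁻¹ * (L ^ (k + 1) * tailIntegral (k + 1) b L)) stripFilter
      (𝓝 (-(Complex.Gamma (b - k))⁻¹)) := by
  induction k generalizing b with
  | zero =>
    have h1 := tendsto_mul_tailIntegral_zero (b - 1)
    have h2 := (tendsto_foldKern_zero_of_pos (x := 1 - 1 / 2) (by norm_num)).const_mul
      (((1 / 2 : ℝ) : ℂ) ^ (b - 1))
    have h3 := (h1.add h2).const_mul (Complex.Gamma b)⁻¹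
    refine (h3.congr' ?_).trans (le_of_eq (by congr 1; simp; ring))
    filter_upwards [eventually_stripFilter 2] with L hL
    rw [zero_add, pow_one, mul_tailIntegral_succ 0 b hL.1 hL.2]
  | succ k ih =>
    have h1 := ih (b - 1)
    obtain ⟨C, hC0, hC⟩ := norm_foldKern_succ_le k
    have h2 : Tendsto (fun L : ℂ => L ^ (k + 1) * (((1 / 2 : ℝ) : ℂ) ^ (b - 1) *
        foldKern (k + 1) (L * (1 - (1 / 2) : ℝ)))) stripFilter (𝓝 0) := by
      have hz := (tendsto_pow_mul_exp_stripFilter (k + 1)).const_mul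
        (‖((1 / 2 : ℝ) : ℂ) ^ (b - 1)‖ * C)
      rw [mul_zero] at hz
      refine squeeze_zero_norm' ?_ hz
      filter_upwards [eventually_stripFilter 2] with L hL
      have := hC L hL.1 hL.2 (1 - 1 / 2) (by norm_num)
      rw [norm_mul, norm_mul, norm_pow]
      calc _ ≤ ‖L‖ ^ (k + 1) * (‖((1 / 2 : ℝ) : ℂ) ^ (b - 1)‖ *
            (C * Real.exp (-(L.re * (1 - 1 / 2))))) := by gcongr
        _ = _ := by ring_nf
    have h3 := h1.add (h2.const_mul (Complex.Gamma b)⁻¹)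
    refine (h3.congr' ?_).trans (le_of_eq (by congr 1; simp; ring_nf))
    filter_upwards [eventually_stripFilter 2] with L hL
    have h4 := Complex.one_div_Gamma_eq_self_mul_one_div_Gamma_add_one (b - 1)
    rw [sub_add_cancel] at h4
    rw [pow_succ L (k + 1), mul_assoc (L ^ (k + 1)) L, mul_tailIntegral_succ (k + 1) b hL.1 hL.2,
      h4]
    ring

lemma tendsto_head_integral (k : ℕ) {a : ℂ} (ha : 0 < a.re) :
    Tendsto (fun L => L ^ (k + 1) * ∫ v in Ioc (0 : ℝ) (1 / 2),
      (v : ℂ) ^ (a - 1) * foldKern (k + 1) (L * (1 - v : ℝ))) stripFilter (𝓝 0) := by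
  obtain ⟨C, hC0, hC⟩ := norm_foldKern_succ_le k
  have hint : IntegrableOn (fun v : ℝ => v ^ (a.re - 1)) (Ioc 0 (1 / 2)) := by
    rw [← intervalIntegrable_iff_integrableOn_Ioc_of_le (by norm_num)]
    exact intervalIntegral.intervalIntegrable_rpow' (by linarith)
  have hz := (tendsto_pow_mul_exp_stripFilter (k + 1)).const_mul
    (C * ∫ v in Ioc (0 : ℝ) (1 / 2), v ^ (a.re - 1))
  rw [mul_zero] at hz
  refine squeeze_zero_norm' ?_ hz
  filter_upwards [eventually_stripFilter 2] with L hL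
  have h1 : ‖∫ v in Ioc (0 : ℝ) (1 / 2), (v : ℂ) ^ (a - 1) * foldKern (k + 1) (L * (1 - v : ℝ))‖ ≤
      ∫ v in Ioc (0 : ℝ) (1 / 2), v ^ (a.re - 1) * (C * Real.exp (-(L.re / 2))) := by
    refine norm_integral_le_of_norm_le (hint.mul_const _) ?_
    refine (ae_restrict_iff' measurableSet_Ioc).2 (ae_of_all _ fun v hv => ?_)
    rw [norm_mul, Complex.norm_cpow_eq_rpow_re_of_pos hv.1, Complex.sub_re, Complex.one_re]
    have h2 := hC L hL.1 hL.2 (1 - v) (by linarith [hv.2])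
    have h3 : Real.exp (-(L.re * (1 - v))) ≤ Real.exp (-(L.re / 2)) :=
      Real.exp_le_exp.2 (by nlinarith [hv.2, hL.1])
    have hv0 := hv.1
    calc _ ≤ v ^ (a.re - 1) * (C * Real.exp (-(L.re * (1 - v)))) := by gcongr
      _ ≤ _ := by gcongr
  rw [integral_mul_const] at h1
  rw [norm_mul, norm_pow]
  calc _ ≤ ‖L‖ ^ (k + 1) * ((∫ v in Ioc (0 : ℝ) (1 / 2), v ^ (a.re - 1)) *
        (C * Real.exp (-(L.re / 2)))) := by gcongr
    _ = _ := by ring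

lemma exp_ne_neg_ofReal {u : ℂ} (hu : |u.im| < Real.pi) {t : ℝ} (ht : 0 < t) :
    Complex.exp u ≠ -(t : ℂ) := by
  intro h
  have h1 := Complex.log_exp (x := u) (abs_lt.1 hu).1 (abs_lt.1 hu).2.le
  have h2 : u.im = Real.pi := by
    rw [← h1, h, Complex.log_im, ← Complex.ofReal_neg, Complex.arg_ofReal_of_neg (neg_lt_zero.2 ht)]
  rw [h2, abs_of_pos Real.pi_pos] at hu
  exact lt_irrefl _ hu

lemma neg_exp_mem_cutAtOne {L : ℂ} (him : |L.im| < Real.pi) : -Complex.exp L ∈ cutAtOne := by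
  rw [mem_cutAtOne]
  intro r hr h
  exact exp_ne_neg_ofReal him (show 0 < r by linarith) (by rw [h, neg_neg])

/-- Direction `α = L` makes the ray straight in the logarithmic coordinate. If `-r e^{L(1-u)} = 1`
with `r ≤ 1`, then `|e^{L(1-u)}| ≥ 1`, so `u ≤ 1` and `|Im L(1-u)| < π`, which excludes a negative
real value. -/
lemma polylog_neg_exp (k : ℕ) {s L : ℂ} (ha : 0 < (s + k).re) (hre : 0 < L.re)
    (him : |L.im| < Real.pi) :
    polylog s (-Complex.exp L) = L ^ (s + k) / Complex.Gamma (s + k) *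
      ∫ v in Ioi (0 : ℝ), (v : ℂ) ^ (s + k - 1) * foldKern k (L * (1 - v : ℝ)) := by
  have hexp : ∀ v : ℝ, -Complex.exp L * Complex.exp (-L * v) = -Complex.exp (L * (1 - v : ℝ)) := by
    intro v
    rw [neg_mul, ← Complex.exp_add]
    push_cast
    ring_nf
  rw [polylog_eq_rayIntegral k ha hre (neg_exp_mem_cutAtOne him)]
  · simp only [rayIntegral, hexp]
    rfl
  · intro r hr0 hr1 u hu h
    rw [mul_assoc, hexp] at h
    have hr : 0 < r := by
      rcases hr0.eq_or_lt with rfl | h'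
      · simp at h
      · exact h'
    have h1 : Complex.exp (L * (1 - u : ℝ)) = -((r⁻¹ : ℝ) : ℂ) := by
      have : (r : ℂ) ≠ 0 := by exact_mod_cast hr.ne'
      push_cast at h ⊢
      field_simp
      linear_combination -h
    have h2 : Real.exp (L.re * (1 - u)) = r⁻¹ := by
      have := congrArg norm h1
      rwa [Complex.norm_exp, Complex.re_mul_ofReal, norm_neg, Complex.norm_real,
        Real.norm_of_nonneg (by positivity)] at this
    have h3 : 0 ≤ L.re * (1 - u) := by
      rw [← Real.one_le_exp_iff, h2]
      exact (one_le_inv₀ hr).2 hr1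
    have h4 : 0 ≤ 1 - u := nonneg_of_mul_nonneg_right h3 hre
    refine exp_ne_neg_ofReal ?_ (inv_pos.2 hr) h1
    rw [Complex.im_mul_ofReal, abs_mul, abs_of_nonneg h4]
    calc |L.im| * (1 - u) ≤ |L.im| * 1 := by gcongr; linarith
      _ < _ := by linarith

/-- The behaviour of the polylogarithm at infinity, uniformly up to both sides of the cut. -/
theorem tendsto_polylog_neg_exp_div_cpow (s : ℂ) :
    Tendsto (fun L => polylog s (-Complex.exp L) / L ^ s) stripFilter
      (𝓝 (-(Complex.Gamma (1 + s))⁻¹)) := by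
  obtain ⟨n, hn, ha⟩ := exists_shift s
  obtain ⟨k, rfl⟩ : ∃ k, n = k + 1 := ⟨n - 1, by omega⟩
  set a := s + (k + 1 : ℕ) with haa
  have h1 := tendsto_tailIntegral k a
  have h2 := (tendsto_head_integral k ha).const_mul (Complex.Gamma a)⁻¹
  have h3 := h2.add h1
  refine (h3.congr' ?_).trans (le_of_eq ?_)
  · filter_upwards [eventually_stripFilter 2] with L hL
    have hL0 : L ≠ 0 := by
      rintro rfl
      have := hL.1
      simp at this
      linarith
    have hLs : L ^ s ≠ 0 := by simp [Complex.cpow_eq_zero_iff, hL0]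
    have hsplit : Ioi (0 : ℝ) = Ioc 0 (1 / 2) ∪ Ioi (1 / 2) :=
      (Ioc_union_Ioi_eq_Ioi (by norm_num)).symm
    obtain ⟨C, hC0, hC⟩ := norm_cpow_mul_foldKern_le (k + 1) a
    have hi1 : IntegrableOn (fun v : ℝ => (v : ℂ) ^ (a - 1) * foldKern (k + 1) (L * (1 - v : ℝ)))
        (Ioc 0 (1 / 2)) := by
      have hint : IntegrableOn (fun v : ℝ => v ^ (a.re - 1)) (Ioc 0 (1 / 2)) := by
        rw [← intervalIntegrable_iff_integrableOn_Ioc_of_le (by norm_num)]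
        exact intervalIntegral.intervalIntegrable_rpow' (by linarith)
      refine Integrable.mono' (hint.const_mul (C * Real.exp 2)) ?_ ?_
      · exact (((continuousOn_cpow_sub_one a).mono Ioc_subset_Ioi_self).mul
          (continuous_foldKern_ray _ hL.1 hL.2).continuousOn).aestronglyMeasurable measurableSet_Ioc
      · refine (ae_restrict_iff' measurableSet_Ioc).2 (ae_of_all _ fun v hv => ?_)
        refine (hC L hL.1 hL.2 v hv.1).trans ?_
        have h5 : Real.exp (2 * (1 - v)) ≤ Real.exp 2 := Real.exp_le_exp.2 (by linarith [hv.1])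
        have h6 : 0 ≤ v ^ (a.re - 1) := Real.rpow_nonneg hv.1.le _
        calc _ ≤ C * (v ^ (a.re - 1) * Real.exp 2) := by gcongr
          _ = _ := by ring
    have hpl := polylog_neg_exp (k + 1) ha (show 0 < L.re by linarith [hL.1]) hL.2
    rw [← haa] at hpl
    rw [hpl, hsplit, setIntegral_union (Ioc_disjoint_Ioi le_rfl) measurableSet_Ioi hi1
      (integrableOn_tail _ _ hL.1 hL.2)]
    have hLa : L ^ a = L ^ s * L ^ (k + 1) := by
      rw [haa, Complex.cpow_add _ _ hL0, Complex.cpow_natCast]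
    rw [hLa]
    unfold tailIntegral
    field_simp
  -- Here `a - k = s + 1`.
  · congr 1
    rw [haa]
    push_cast
    simp
    ring_nf

/-! ### Bernstein form and decay of `S_n` -/

/-- The sum `∑ j, (-1) ^ j * m.choose j * (j + 1) ^ k * p ^ (j + 1)` in Bernstein form. -/
def eulerPoly (k m : ℕ) (p : ℂ) : ℂ :=
  ∑ i ∈ Finset.range (k + 1), newtonCoeff k i * ((-1) ^ i *
    ((m.choose i : ℂ) * p ^ (i + 1) * (1 - p) ^ (m - i)))

/-- `C(m,j) C(j,i) = C(m,i) C(m-i,j-i)`, then the binomial theorem in `l = j - i`. -/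
lemma sum_choose_mul_choose (m i : ℕ) (p : ℂ) :
    ∑ j ∈ Finset.range (m + 1), (-1 : ℂ) ^ j * (m.choose j : ℂ) * (j.choose i : ℂ) * p ^ (j + 1) =
      (-1) ^ i * ((m.choose i : ℂ) * p ^ (i + 1) * (1 - p) ^ (m - i)) := by
  rcases lt_or_ge m i with h | h
  · rw [Nat.choose_eq_zero_of_lt h]
    simp only [Nat.cast_zero, zero_mul, mul_zero]
    refine Finset.sum_eq_zero fun j hj => ?_
    rw [Nat.choose_eq_zero_of_lt (show j < i by have := Finset.mem_range.1 hj; omega)]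
    simp
  · obtain ⟨d, rfl⟩ := Nat.exists_eq_add_of_le h
    rw [add_assoc, Finset.sum_range_add, Finset.sum_eq_zero, zero_add, Nat.add_sub_cancel_left,
      sub_eq_neg_add, add_pow, Finset.mul_sum, Finset.mul_sum]
    · refine Finset.sum_congr rfl fun l hl => ?_
      have hl' : l ≤ d := Nat.lt_succ_iff.1 (Finset.mem_range.1 hl)
      have hc := Nat.choose_mul (n := i + d) (k := i + l) (s := i) (by omega)
      rw [Nat.add_sub_cancel_left, Nat.add_sub_cancel_left] at hc
      have hc' : ((i + d).choose (i + l) : ℂ) * ((i + l).choose i : ℂ) =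
          ((i + d).choose i : ℂ) * (d.choose l : ℂ) := by exact_mod_cast hc
      rw [mul_assoc ((-1 : ℂ) ^ (i + l)), hc', neg_pow p]
      ring
    · intro j hj
      rw [Nat.choose_eq_zero_of_lt (Finset.mem_range.1 hj)]
      simp

lemma sum_eq_eulerPoly (k m : ℕ) (p : ℂ) :
    ∑ j ∈ Finset.range (m + 1), (-1 : ℂ) ^ j * (m.choose j : ℂ) * ((j : ℂ) + 1) ^ k * p ^ (j + 1) =
      eulerPoly k m p := by
  unfold eulerPoly
  simp_rw [← sum_choose_mul_choose, Finset.mul_sum]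
  rw [Finset.sum_comm]
  refine Finset.sum_congr rfl fun j _ => ?_
  rw [← sum_newtonCoeff_choose, Finset.mul_sum, Finset.sum_mul]
  exact Finset.sum_congr rfl fun i _ => by ring

lemma bernstein_le_one {m i : ℕ} (h : i ≤ m) {p : ℝ} (hp0 : 0 ≤ p) (hp1 : p ≤ 1) :
    (m.choose i : ℝ) * p ^ i * (1 - p) ^ (m - i) ≤ 1 := by
  have h1 : ∑ j ∈ Finset.range (m + 1), p ^ j * (1 - p) ^ (m - j) * (m.choose j : ℝ) = 1 := by
    rw [← add_pow]; simp
  have h2 := Finset.single_le_sum (f := fun j => p ^ j * (1 - p) ^ (m - j) * (m.choose j : ℝ))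
    (s := Finset.range (m + 1)) (fun j _ => by have := sub_nonneg.2 hp1; positivity)
    (Finset.mem_range.2 (Nat.lt_succ_iff.2 h))
  calc _ = p ^ i * (1 - p) ^ (m - i) * (m.choose i : ℝ) := by ring
    _ ≤ _ := h2
    _ = 1 := h1

/-- The left side is at most `p`, and, by comparison with a Bernstein polynomial of degree `m + 1`,
at most `(i+1)/(m+1)`. The geometric mean of the two gives decay in `t` (for `p = e^{-t}`) and in
`m` at once. -/
lemma bernstein_le (m i : ℕ) {p : ℝ} (hp0 : 0 ≤ p) (hp1 : p ≤ 1) :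
    (m.choose i : ℝ) * p ^ (i + 1) * (1 - p) ^ (m - i) ≤ (i + 1) * (√p / √((m : ℝ) + 1)) := by
  rcases lt_or_ge m i with h | h
  · rw [Nat.choose_eq_zero_of_lt h]; simp; positivity
  have hq := sub_nonneg.2 hp1
  have hm : (0 : ℝ) < (m : ℝ) + 1 := by positivity
  set x := (m.choose i : ℝ) * p ^ (i + 1) * (1 - p) ^ (m - i) with hx
  have hx0 : 0 ≤ x := by positivity
  have h1 : x ≤ p := by
    calc x = p * ((m.choose i : ℝ) * p ^ i * (1 - p) ^ (m - i)) := by rw [hx]; ring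
      _ ≤ p * 1 := by gcongr; exact bernstein_le_one h hp0 hp1
      _ = p := mul_one p
  have h2 : x * (m + 1) ≤ i + 1 := by
    have hc : ((m : ℝ) + 1) * (m.choose i : ℝ) = ((m + 1).choose (i + 1) : ℝ) * (i + 1) := by
      exact_mod_cast Nat.add_one_mul_choose_eq m i
    have h3 := bernstein_le_one (m := m + 1) (i := i + 1) (by omega) hp0 hp1
    rw [Nat.add_sub_add_right] at h3
    calc x * (m + 1) = (((m : ℝ) + 1) * (m.choose i : ℝ)) * p ^ (i + 1) * (1 - p) ^ (m - i) := by
          rw [hx]; ring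
      _ = (i + 1) * (((m + 1).choose (i + 1) : ℝ) * p ^ (i + 1) * (1 - p) ^ (m - i)) := by
          rw [hc]; ring
      _ ≤ (i + 1) * 1 := by gcongr
      _ = _ := mul_one _
  rw [← Real.sqrt_div' _ hm.le]
  refine le_trans (Real.le_sqrt_of_sq_le (y := (i + 1) * (p / (m + 1))) ?_) ?_
  · rw [← mul_div_assoc, le_div_iff₀ hm]
    nlinarith
  · rw [Real.sqrt_mul (by positivity)]
    gcongr
    rw [Real.sqrt_le_left (by positivity)]
    have : (0 : ℝ) ≤ i := Nat.cast_nonneg i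
    nlinarith

lemma sqrt_exp_neg (t : ℝ) : √(Real.exp (-t)) = Real.exp (-(1 / 2) * t) := by
  rw [Real.sqrt_eq_iff_mul_self_eq (Real.exp_pos _).le (Real.exp_pos _).le, ← Real.exp_add]
  ring_nf

/-- The constant in the bound of `eulerPoly`. -/
def eulerConst (k : ℕ) : ℝ := ∑ i ∈ Finset.range (k + 1), ‖newtonCoeff k i‖ * (i + 1)

lemma eulerConst_nonneg (k : ℕ) : 0 ≤ eulerConst k := by unfold eulerConst; positivity

lemma norm_eulerPoly_le (k m : ℕ) {t : ℝ} (ht : 0 ≤ t) :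
    ‖eulerPoly k m (Real.exp (-t) : ℝ)‖ ≤
      eulerConst k * (Real.exp (-(1 / 2) * t) / √((m : ℝ) + 1)) := by
  have hp1 : Real.exp (-t) ≤ 1 := Real.exp_le_one_iff.2 (by linarith)
  have hq := sub_nonneg.2 hp1
  unfold eulerPoly eulerConst
  rw [Finset.sum_mul]
  refine norm_sum_le_of_le _ fun i _ => ?_
  rw [norm_mul, norm_mul, norm_pow, norm_neg, norm_one, one_pow, one_mul, mul_assoc ‖newtonCoeff k i‖]
  refine mul_le_mul_of_nonneg_left ?_ (norm_nonneg (newtonCoeff k i))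
  rw [← sqrt_exp_neg]
  refine le_trans (le_of_eq ?_) (bernstein_le m i (Real.exp_pos (-t)).le hp1)
  have : (m.choose i : ℂ) * ((Real.exp (-t) : ℝ) : ℂ) ^ (i + 1) *
      (1 - ((Real.exp (-t) : ℝ) : ℂ)) ^ (m - i) =
      (((m.choose i : ℝ) * Real.exp (-t) ^ (i + 1) * (1 - Real.exp (-t)) ^ (m - i) : ℝ) : ℂ) := by
    push_cast; rfl
  rw [this, Complex.norm_real, Real.norm_of_nonneg (by positivity)]

lemma continuous_eulerPoly_exp (k m : ℕ) :
    Continuous fun t : ℝ => eulerPoly k m (Real.exp (-t) : ℝ) := by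
  unfold eulerPoly
  fun_prop

lemma S_eq_integral (k m : ℕ) {s : ℂ} (ha : 0 < (s + k).re) :
    S (m + 1) s = (Complex.Gamma (s + k))⁻¹ *
      ∫ t in Ioi (0 : ℝ), (t : ℂ) ^ (s + k - 1) * eulerPoly k m (Real.exp (-t) : ℝ) := by
  set a := s + k with haa
  have hG : Complex.Gamma a ≠ 0 := Complex.Gamma_ne_zero_of_re_pos ha
  have hterm : ∀ t : ℝ, (t : ℂ) ^ (a - 1) * eulerPoly k m (Real.exp (-t) : ℝ) =
      ∑ j ∈ Finset.range (m + 1), ((-1 : ℂ) ^ j * (m.choose j : ℂ) * ((j : ℂ) + 1) ^ k) *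
        ((t : ℂ) ^ (a - 1) * Complex.exp (-(((j : ℂ) + 1) * 1) * t)) := by
    intro t
    rw [← sum_eq_eulerPoly, Finset.mul_sum]
    refine Finset.sum_congr rfl fun j _ => ?_
    rw [Complex.ofReal_exp, ← Complex.exp_nat_mul]
    push_cast
    ring_nf
  simp_rw [hterm]
  rw [integral_finsetSum, Finset.mul_sum, S, Nat.add_sub_cancel]
  · refine Finset.sum_congr rfl fun j _ => ?_
    rw [integral_const_mul, integral_cpow_mul_exp_nat ha (by simp)]
    have h0 : ((j : ℂ) + 1) ≠ 0 := by exact_mod_cast (Nat.succ_ne_zero j)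
    rw [haa, neg_add, Complex.cpow_add _ _ h0, Complex.cpow_neg _ (k : ℂ), Complex.cpow_natCast,
      Complex.one_cpow]
    rw [haa] at hG
    field_simp
  · intro j _
    refine Integrable.const_mul ?_ _
    have hd := integrableOn_rpow_mul_exp ha (r := (j : ℝ) + 1) (by positivity)
    refine Integrable.mono' hd
      (((continuousOn_cpow_sub_one a).mul (by fun_prop)).aestronglyMeasurable measurableSet_Ioi) ?_
    refine (ae_restrict_iff' measurableSet_Ioi).2 (ae_of_all _ fun t (ht : 0 < t) => ?_)
    rw [norm_mul, Complex.norm_cpow_eq_rpow_re_of_pos ht, norm_exp_neg_mul]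
    simp

lemma norm_cpow_mul_eulerPoly_le (k m : ℕ) (a : ℂ) {t : ℝ} (ht : 0 < t) :
    ‖(t : ℂ) ^ (a - 1) * eulerPoly k m (Real.exp (-t) : ℝ)‖ ≤
      (eulerConst k / √((m : ℝ) + 1)) * (t ^ (a.re - 1) * Real.exp (-(1 / 2) * t)) := by
  rw [norm_mul, Complex.norm_cpow_eq_rpow_re_of_pos ht, Complex.sub_re, Complex.one_re]
  calc _ ≤ t ^ (a.re - 1) * (eulerConst k * (Real.exp (-(1 / 2) * t) / √((m : ℝ) + 1))) := by
        gcongr; exact norm_eulerPoly_le k m ht.le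
    _ = _ := by ring

/-- The constant in the bound of `S`, continuous in `s`. -/
def sConst (k : ℕ) (s : ℂ) : ℝ :=
  ‖(Complex.Gamma (s + k))⁻¹‖ * (eulerConst k * ((1 / (1 / 2)) ^ (s + k).re *
    Real.Gamma (s + k).re))

/-- The gain of `m^{-1/2}` is what makes `∑ S_n/(n+1)` converge absolutely, with terms
`O(m^{-3/2})`. -/
lemma norm_S_succ_le (k m : ℕ) {s : ℂ} (ha : 0 < (s + k).re) :
    ‖S (m + 1) s‖ ≤ sConst k s / √((m : ℝ) + 1) := by
  rw [S_eq_integral k m ha, norm_mul]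
  have h1 : ‖∫ t in Ioi (0 : ℝ), (t : ℂ) ^ (s + k - 1) * eulerPoly k m (Real.exp (-t) : ℝ)‖ ≤
      ∫ t in Ioi (0 : ℝ), (eulerConst k / √((m : ℝ) + 1)) *
        (t ^ ((s + k).re - 1) * Real.exp (-(1 / 2) * t)) := by
    refine norm_integral_le_of_norm_le
      ((integrableOn_rpow_mul_exp ha (by norm_num)).const_mul _) ?_
    exact (ae_restrict_iff' measurableSet_Ioi).2 (ae_of_all _ fun t (ht : 0 < t) =>
      norm_cpow_mul_eulerPoly_le k m _ ht)
  have h2 := Real.integral_rpow_mul_exp_neg_mul_Ioi ha (show (0 : ℝ) < 1 / 2 by norm_num)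
  simp only [neg_mul] at h1
  rw [integral_const_mul, h2] at h1
  unfold sConst
  calc _ ≤ ‖(Complex.Gamma (s + k))⁻¹‖ * _ := mul_le_mul_of_nonneg_left h1 (norm_nonneg _)
    _ = _ := by ring

lemma sConst_nonneg (k : ℕ) {s : ℂ} (ha : 0 < (s + k).re) : 0 ≤ sConst k s := by
  have := norm_S_succ_le k 0 ha
  simp at this
  exact (norm_nonneg _).trans this

lemma continuousAt_sConst (k : ℕ) {s : ℂ} (ha : 0 < (s + k).re) : ContinuousAt (sConst k) s := by
  unfold sConst
  have h1 : ContinuousAt (fun s : ℂ => (Complex.Gamma (s + k))⁻¹) s :=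
    (Complex.differentiable_one_div_Gamma.continuous.comp
      (continuous_id.add continuous_const)).continuousAt
  have hre : Continuous fun s : ℂ => (s + k).re := by fun_prop
  have h2 : ContinuousAt (fun s : ℂ => Real.Gamma (s + k).re) s := by
    refine ContinuousAt.comp (g := Real.Gamma) (f := fun s : ℂ => (s + k).re) ?_ hre.continuousAt
    refine (Real.differentiableAt_Gamma fun n h => ?_).continuousAt
    have : (0 : ℝ) ≤ n := Nat.cast_nonneg n
    linarith
  have h3 : Continuous fun s : ℂ => (1 / (1 / 2) : ℝ) ^ (s + k).re :=
    (Real.continuous_const_rpow (by norm_num)).comp hre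
  exact h1.norm.mul (continuousAt_const.mul (h3.continuousAt.mul h2))

lemma S_zero (s : ℂ) : S 0 s = 0 := by simp [S]

lemma exists_norm_S_le (s : ℂ) : ∃ B, 0 ≤ B ∧ ∀ n, ‖S n s‖ ≤ B := by
  obtain ⟨k, -, hk⟩ := exists_shift s
  refine ⟨sConst k s, sConst_nonneg k hk, fun n => ?_⟩
  rcases n with _ | m
  · simpa [S_zero] using sConst_nonneg k hk
  · refine (norm_S_succ_le k m hk).trans (div_le_self (sConst_nonneg k hk) ?_)
    rw [Real.one_le_sqrt]
    linarith [Nat.cast_nonneg (α := ℝ) m]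

/-! ### Euler's transformation and the derivative of `Z` -/

/-- The map is an involution exchanging `1` and `∞` and preserving `(1,∞)`. -/
lemma div_sub_one_mem_cutAtOne {x : ℂ} (hx : x ∈ cutAtOne) : x / (x - 1) ∈ cutAtOne := by
  have hx1 : x - 1 ≠ 0 := by
    intro h
    exact mem_cutAtOne.1 hx 1 le_rfl (by rw [sub_eq_zero] at h; simp [h])
  rw [mem_cutAtOne] at hx ⊢
  intro r hr h
  rw [eq_div_iff hx1] at h
  have hr1 : r ≠ 1 := by
    rintro rfl
    simp at h
  have hr2 : 0 < r - 1 := lt_of_le_of_ne (by linarith) (sub_ne_zero.2 hr1).symm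
  refine hx (r / (r - 1)) ((one_le_div hr2).2 (by linarith)) ?_
  have : ((r : ℂ) - 1) ≠ 0 := by exact_mod_cast hr2.ne'
  push_cast
  rw [div_eq_iff this]
  linear_combination -h

lemma sub_one_ne_zero_of_mem {x : ℂ} (hx : x ∈ cutAtOne) : x - 1 ≠ 0 := by
  intro h
  exact mem_cutAtOne.1 hx 1 le_rfl (by rw [sub_eq_zero] at h; simp [h])

/-- The integrand `Li_s (z / (z - 1))`. -/
def pullback (s z : ℂ) : ℂ := polylog s (z / (z - 1))

lemma differentiableOn_pullback (s : ℂ) : DifferentiableOn ℂ (pullback s) cutAtOne :=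
  (isContinuation_polylog s).1.comp
    (DifferentiableOn.div (by fun_prop) (by fun_prop) fun _ hx => sub_one_ne_zero_of_mem hx)
    fun _ hx => div_sub_one_mem_cutAtOne hx

/-- With `p = e^{-t}` and `q = 1 - p`, the Bernstein terms have generating function
`(px/(1-qx))^{i+1}`; for `w = x/(x-1)`, `wp/(1-wp) = -px/(1-qx)`, so the signs `(-1)^i` recombine
into `-kern`. -/
lemma hasSum_eulerPoly (k : ℕ) {x : ℂ} (hx : ‖x‖ < 1) {t : ℝ} (ht : 0 < t) :
    HasSum (fun m => eulerPoly k m (Real.exp (-t) : ℝ) * x ^ (m + 1))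
      (-kern k (x / (x - 1) * Complex.exp (-1 * t))) := by
  set p : ℂ := ((Real.exp (-t) : ℝ) : ℂ) with hp
  have hpe : Complex.exp (-1 * t) = p := by rw [hp, Complex.ofReal_exp]; simp
  have hp1 : Real.exp (-t) < 1 := by simpa using ht
  set q : ℂ := 1 - p with hq
  have hqr : q = ((1 - Real.exp (-t) : ℝ) : ℂ) := by rw [hq, hp]; push_cast; rfl
  have hq0 : q ≠ 0 := by rw [hqr]; exact_mod_cast (sub_pos.2 hp1).ne'
  have hqn : ‖q‖ ≤ 1 := by
    rw [hqr, Complex.norm_real, Real.norm_of_nonneg (by linarith)]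
    linarith [Real.exp_pos (-t)]
  have hqx : ‖q * x‖ < 1 := by
    rw [norm_mul]
    calc _ ≤ 1 * ‖x‖ := by gcongr
      _ < 1 := by simpa
  have h1 : 1 - q * x ≠ 0 := by
    intro h
    rw [← sub_eq_zero.1 h] at hqx
    simp at hqx
  have hx1 : x - 1 ≠ 0 := by
    intro h
    rw [sub_eq_zero.1 h] at hx
    simp at hx
  have hi : ∀ i : ℕ, HasSum (fun m : ℕ => (m.choose i : ℂ) * p ^ (i + 1) * q ^ (m - i) *
      x ^ (m + 1)) ((p * x / (1 - q * x)) ^ (i + 1)) := by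
    intro i
    have h := (hasSum_choose_mul_pow i hqx).mul_left ((p / q) ^ (i + 1))
    rw [← mul_pow, show p / q * (q * x / (1 - q * x)) = p * x / (1 - q * x) by field_simp] at h
    refine h.congr_fun fun m => ?_
    rcases lt_or_ge m i with hmi | hmi
    · simp [Nat.choose_eq_zero_of_lt hmi]
    · have : (q * x) ^ (m + 1) = q ^ (m - i) * q ^ (i + 1) * x ^ (m + 1) := by
        rw [← pow_add, mul_pow, show m - i + (i + 1) = m + 1 by omega]
      rw [this, div_pow]
      field_simp
  have hs := hasSum_sum (s := Finset.range (k + 1)) fun i _ =>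
    (hi i).mul_left (newtonCoeff k i * (-1) ^ i)
  have hY : x / (x - 1) * p / (1 - x / (x - 1) * p) = -(p * x / (1 - q * x)) := by
    have h2 : 1 - x / (x - 1) * p = -(1 - q * x) / (x - 1) := by
      rw [hq]; field_simp; ring
    rw [h2]
    field_simp
  have hval : -kern k (x / (x - 1) * Complex.exp (-1 * t)) = ∑ i ∈ Finset.range (k + 1),
      newtonCoeff k i * (-1) ^ i * (p * x / (1 - q * x)) ^ (i + 1) := by
    rw [hpe, kern, hY, ← Finset.sum_neg_distrib]
    refine Finset.sum_congr rfl fun i _ => ?_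
    rw [neg_pow (p * x / (1 - q * x)), pow_succ (-1 : ℂ)]
    ring
  rw [hval]
  refine hs.congr_fun fun m => ?_
  rw [eulerPoly, Finset.sum_mul]
  exact Finset.sum_congr rfl fun i _ => by ring

/-- Summing `S_eq_integral` under the integral sign by `hasSum_eulerPoly` produces the ray integral
of `Li_s` with `α = 1`. -/
lemma hasSum_S_mul_pow (s : ℂ) {x : ℂ} (hx : ‖x‖ < 1) :
    HasSum (fun n => S n s * x ^ n) (-pullback s x) := by
  obtain ⟨k, -, hk⟩ := exists_shift s
  set a := s + k with haa
  have hxc : x ∈ cutAtOne := ball_subset_cutAtOne (by simpa using hx)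
  have hw := div_sub_one_mem_cutAtOne hxc
  have hpl := polylog_eq_rayIntegral k hk (α := 1) (by simp) hw fun r hr0 hr1 u hu =>
    ray_ne_one_of_mem_cutAtOne (smul_mem_cutAtOne hw hr0 hr1) u hu
  rw [← haa, Complex.one_cpow] at hpl
  have hdom := integrableOn_rpow_mul_exp hk (show (0 : ℝ) < 1 / 2 by norm_num)
  have hS : HasSum (fun m : ℕ => ∫ t in Ioi (0 : ℝ), (t : ℂ) ^ (a - 1) *
      (eulerPoly k m (Real.exp (-t) : ℝ) * x ^ (m + 1)))
      (∫ t in Ioi (0 : ℝ), (t : ℂ) ^ (a - 1) *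
        (-kern k (x / (x - 1) * Complex.exp (-1 * t)))) := by
    refine hasSum_integral_of_dominated_convergence (fun m t => ‖x‖ ^ (m + 1) * (eulerConst k *
      (t ^ (a.re - 1) * Real.exp (-(1 / 2) * t)))) ?_ ?_ ?_ ?_ ?_
    · intro m
      exact ((continuousOn_cpow_sub_one a).mul (((continuous_eulerPoly_exp k m).mul
        continuous_const).continuousOn)).aestronglyMeasurable measurableSet_Ioi
    · intro m
      refine (ae_restrict_iff' measurableSet_Ioi).2 (ae_of_all _ fun t (ht : 0 < t) => ?_)
      have h1 := norm_cpow_mul_eulerPoly_le k m a ht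
      have h2 : eulerConst k / √((m : ℝ) + 1) ≤ eulerConst k := by
        refine div_le_self (eulerConst_nonneg k) ?_
        rw [Real.one_le_sqrt]
        linarith [Nat.cast_nonneg (α := ℝ) m]
      rw [← mul_assoc, norm_mul, norm_pow, mul_comm]
      gcongr
      refine h1.trans ?_
      gcongr
    · refine ae_of_all _ fun t => Summable.mul_right _ ?_
      exact (summable_nat_add_iff 1).2 (summable_geometric_of_lt_one (norm_nonneg _) hx)
    · simp_rw [tsum_mul_right]
      exact (hdom.const_mul _).const_mul _
    · exact (ae_restrict_iff' measurableSet_Ioi).2 (ae_of_all _ fun t (ht : 0 < t) =>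
        (hasSum_eulerPoly k hx ht).mul_left _)
  have hS2 := hS.mul_left (Complex.Gamma a)⁻¹
  have hval : (Complex.Gamma a)⁻¹ * (∫ t in Ioi (0 : ℝ), (t : ℂ) ^ (a - 1) *
        (-kern k (x / (x - 1) * Complex.exp (-1 * t)))) = -pullback s x := by
    rw [pullback, hpl, rayIntegral]
    simp_rw [mul_neg]
    rw [integral_neg]
    ring
  rw [hval] at hS2
  have hS3 : HasSum (fun m : ℕ => S (m + 1) s * x ^ (m + 1)) (-pullback s x) := by
    refine hS2.congr_fun fun m => ?_
    rw [S_eq_integral k m hk]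
    simp_rw [← mul_assoc]
    rw [integral_mul_const, ← mul_assoc]
  have := (hasSum_nat_add_iff (f := fun n => S n s * x ^ n) 1).1 hS3
  simpa [S_zero] using this

/-- Holomorphic functions on the cut plane have primitives. -/
lemma exists_primitive {h : ℂ → ℂ} (hh : DifferentiableOn ℂ h cutAtOne) :
    ∃ H : ℂ → ℂ, H 0 = 0 ∧ ∀ z ∈ cutAtOne, HasDerivAt H (h z) z := by
  -- The integral of `h` along `[0, z]`, available because the cut plane is star-shaped about `0`.
  refine ⟨fun z => z * ∫ r in (0 : ℝ)..1, h (r * z), by simp, fun z hz => ?_⟩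
  have hd : DifferentiableOn ℂ (deriv h) cutAtOne := hh.deriv isOpen_cutAtOne
  obtain ⟨ε, hε, hball⟩ := Metric.nhds_basis_closedBall.mem_iff.1 (isOpen_cutAtOne.mem_nhds hz)
  have hmaps : ∀ v ∈ Metric.closedBall z ε, ∀ r ∈ Icc (0 : ℝ) 1, (r : ℂ) * v ∈ cutAtOne :=
    fun v hv r hr => smul_mem_cutAtOne (hball hv) hr.1 hr.2
  have hK : IsCompact ((fun q : ℝ × ℂ => (q.1 : ℂ) * q.2) '' (Icc 0 1 ×ˢ Metric.closedBall z ε)) :=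
    (isCompact_Icc.prod (isCompact_closedBall z ε)).image (by fun_prop)
  have hKsub : ((fun q : ℝ × ℂ => (q.1 : ℂ) * q.2) '' (Icc 0 1 ×ˢ Metric.closedBall z ε)) ⊆
      cutAtOne := by
    rintro _ ⟨⟨r, v⟩, ⟨hr, hv⟩, rfl⟩
    exact hmaps v hv r hr
  obtain ⟨C, hC⟩ := hK.exists_bound_of_continuousOn (hd.continuousOn.mono hKsub)
  have hcont : ∀ g : ℂ → ℂ, DifferentiableOn ℂ g cutAtOne → ∀ v ∈ Metric.closedBall z ε,
      ContinuousOn (fun r : ℝ => g (r * v)) (Icc 0 1) := fun g hg v hv =>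
    hg.continuousOn.comp (by fun_prop) fun r hr => hmaps v hv r hr
  have hzmem : z ∈ Metric.closedBall z ε := Metric.mem_closedBall_self hε.le
  have hder := intervalIntegral.hasDerivAt_integral_of_dominated_loc_of_deriv_le (μ := volume)
    (a := 0) (b := 1) (F := fun v (r : ℝ) => h (r * v)) (F' := fun v (r : ℝ) => deriv h (r * v) * r)
    (bound := fun _ => C) (x₀ := z) (Metric.ball_mem_nhds z hε) ?_ ?_ ?_ ?_ ?_ ?_
  · have hmain := (hasDerivAt_id z).mul hder.2
    refine hmain.congr_deriv ?_
    have hi1 : IntervalIntegrable (fun r : ℝ => h (r * z)) volume 0 1 :=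
      ContinuousOn.intervalIntegrable (by rw [uIcc_of_le zero_le_one]; exact hcont h hh z hzmem)
    have hi2 : IntervalIntegrable (fun r : ℝ => deriv h (r * z) * r) volume 0 1 :=
      ContinuousOn.intervalIntegrable (by
        rw [uIcc_of_le zero_le_one]; exact (hcont _ hd z hzmem).mul (by fun_prop))
    -- The derivative found is the integral over `[0,1]` of `d/dr (r h(rz))`, that is `h(z)`.
    have hftc := intervalIntegral.integral_eq_sub_of_hasDerivAt
      (f := fun r : ℝ => (r : ℂ) * h (r * z))
      (f' := fun r : ℝ => h (r * z) + z * (deriv h (r * z) * r)) (a := 0) (b := 1) ?_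
      (hi1.add (hi2.const_mul z))
    · rw [intervalIntegral.integral_add hi1 (hi2.const_mul z),
        intervalIntegral.integral_const_mul] at hftc
      simpa using hftc
    · intro r hr
      rw [uIcc_of_le zero_le_one] at hr
      have h1 : HasDerivAt h (deriv h (r * z)) (r * z) :=
        (hh.differentiableAt (isOpen_cutAtOne.mem_nhds (hmaps z hzmem r hr))).hasDerivAt
      have h2 : HasDerivAt (fun r : ℝ => (r : ℂ) * z) z r := by
        simpa using (Complex.ofRealCLM.hasDerivAt (x := r)).mul_const z
      have h3 : HasDerivAt (fun r : ℝ => (r : ℂ)) 1 r := by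
        exact (hasDerivAt_id r).ofReal_comp
      refine (h3.mul (h1.comp r h2)).congr_deriv ?_
      simp
      ring
  · refine eventually_of_mem (Metric.ball_mem_nhds z hε) fun v hv => ?_
    rw [uIoc_of_le zero_le_one]
    exact ((hcont h hh v (Metric.ball_subset_closedBall hv)).mono
      Ioc_subset_Icc_self).aestronglyMeasurable measurableSet_Ioc
  · exact ContinuousOn.intervalIntegrable (by
      rw [uIcc_of_le zero_le_one]; exact hcont h hh z hzmem)
  · rw [uIoc_of_le zero_le_one]
    exact (((hcont _ hd z hzmem).mul (by fun_prop)).mono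
      Ioc_subset_Icc_self).aestronglyMeasurable measurableSet_Ioc
  · refine ae_of_all _ fun r hr v hv => ?_
    rw [uIoc_of_le zero_le_one] at hr
    have h1 := hC _ ⟨(r, v), ⟨Ioc_subset_Icc_self hr, Metric.ball_subset_closedBall hv⟩, rfl⟩
    have h0 := (norm_nonneg _).trans h1
    rw [norm_mul, Complex.norm_real, Real.norm_of_nonneg hr.1.le]
    calc _ ≤ C * 1 := mul_le_mul h1 hr.2 hr.1.le h0
      _ = C := mul_one C
  · exact intervalIntegrable_const
  · refine ae_of_all _ fun r hr v hv => ?_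
    rw [uIoc_of_le zero_le_one] at hr
    have h1 : HasDerivAt h (deriv h (r * v)) (r * v) :=
      (hh.differentiableAt (isOpen_cutAtOne.mem_nhds
        (hmaps v (Metric.ball_subset_closedBall hv) r (Ioc_subset_Icc_self hr)))).hasDerivAt
    have h2 : HasDerivAt (fun v : ℂ => (r : ℂ) * v) r v := by
      simpa using (hasDerivAt_id v).const_mul (r : ℂ)
    exact h1.comp v h2

lemma hasDerivAt_zetaSeries (s : ℂ) {x : ℂ} (hx : ‖x‖ < 1) :
    HasDerivAt (zetaSeries s) (-pullback s x) x := by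
  obtain ⟨B, hB0, hB⟩ := exists_norm_S_le s
  obtain ⟨r, hxr, hr1⟩ := exists_between hx
  have hr0 : 0 ≤ r := (norm_nonneg x).trans hxr.le
  rw [← (hasSum_S_mul_pow s hx).tsum_eq]
  refine hasDerivAt_tsum_of_isPreconnected
    (g := fun (n : ℕ) (z : ℂ) => S n s / ((n : ℂ) + 1) * z ^ (n + 1))
    (g' := fun n z => S n s * z ^ n) (u := fun n => B * r ^ n)
    (t := Metric.ball 0 r) (y₀ := (0 : ℂ)) (y := x) ((summable_geometric_of_lt_one hr0 hr1).mul_left B)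
    Metric.isOpen_ball (convex_ball _ _).isPreconnected ?_ ?_
    (Metric.mem_ball_self ((norm_nonneg x).trans_lt hxr)) ?_ (by simpa using hxr)
  · intro n y _
    refine ((hasDerivAt_pow (𝕜 := ℂ) (n + 1) y).const_mul (S n s / ((n : ℂ) + 1))).congr_deriv ?_
    have h0 : ((n : ℂ) + 1) ≠ 0 := by exact_mod_cast (Nat.succ_ne_zero n)
    push_cast
    field_simp
  · intro n y hy
    have hy' : ‖y‖ ≤ r := by simpa using (Metric.mem_ball.1 hy).le
    rw [norm_mul, norm_pow]
    gcongr
    exact hB n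
  · simp

/-- The continuation of `zetaSeries` exists. -/
lemma isContinuation_Z_aux (s : ℂ) : ∃ H : ℂ → ℂ, IsContinuation (zetaSeries s) H ∧
    ∀ z ∈ cutAtOne, HasDerivAt H (-pullback s z) z := by
  obtain ⟨H, hH0, hH⟩ := exists_primitive (differentiableOn_pullback s).neg
  refine ⟨H, ⟨fun z hz => (hH z hz).differentiableAt.differentiableWithinAt, ?_⟩, hH⟩
  have hz : ∀ z ∈ Metric.ball (0 : ℂ) 1, HasDerivAt (zetaSeries s) (-pullback s z) z :=
    fun z hz => hasDerivAt_zetaSeries s (by simpa using hz)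
  refine Metric.isOpen_ball.eqOn_of_deriv_eq (convex_ball _ _).isPreconnected
    (fun z hz' => (hH z (ball_subset_cutAtOne hz')).differentiableAt.differentiableWithinAt)
    (fun z hz' => (hz z hz').differentiableAt.differentiableWithinAt)
    (fun z hz' => ?_) (Metric.mem_ball_self one_pos) ?_
  · rw [(hH z (ball_subset_cutAtOne hz')).deriv, (hz z hz').deriv]
    rfl
  · rw [hH0]
    simp [zetaSeries]

lemma one_notMem_cutAtOne : (1 : ℂ) ∉ cutAtOne := fun h => sub_one_ne_zero_of_mem h (sub_self 1)

lemma isContinuation_Z (s : ℂ) : IsContinuation (zetaSeries s) (Z s) := by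
  obtain ⟨H, hH, -⟩ := isContinuation_Z_aux s
  have h := Classical.epsilon_spec (p := IsContinuation (zetaSeries s)) ⟨H, hH⟩
  have heq : EqOn (Z s) (continuation (zetaSeries s)) cutAtOne := fun z hz => by
    rw [Z, if_neg]
    rintro rfl
    exact one_notMem_cutAtOne hz
  exact ⟨DifferentiableOn.congr h.1 heq, fun z hz => (heq (ball_subset_cutAtOne hz)).trans (h.2 hz)⟩

lemma hasDerivAt_Z (s : ℂ) {z : ℂ} (hz : z ∈ cutAtOne) : HasDerivAt (Z s) (-pullback s z) z := by
  obtain ⟨H, hH, hd⟩ := isContinuation_Z_aux s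
  have heq : EqOn (Z s) H cutAtOne := by
    refine ((isContinuation_Z s).1.analyticOnNhd isOpen_cutAtOne).eqOn_of_preconnected_of_eventuallyEq
      (hH.1.analyticOnNhd isOpen_cutAtOne) isPreconnected_cutAtOne
      (ball_subset_cutAtOne (Metric.mem_ball_self one_pos)) ?_
    refine eventually_of_mem (Metric.ball_mem_nhds 0 one_pos) fun w hw => ?_
    rw [(isContinuation_Z s).2 hw, hH.2 hw]
  exact (hd z hz).congr_of_eventuallyEq (eventually_of_mem (isOpen_cutAtOne.mem_nhds hz) heq)

/-! ### The value of `Z` at `1` -/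

lemma norm_zetaCoeff_le (k m : ℕ) {s : ℂ} (ha : 0 < (s + k).re) :
    ‖S (m + 1) s / (((m + 1 : ℕ) : ℂ) + 1)‖ ≤ sConst k s * (1 / ((m : ℝ) + 1) ^ (3 / 2 : ℝ)) := by
  have hm : (0 : ℝ) < (m : ℝ) + 1 := by positivity
  have h1 : ‖(((m + 1 : ℕ) : ℂ) + 1)‖ = (m : ℝ) + 1 + 1 := by
    rw [show (((m + 1 : ℕ) : ℂ) + 1) = ((m + 1 + 1 : ℕ) : ℂ) by push_cast; rfl, Complex.norm_natCast]
    push_cast; rfl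
  have h2 : ((m : ℝ) + 1) ^ (3 / 2 : ℝ) = √((m : ℝ) + 1) * ((m : ℝ) + 1) := by
    rw [show (3 / 2 : ℝ) = 1 / 2 + 1 by norm_num, Real.rpow_add_one hm.ne', Real.sqrt_eq_rpow]
  rw [norm_div, h1, h2, mul_one_div, ← div_div]
  refine div_le_div₀ (div_nonneg (sConst_nonneg k ha) (Real.sqrt_nonneg _))
    (norm_S_succ_le k m ha) hm (by linarith)

lemma summable_three_halves : Summable fun m : ℕ => 1 / ((m : ℝ) + 1) ^ (3 / 2 : ℝ) := by
  have := (Real.summable_one_div_nat_add_rpow 1 (3 / 2)).2 (by norm_num)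
  refine this.congr fun m => ?_
  rw [abs_of_pos (by positivity)]

lemma summable_zetaCoeff (s : ℂ) : Summable fun n : ℕ => S n s / ((n : ℂ) + 1) := by
  obtain ⟨k, -, hk⟩ := exists_shift s
  refine (summable_nat_add_iff 1).1 ?_
  exact Summable.of_norm_bounded (summable_three_halves.mul_left (sConst k s))
    fun m => norm_zetaCoeff_le k m hk

lemma zetaSeries_one (s : ℂ) :
    zetaSeries s 1 = ∑' m : ℕ, S (m + 1) s / (((m + 1 : ℕ) : ℂ) + 1) := by
  rw [zetaSeries]
  simp only [one_pow, mul_one]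
  rw [(summable_zetaCoeff s).tsum_eq_zero_add]
  simp [S_zero]

lemma differentiable_S (n : ℕ) : Differentiable ℂ (S n) := by
  unfold S
  refine Differentiable.fun_sum fun k _ => Differentiable.const_mul ?_ _
  have h0 : ((k : ℂ) + 1) ≠ 0 := by exact_mod_cast (Nat.succ_ne_zero k)
  exact differentiable_neg.const_cpow (Or.inl h0)

lemma differentiable_zetaSeries_one : Differentiable ℂ fun s => zetaSeries s 1 := by
  intro s
  obtain ⟨k, -, hk⟩ := exists_shift s
  have hopen : IsOpen {z : ℂ | 0 < (z + k).re} := isOpen_lt continuous_const (by fun_prop)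
  -- Near `s` the same `k` works and the constant grows by less than `1`, giving a Weierstrass
  -- majorant.
  have hev := ((continuousAt_sConst k hk).eventually (gt_mem_nhds (lt_add_one (sConst k s)))).and
    (hopen.mem_nhds hk)
  obtain ⟨U, hU, hUo, hsU⟩ := eventually_nhds_iff.1 hev
  have h := Complex.differentiableOn_tsum_of_summable_norm
    (F := fun (m : ℕ) (s : ℂ) => S (m + 1) s / (((m + 1 : ℕ) : ℂ) + 1))
    (summable_three_halves.mul_left (sConst k s + 1))
    (fun m => ((differentiable_S (m + 1)).div_const _).differentiableOn) hUo (fun m z hz => by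
      refine (norm_zetaCoeff_le k m (hU z hz).2).trans ?_
      exact mul_le_mul_of_nonneg_right (hU z hz).1.le (by positivity))
  simp_rw [zetaSeries_one]
  exact h.differentiableAt (hUo.mem_nhds hsU)

lemma exp_neg_lt_one {t : ℝ} (ht : 0 < t) : Real.exp (-t) < 1 := by simpa using ht

/-- Closed form of `∑ m, eulerPoly 0 m p / (m + 2)` in the variable `p = exp (-t)`. -/
lemma hasSum_eulerPoly_zero {t : ℝ} (ht : 0 < t) :
    HasSum (fun m : ℕ => eulerPoly 0 m (Real.exp (-t) : ℝ) / (((m + 1 : ℕ) : ℂ) + 1))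
      (((Real.exp (-t) / (1 - Real.exp (-t)) ^ 2 * t : ℝ) : ℂ) -
        ((Real.exp (-t) / (1 - Real.exp (-t)) : ℝ) : ℂ)) := by
  set p := Real.exp (-t) with hp
  have hp1 : p < 1 := exp_neg_lt_one ht
  have hp0 : 0 < p := Real.exp_pos _
  have hq0 : 1 - p ≠ 0 := (sub_pos.2 hp1).ne'
  -- With `q = 1 - p`, `∑ q^{m+1}/(m+1) = -log p = t`; the first term is dropped and the rest
  -- multiplied by `p/q²`.
  have h1 := Real.hasSum_pow_div_log_of_abs_lt_one (x := 1 - p)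
    (by rw [abs_lt]; constructor <;> linarith)
  rw [sub_sub_cancel, hp, Real.log_exp, neg_neg, ← hp] at h1
  have h2 := ((hasSum_nat_add_iff' 1).2 h1).mul_left (p / (1 - p) ^ 2)
  have h3 := Complex.hasSum_ofReal.2 h2
  have hval : p / (1 - p) ^ 2 * (t - ∑ i ∈ Finset.range 1, (1 - p) ^ (i + 1) / ((i : ℝ) + 1)) =
      p / (1 - p) ^ 2 * t - p / (1 - p) := by
    simp
    field_simp
  rw [hval, Complex.ofReal_sub] at h3
  refine h3.congr_fun fun m => ?_
  have hq : (1 - (p : ℂ)) ≠ 0 := by exact_mod_cast hq0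
  simp only [eulerPoly, newtonCoeff]
  push_cast
  simp only [Finset.range_one, Finset.sum_singleton, if_true]
  have h4 : ((m : ℂ) + 1 + 1) ≠ 0 := by exact_mod_cast (Nat.succ_ne_zero (m + 1))
  simp
  field_simp
  ring

lemma hasSum_geometric_exp {t : ℝ} (ht : 0 < t) :
    HasSum (fun n : ℕ => (1 : ℂ) * (Real.exp (-((n : ℝ) + 1) * t) : ℝ))
      ((Real.exp (-t) / (1 - Real.exp (-t)) : ℝ) : ℂ) := by
  have h1 := (hasSum_geometric_of_lt_one (Real.exp_pos (-t)).le (exp_neg_lt_one ht)).mul_left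
    (Real.exp (-t))
  rw [← div_eq_mul_inv] at h1
  refine (Complex.hasSum_ofReal.2 h1).congr_fun fun n => ?_
  rw [← Real.exp_nat_mul, ← Real.exp_add]
  ring_nf

lemma hasSum_coe_mul_geometric_exp {t : ℝ} (ht : 0 < t) :
    HasSum (fun n : ℕ => ((n : ℂ) + 1) * (Real.exp (-((n : ℝ) + 1) * t) : ℝ))
      ((Real.exp (-t) / (1 - Real.exp (-t)) ^ 2 : ℝ) : ℂ) := by
  have h1 := hasSum_coe_mul_geometric_of_norm_lt_one (𝕜 := ℝ) (r := Real.exp (-t))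
    (by rw [Real.norm_of_nonneg (Real.exp_pos _).le]; exact exp_neg_lt_one ht)
  have h2 := (hasSum_nat_add_iff' 1).2 h1
  simp only [Finset.range_one, Finset.sum_singleton, Nat.cast_zero, zero_mul, sub_zero] at h2
  refine (Complex.hasSum_ofReal.2 h2).congr_fun fun n => ?_
  rw [← Real.exp_nat_mul]
  push_cast
  ring_nf

lemma mellin_geometric {σ : ℝ} (hσ : 1 < σ) :
    mellin (fun t : ℝ => ((Real.exp (-t) / (1 - Real.exp (-t)) : ℝ) : ℂ)) σ =
      Complex.Gamma σ * riemannZeta σ := by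
  have hσ' : 1 < (σ : ℂ).re := by simpa
  have h := hasSum_mellin (a := fun _ : ℕ => (1 : ℂ)) (p := fun n : ℕ => (n : ℝ) + 1) (s := σ)
    (fun n => Or.inr (by positivity)) (by linarith) (fun t ht => hasSum_geometric_exp ht) (by
      have := (Real.summable_one_div_nat_add_rpow 1 σ).2 hσ
      refine this.congr fun m => ?_
      rw [abs_of_pos (by positivity)]
      simp)
  rw [← h.tsum_eq, zeta_eq_tsum_one_div_nat_add_one_cpow hσ', ← tsum_mul_left]
  refine tsum_congr fun n => ?_
  push_cast
  ring

lemma mellin_coe_mul_geometric {σ : ℝ} (hσ : 1 < σ) :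
    mellin (fun t : ℝ => ((Real.exp (-t) / (1 - Real.exp (-t)) ^ 2 : ℝ) : ℂ)) ((σ : ℂ) + 1) =
      Complex.Gamma (σ + 1) * riemannZeta σ := by
  have hσ' : 1 < (σ : ℂ).re := by simpa
  have h := hasSum_mellin (a := fun n : ℕ => (n : ℂ) + 1) (p := fun n : ℕ => (n : ℝ) + 1)
    (s := (σ : ℂ) + 1) (fun n => Or.inr (by positivity)) (by simp; linarith)
    (fun t ht => hasSum_coe_mul_geometric_exp ht) (by
      have := (Real.summable_one_div_nat_add_rpow 1 σ).2 hσ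
      refine this.congr fun m => ?_
      have hm : (0 : ℝ) < (m : ℝ) + 1 := by positivity
      have h1 : ‖((m : ℂ) + 1)‖ = (m : ℝ) + 1 := by
        rw [show ((m : ℂ) + 1) = ((m + 1 : ℕ) : ℂ) by push_cast; rfl, Complex.norm_natCast]
        push_cast; rfl
      rw [abs_of_pos hm, h1]
      simp only [Complex.add_re, Complex.ofReal_re, Complex.one_re]
      rw [Real.rpow_add_one hm.ne']
      field_simp)
  rw [← h.tsum_eq, zeta_eq_tsum_one_div_nat_add_one_cpow hσ', ← tsum_mul_left]
  refine tsum_congr fun n => ?_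
  have h0 : ((n : ℂ) + 1) ≠ 0 := by exact_mod_cast (Nat.succ_ne_zero n)
  push_cast
  rw [Complex.cpow_add _ _ h0, Complex.cpow_one]
  field_simp

/-- A divergent integral has the default value `0`, so a nonzero value proves convergence. -/
lemma mellinConvergent_of_ne_zero {f : ℝ → ℂ} {s : ℂ} (h : mellin f s ≠ 0) :
    MellinConvergent f s := by
  by_contra hc
  exact h (integral_undef hc)

/-- Summation under the integral (with `k = 0`) leaves the Mellin transforms of `∑ n e^{-nt}` at `σ
+ 1` and of `∑ e^{-nt}` at `σ`, and `Γ(σ+1)ζ(σ) - Γ(σ)ζ(σ) = Γ(σ)(σ-1)ζ(σ)`. -/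
lemma zetaSeries_one_of_one_lt {σ : ℝ} (hσ : 1 < σ) :
    zetaSeries σ 1 = (σ - 1) * riemannZeta σ := by
  have hσ' : 1 < (σ : ℂ).re := by simpa
  have hσ0 : 0 < ((σ : ℂ) + (0 : ℕ)).re := by simp; linarith
  have hζ := riemannZeta_ne_zero_of_one_lt_re hσ'
  have hΓ : Complex.Gamma σ ≠ 0 := Complex.Gamma_ne_zero_of_re_pos (by linarith)
  have hσne : (σ : ℂ) ≠ 0 := by exact_mod_cast (show σ ≠ 0 by linarith)
  have hc1 := mellinConvergent_of_ne_zero (f := fun t : ℝ =>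
    ((Real.exp (-t) / (1 - Real.exp (-t)) : ℝ) : ℂ)) (s := σ)
    (by rw [mellin_geometric hσ]; exact mul_ne_zero hΓ hζ)
  have hc2 := mellinConvergent_of_ne_zero (f := fun t : ℝ =>
    ((Real.exp (-t) / (1 - Real.exp (-t)) ^ 2 : ℝ) : ℂ)) (s := (σ : ℂ) + 1)
    (by
      rw [mellin_coe_mul_geometric hσ, Complex.Gamma_add_one _ hσne]
      exact mul_ne_zero (mul_ne_zero hσne hΓ) hζ)
  have hdom := integrableOn_rpow_mul_exp hσ0 (show (0 : ℝ) < 1 / 2 by norm_num)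
  have hS : HasSum (fun m : ℕ => ∫ t in Ioi (0 : ℝ), ((t : ℂ) ^ ((σ : ℂ) + (0 : ℕ) - 1) *
      eulerPoly 0 m (Real.exp (-t) : ℝ)) / (((m + 1 : ℕ) : ℂ) + 1))
      (∫ t in Ioi (0 : ℝ), (t : ℂ) ^ ((σ : ℂ) + (0 : ℕ) - 1) *
        (((Real.exp (-t) / (1 - Real.exp (-t)) ^ 2 * t : ℝ) : ℂ) -
        ((Real.exp (-t) / (1 - Real.exp (-t)) : ℝ) : ℂ))) := by
    refine hasSum_integral_of_dominated_convergence (fun m t => (1 / ((m : ℝ) + 1) ^ (3 / 2 : ℝ)) *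
      (eulerConst 0 * (t ^ (((σ : ℂ) + (0 : ℕ)).re - 1) * Real.exp (-(1 / 2) * t))))
      ?_ ?_ ?_ ?_ ?_
    · intro m
      exact ((((continuousOn_cpow_sub_one _).mul
        (continuous_eulerPoly_exp 0 m).continuousOn)).div_const _).aestronglyMeasurable
        measurableSet_Ioi
    · intro m
      refine (ae_restrict_iff' measurableSet_Ioi).2 (ae_of_all _ fun t (ht : 0 < t) => ?_)
      have h1 := norm_cpow_mul_eulerPoly_le 0 m ((σ : ℂ) + (0 : ℕ)) ht
      have hm : (0 : ℝ) < (m : ℝ) + 1 := by positivity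
      have h2 : ‖(((m + 1 : ℕ) : ℂ) + 1)‖ = (m : ℝ) + 1 + 1 := by
        rw [show (((m + 1 : ℕ) : ℂ) + 1) = ((m + 1 + 1 : ℕ) : ℂ) by push_cast; rfl,
          Complex.norm_natCast]
        push_cast; rfl
      have h3 : ((m : ℝ) + 1) ^ (3 / 2 : ℝ) = √((m : ℝ) + 1) * ((m : ℝ) + 1) := by
        rw [show (3 / 2 : ℝ) = 1 / 2 + 1 by norm_num, Real.rpow_add_one hm.ne', Real.sqrt_eq_rpow]
      rw [norm_div, h2, h3]
      have hE := eulerConst_nonneg 0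
      calc _ ≤ (eulerConst 0 / √((m : ℝ) + 1)) * (t ^ (((σ : ℂ) + (0 : ℕ)).re - 1) *
            Real.exp (-(1 / 2) * t)) / ((m : ℝ) + 1) :=
          div_le_div₀ (by positivity) h1 hm (by linarith)
        _ = _ := by field_simp
    · exact ae_of_all _ fun t => summable_three_halves.mul_right _
    · simp_rw [tsum_mul_right]
      exact (hdom.const_mul _).const_mul _
    · refine (ae_restrict_iff' measurableSet_Ioi).2 (ae_of_all _ fun t (ht : 0 < t) => ?_)
      refine ((hasSum_eulerPoly_zero ht).mul_left _).congr_fun fun m => ?_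
      rw [mul_div_assoc]
  have hval : ∫ t in Ioi (0 : ℝ), (t : ℂ) ^ ((σ : ℂ) + (0 : ℕ) - 1) *
        (((Real.exp (-t) / (1 - Real.exp (-t)) ^ 2 * t : ℝ) : ℂ) -
        ((Real.exp (-t) / (1 - Real.exp (-t)) : ℝ) : ℂ)) =
      Complex.Gamma (σ + 1) * riemannZeta σ - Complex.Gamma σ * riemannZeta σ := by
    rw [← mellin_geometric hσ, ← mellin_coe_mul_geometric hσ, mellin, mellin, ← integral_sub hc2 hc1]
    refine setIntegral_congr_fun measurableSet_Ioi fun t (ht : 0 < t) => ?_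
    have ht0 : (t : ℂ) ≠ 0 := by exact_mod_cast ht.ne'
    simp only [smul_eq_mul, Nat.cast_zero, add_zero, add_sub_cancel_right]
    rw [show (t : ℂ) ^ (σ : ℂ) = (t : ℂ) ^ ((σ : ℂ) - 1) * t by
      rw [Complex.cpow_sub _ _ ht0, Complex.cpow_one]; field_simp]
    push_cast
    ring
  rw [hval] at hS
  have hS2 := hS.mul_left (Complex.Gamma σ)⁻¹
  rw [zetaSeries_one, show ((σ : ℂ) - 1) * riemannZeta σ = (Complex.Gamma σ)⁻¹ *
    (Complex.Gamma (σ + 1) * riemannZeta σ - Complex.Gamma σ * riemannZeta σ) by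
      rw [Complex.Gamma_add_one _ hσne]; field_simp, ← hS2.tsum_eq]
  refine tsum_congr fun m => ?_
  rw [S_eq_integral 0 m hσ0, integral_div]
  simp only [Nat.cast_zero, add_zero]
  rw [mul_div_assoc]

/-- The value at `1` of the parametrized zeta function. -/
theorem zetaSeries_one_eq (s : ℂ) : zetaSeries s 1 = subOneMulZeta s := by
  have hA : DifferentiableOn ℂ (fun s => zetaSeries s 1) {1}ᶜ :=
    differentiable_zetaSeries_one.differentiableOn
  have hB : DifferentiableOn ℂ (fun s => (s - 1) * riemannZeta s) {1}ᶜ := fun z hz =>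
    ((differentiableAt_id.sub_const 1).mul
      (differentiableAt_riemannZeta hz)).differentiableWithinAt
  have hseq : Tendsto (fun n : ℕ => (((2 : ℝ) + 1 / ((n : ℝ) + 1) : ℝ) : ℂ)) atTop (𝓝[≠] 2) := by
    refine tendsto_nhdsWithin_iff.2 ⟨?_, Eventually.of_forall fun n => ?_⟩
    · have := (tendsto_one_div_add_atTop_nhds_zero_nat (𝕜 := ℝ)).const_add 2
      rw [add_zero] at this
      exact (Complex.continuous_ofReal.tendsto' 2 2 (by simp)).comp this
    · have : (0 : ℝ) < 1 / ((n : ℝ) + 1) := by positivity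
      simp only [mem_compl_iff, mem_singleton_iff]
      intro h
      have h2 : (2 : ℝ) + 1 / ((n : ℝ) + 1) = 2 := by exact_mod_cast h
      linarith
  have hEq : EqOn (fun s => zetaSeries s 1) (fun s => (s - 1) * riemannZeta s) {1}ᶜ := by
    refine (hA.analyticOnNhd isOpen_compl_singleton).eqOn_of_preconnected_of_frequently_eq
      (hB.analyticOnNhd isOpen_compl_singleton)
      (isConnected_compl_singleton_of_one_lt_rank (by simp) 1).isPreconnected
      (z₀ := 2) (by simp) (hseq.frequently (Frequently.of_forall fun n => ?_))
    have : (0 : ℝ) < 1 / ((n : ℝ) + 1) := by positivity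
    exact zetaSeries_one_of_one_lt (by linarith)
  rw [subOneMulZeta]
  split_ifs with h
  · subst h
    -- At `s = 1`, continuity of the series in `s` meets the residue `1` of zeta.
    have h1 : Tendsto (fun s => zetaSeries s 1) (𝓝[≠] 1) (𝓝 (zetaSeries 1 1)) :=
      (differentiable_zetaSeries_one.continuous.tendsto 1).mono_left nhdsWithin_le_nhds
    refine tendsto_nhds_unique h1 (riemannZeta_residue_one.congr' ?_)
    exact eventually_of_mem self_mem_nhdsWithin fun z hz => (hEq hz).symm
  · exact hEq h

/-! ### The singularity of the integrand at `1` -/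

/-- The logarithmic coordinate `-log (1 / x - 1)`. -/
def logVar (x : ℂ) : ℂ := -Complex.log (1 / x - 1)

lemma ne_zero_of_near_one {x : ℂ} (hx : ‖x - 1‖ < 1 / 4) : x ≠ 0 := by
  rintro rfl
  norm_num at hx

lemma one_div_sub_one_eq {x : ℂ} (hx0 : x ≠ 0) : 1 / x - 1 = (1 - x) / x := by
  field_simp

lemma one_div_sub_one_ne_zero {x : ℂ} (hx : x ∈ cutAtOne) (hx1 : ‖x - 1‖ < 1 / 4) :
    1 / x - 1 ≠ 0 := by
  rw [one_div_sub_one_eq (ne_zero_of_near_one hx1)]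
  refine div_ne_zero (fun h => sub_one_ne_zero_of_mem hx ?_) (ne_zero_of_near_one hx1)
  rw [← neg_sub, h, neg_zero]

/-- Argument `π` would make `1/x - 1` a negative real, so `x` real with `x > 1` or `x < 0`; the
first is on the cut, the second is far from `1`. -/
lemma abs_im_logVar_lt {x : ℂ} (hx : x ∈ cutAtOne) (hx1 : ‖x - 1‖ < 1 / 4) :
    |(logVar x).im| < Real.pi := by
  rw [logVar, Complex.neg_im, abs_neg, Complex.log_im, abs_lt]
  refine ⟨Complex.neg_pi_lt_arg _, lt_of_le_of_ne (Complex.arg_le_pi _) fun h => ?_⟩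
  obtain ⟨hre, him⟩ := Complex.arg_eq_pi_iff.1 h
  have hx0 := ne_zero_of_near_one hx1
  set y : ℝ := (1 / x - 1).re with hy
  have h1 : 1 / x - 1 = (y : ℂ) := Complex.ext (by simp [hy]) (by simpa using him)
  have h2 : x * ((1 + y : ℝ) : ℂ) = 1 := by
    push_cast
    rw [← h1]
    field_simp
    ring
  have hy1 : (1 + y) ≠ 0 := by
    intro h0
    rw [h0] at h2
    simp at h2
  have h3 : x = ((1 / (1 + y) : ℝ) : ℂ) := by
    have : ((1 + y : ℝ) : ℂ) ≠ 0 := by exact_mod_cast hy1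
    rw [Complex.ofReal_div, Complex.ofReal_one]
    rw [eq_div_iff this, h2]
  have hpos : 0 < 1 + y := by
    by_contra hneg
    have h4 : 1 / (1 + y) ≤ 0 := one_div_nonpos.2 (not_lt.1 hneg)
    have h5 : ‖x - 1‖ = |1 / (1 + y) - 1| := by
      rw [h3, ← Complex.ofReal_one, ← Complex.ofReal_sub, Complex.norm_real, Real.norm_eq_abs]
    rw [h5, abs_lt] at hx1
    linarith
  refine mem_cutAtOne.1 hx (1 / (1 + y)) ?_ h3.symm
  rw [le_div_iff₀ hpos]
  linarith

lemma neg_exp_logVar {x : ℂ} (hx : x ∈ cutAtOne) (hx1 : ‖x - 1‖ < 1 / 4) :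
    -Complex.exp (logVar x) = x / (x - 1) := by
  have hx0 := ne_zero_of_near_one hx1
  have h1 := sub_one_ne_zero_of_mem hx
  have h2 : 1 - x ≠ 0 := by rw [← neg_sub]; exact neg_ne_zero.2 h1
  rw [logVar, Complex.exp_neg, Complex.exp_log (one_div_sub_one_ne_zero hx hx1),
    one_div_sub_one_eq hx0, inv_div, neg_eq_iff_add_eq_zero, div_add_div _ _ h2 h1]
  rw [div_eq_zero_iff]
  left
  ring

lemma re_logVar {x : ℂ} (hx : x ∈ cutAtOne) (hx1 : ‖x - 1‖ < 1 / 4) :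
    (logVar x).re = Real.log ‖x‖ - Real.log ‖1 - x‖ := by
  have hx0 := ne_zero_of_near_one hx1
  have h2 : 1 - x ≠ 0 := by
    rw [← neg_sub]; exact neg_ne_zero.2 (sub_one_ne_zero_of_mem hx)
  rw [logVar, Complex.neg_re, Complex.log_re, one_div_sub_one_eq hx0, norm_div,
    Real.log_div (norm_ne_zero_iff.2 h2) (norm_ne_zero_iff.2 hx0)]
  ring

lemma eventually_near_one {δ : ℝ} (hδ : 0 < δ) :
    ∀ᶠ x in 𝓝[cutAtOne] (1 : ℂ), x ∈ cutAtOne ∧ ‖x - 1‖ < δ := by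
  refine (eventually_mem_nhdsWithin).and (nhdsWithin_le_nhds ?_)
  filter_upwards [Metric.ball_mem_nhds (1 : ℂ) hδ] with x hx
  rwa [Metric.mem_ball, dist_eq_norm] at hx

lemma tendsto_logVar : Tendsto logVar (𝓝[cutAtOne] 1) stripFilter := by
  refine tendsto_inf.2 ⟨tendsto_comap_iff.2 ?_, tendsto_principal.2 ?_⟩
  · have h1 : Tendsto (fun x : ℂ => Real.log ‖x‖) (𝓝[cutAtOne] 1) (𝓝 (Real.log ‖(1 : ℂ)‖)) := by
      refine (ContinuousAt.tendsto ?_).mono_left nhdsWithin_le_nhds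
      exact continuous_norm.continuousAt.log (by simp)
    have h2 : Tendsto (fun x : ℂ => ‖1 - x‖) (𝓝[cutAtOne] 1) (𝓝[≠] 0) := by
      refine tendsto_nhdsWithin_iff.2 ⟨?_, eventually_mem_nhdsWithin.mono fun x hx => ?_⟩
      · have : Tendsto (fun x : ℂ => ‖1 - x‖) (𝓝 1) (𝓝 0) := by
          have hc : Continuous fun x : ℂ => ‖1 - x‖ := by fun_prop
          simpa using hc.tendsto 1
        exact this.mono_left nhdsWithin_le_nhds
      · have := sub_one_ne_zero_of_mem hx
        rw [← norm_ne_zero_iff, norm_sub_rev] at this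
        exact this
    have h3 := h1.add_atTop (tendsto_neg_atBot_atTop.comp (Real.tendsto_log_nhdsNE_zero.comp h2))
    refine h3.congr' ?_
    filter_upwards [eventually_near_one (show (0 : ℝ) < 1 / 4 by norm_num)] with x hx
    simp only [Function.comp]
    rw [re_logVar hx.1 hx.2]
    ring
  · filter_upwards [eventually_near_one (show (0 : ℝ) < 1 / 4 by norm_num)] with x hx
    exact abs_im_logVar_lt hx.1 hx.2

lemma tendsto_pullback_div (s : ℂ) :
    Tendsto (fun x => pullback s x / logVar x ^ s) (𝓝[cutAtOne] 1)
      (𝓝 (-(Complex.Gamma (1 + s))⁻¹)) := by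
  refine ((tendsto_polylog_neg_exp_div_cpow s).comp tendsto_logVar).congr' ?_
  filter_upwards [eventually_near_one (show (0 : ℝ) < 1 / 4 by norm_num)] with x hx
  simp only [Function.comp]
  rw [neg_exp_logVar hx.1 hx.2, pullback]

lemma eventually_norm_cpow_le (s : ℂ) :
    ∀ᶠ L in stripFilter, ‖L ^ s‖ ≤ Real.exp (L.re / 2) := by
  have hε : (0 : ℝ) < 1 / (4 * (‖s‖ + 1)) := by positivity
  have hlog := (Real.isLittleO_log_id_atTop.def hε)
  have hy : Tendsto (fun L : ℂ => L.re + Real.pi) stripFilter atTop :=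
    tendsto_atTop_add_const_right _ _ tendsto_re_stripFilter
  -- The logarithm costs at most `(Re L + π)/4` and the argument `π‖s‖`; the total is below `Re L /
  -- 2` once `Re L ≥ π + 4‖s‖π`.
  filter_upwards [hy.eventually hlog, eventually_stripFilter (max 1 (Real.pi + 4 * ‖s‖ * Real.pi))]
    with L hL1 hL2
  have hre1 : 1 ≤ L.re := (le_max_left _ _).trans hL2.1
  have hre2 := (le_max_right _ _).trans hL2.1
  have hL0 : L ≠ 0 := by rintro rfl; simp at hre1; linarith
  have hnL : 1 ≤ ‖L‖ := hre1.trans (Complex.re_le_norm L)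
  have hpi := Real.pi_pos
  have h1 : ‖Complex.log L‖ ≤ Real.log (L.re + Real.pi) + Real.pi := by
    refine (Complex.norm_le_abs_re_add_abs_im _).trans (add_le_add ?_ ?_)
    · rw [Complex.log_re, abs_of_nonneg (Real.log_nonneg hnL)]
      exact Real.log_le_log (by linarith) (norm_le_re_add_pi (by linarith) hL2.2)
    · rw [Complex.log_im]
      exact Complex.abs_arg_le_pi L
  rw [Complex.cpow_def_of_ne_zero hL0]
  refine (Complex.norm_exp_le_exp_norm _).trans (Real.exp_le_exp.2 ?_)
  rw [norm_mul]
  simp only [id] at hL1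
  rw [Real.norm_of_nonneg (by linarith : 0 ≤ L.re + Real.pi)] at hL1
  have h2 := (le_abs_self _).trans hL1
  have h3 : 1 / (4 * (‖s‖ + 1)) * (L.re + Real.pi) * ‖s‖ ≤ (L.re + Real.pi) / 4 := by
    have h4 : 1 / (4 * (‖s‖ + 1)) * ‖s‖ ≤ 1 / 4 := by
      rw [one_div_mul_eq_div, div_le_div_iff₀ (by positivity) (by norm_num)]
      linarith
    nlinarith [mul_le_mul_of_nonneg_right h4 (show 0 ≤ L.re + Real.pi by linarith)]
  have h5 : ‖Complex.log L‖ * ‖s‖ ≤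
      (1 / (4 * (‖s‖ + 1)) * (L.re + Real.pi) + Real.pi) * ‖s‖ :=
    mul_le_mul_of_nonneg_right (h1.trans (by linarith)) (norm_nonneg s)
  nlinarith

/-- Near `1` the integrand has an integrable singularity. -/
lemma exists_norm_pullback_le (s : ℂ) : ∃ C δ : ℝ, 0 ≤ C ∧ 0 < δ ∧ ∀ z ∈ cutAtOne, ‖z - 1‖ < δ →
    ‖pullback s z‖ ≤ C * ‖1 - z‖ ^ (-(1 / 2) : ℝ) := by
  set c := -(Complex.Gamma (1 + s))⁻¹ with hc
  have h1 := (tendsto_pullback_div s).norm.eventually (gt_mem_nhds (lt_add_one ‖c‖))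
  have h2 := tendsto_logVar.eventually (eventually_norm_cpow_le s)
  have h3 := tendsto_logVar.eventually (eventually_stripFilter 1)
  have h4 := (h1.and (h2.and h3)).and (eventually_near_one (show (0 : ℝ) < 1 / 4 by norm_num))
  rw [eventually_nhdsWithin_iff, Metric.eventually_nhds_iff] at h4
  obtain ⟨δ, hδ, h⟩ := h4
  refine ⟨(‖c‖ + 1) * 2, δ, by positivity, hδ, fun z hz hz1 => ?_⟩
  obtain ⟨⟨ha, hb, hd⟩, -, he⟩ := h (by rwa [dist_eq_norm]) hz
  have hL0 : logVar z ≠ 0 := by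
    intro h0
    have := hd.1
    rw [h0] at this
    simp at this
    linarith
  have hLs : 0 < ‖logVar z ^ s‖ := by
    rw [norm_pos_iff]; simp [Complex.cpow_eq_zero_iff, hL0]
  rw [norm_div, div_lt_iff₀ hLs] at ha
  have hz0 : 0 < ‖1 - z‖ := by
    rw [norm_sub_rev]; exact norm_pos_iff.2 (sub_one_ne_zero_of_mem hz)
  have hz2 : ‖z‖ ≤ 2 := by
    calc ‖z‖ = ‖(z - 1) + 1‖ := by ring_nf
      _ ≤ ‖z - 1‖ + ‖(1 : ℂ)‖ := norm_add_le _ _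
      _ ≤ 2 := by rw [norm_one]; linarith
  have hzpos : 0 < ‖z‖ := norm_pos_iff.2 (ne_zero_of_near_one he)
  have h5 : Real.exp ((logVar z).re / 2) ≤ 2 * ‖1 - z‖ ^ (-(1 / 2) : ℝ) := by
    rw [re_logVar hz he, sub_div, Real.exp_sub, Real.rpow_neg hz0.le, ← div_eq_mul_inv,
      Real.rpow_def_of_pos hz0, mul_one_div]
    gcongr
    rw [← Real.le_log_iff_exp_le (by norm_num)]
    have := Real.log_le_log hzpos hz2
    have := Real.log_nonneg (show (1 : ℝ) ≤ 2 by norm_num)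
    linarith
  calc ‖pullback s z‖ ≤ (‖c‖ + 1) * ‖logVar z ^ s‖ := ha.le
    _ ≤ (‖c‖ + 1) * (2 * ‖1 - z‖ ^ (-(1 / 2) : ℝ)) := by gcongr; exact hb.trans h5
    _ = _ := by ring

/-! ### Continuity of `Z` at `1` -/

lemma ray_to_one_mem {x : ℂ} (hx : x ∈ cutAtOne) {r : ℝ} (hr0 : 0 < r) :
    1 - r * (1 - x) ∈ cutAtOne := by
  rw [mem_cutAtOne] at hx ⊢
  intro t ht h
  refine hx (1 + (t - 1) / r) (by have : 0 ≤ (t - 1) / r := div_nonneg (by linarith) hr0.le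
                                  linarith) ?_
  have : (r : ℂ) ≠ 0 := by exact_mod_cast hr0.ne'
  push_cast
  rw [h]
  field_simp
  ring

/-- Absolute convergence at `1` dominates the series on the real segment below `1`. -/
lemma tendsto_Z_radial (s : ℂ) :
    Tendsto (fun r : ℝ => Z s (1 - r)) (𝓝[>] 0) (𝓝 (zetaSeries s 1)) := by
  have h1 : Tendsto (fun r : ℝ => zetaSeries s (1 - r)) (𝓝[>] 0) (𝓝 (zetaSeries s 1)) := by
    refine tendsto_tsum_of_dominated_convergence (summable_zetaCoeff s).norm ?_ ?_
    · intro n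
      have : Continuous fun r : ℝ => S n s / ((n : ℂ) + 1) * (1 - (r : ℂ)) ^ (n + 1) := by fun_prop
      exact (this.tendsto' 0 _ (by simp)).mono_left nhdsWithin_le_nhds
    · filter_upwards [Ioo_mem_nhdsGT (show (0 : ℝ) < 1 by norm_num)] with r hr n
      rw [norm_mul, norm_pow]
      refine mul_le_of_le_one_right (norm_nonneg _) (pow_le_one₀ (norm_nonneg _) ?_)
      rw [← Complex.ofReal_one, ← Complex.ofReal_sub, Complex.norm_real, Real.norm_eq_abs, abs_le]
      constructor <;> linarith [hr.1, hr.2]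
  refine h1.congr' ?_
  filter_upwards [Ioo_mem_nhdsGT (show (0 : ℝ) < 1 by norm_num)] with r hr
  refine ((isContinuation_Z s).2 ?_).symm
  rw [mem_ball_zero_iff, ← Complex.ofReal_one, ← Complex.ofReal_sub, Complex.norm_real,
    Real.norm_eq_abs, abs_lt]
  constructor <;> linarith [hr.1, hr.2]

/-- Comparison with the radial limit along the segment `1 - r(1 - tx)`, `0 ≤ t ≤ 1`. It has length
`r‖x‖` and stays at distance at least `rc` from `1`, where the derivative of `Z` is
`O((rc)^{-1/2})`; so the difference is `O(r^{1/2})`. -/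
lemma tendsto_Z_ray (s : ℂ) {x : ℂ} (hx : x ∈ cutAtOne) :
    Tendsto (fun r : ℝ => Z s (1 - r * (1 - x))) (𝓝[>] 0) (𝓝 (zetaSeries s 1)) := by
  obtain ⟨C, δ, hC0, hδ, hC⟩ := exists_norm_pullback_le s
  obtain ⟨t0, ht0, hmin⟩ := (isCompact_Icc (a := (0 : ℝ)) (b := 1)).exists_isMinOn
    (nonempty_Icc.2 zero_le_one) (f := fun t : ℝ => ‖1 - t * x‖) (by fun_prop)
  set c := ‖1 - t0 * x‖ with hc
  have hc0 : 0 < c := by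
    rw [hc, norm_sub_rev]
    exact norm_pos_iff.2 (sub_one_ne_zero_of_mem (smul_mem_cutAtOne hx ht0.1 ht0.2))
  have hM : ∀ t ∈ Icc (0 : ℝ) 1, ‖1 - t * x‖ ≤ 1 + ‖x‖ := by
    intro t ht
    refine (norm_sub_le _ _).trans ?_
    rw [norm_one, norm_mul, Complex.norm_real, Real.norm_of_nonneg ht.1]
    have := mul_le_of_le_one_left (norm_nonneg x) ht.2
    linarith
  have hbound : ∀ r : ℝ, 0 < r → r < min 1 (δ / (1 + ‖x‖)) →
      ‖Z s (1 - r * (1 - x)) - Z s (1 - r)‖ ≤ C * c ^ (-(1 / 2) : ℝ) * ‖x‖ * r ^ (1 / 2 : ℝ) := by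
    intro r hr0 hr
    have hr1 : r ≤ 1 := (hr.trans_le (min_le_left _ _)).le
    have hr2 : r * (1 + ‖x‖) < δ := by
      rw [← lt_div_iff₀ (by positivity)]; exact hr.trans_le (min_le_right _ _)
    have hmem : ∀ t ∈ Icc (0 : ℝ) 1, 1 - r * (1 - t * x) ∈ cutAtOne := fun t ht =>
      ray_to_one_mem (smul_mem_cutAtOne hx ht.1 ht.2) hr0
    have h := norm_image_sub_le_of_norm_deriv_le_segment_01'
      (f := fun t : ℝ => Z s (1 - r * (1 - t * x)))
      (f' := fun t : ℝ => -pullback s (1 - r * (1 - t * x)) * (r * x))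
      (C := C * c ^ (-(1 / 2) : ℝ) * ‖x‖ * r ^ (1 / 2 : ℝ)) ?_ ?_
    · simpa using h
    · intro t ht
      have h1 : HasDerivAt (fun t : ℝ => 1 - (r : ℂ) * (1 - t * x)) (r * x) t := by
        have h2 : HasDerivAt (fun t : ℝ => (t : ℂ)) 1 t := (hasDerivAt_id t).ofReal_comp
        simpa using ((((h2.mul_const x).const_sub 1).const_mul (r : ℂ)).const_sub 1)
      exact ((hasDerivAt_Z s (hmem t ht)).comp t h1).hasDerivWithinAt
    · intro t ht
      have ht' := Ico_subset_Icc_self ht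
      have h1 : ‖1 - (1 - r * (1 - t * x))‖ = r * ‖1 - t * x‖ := by
        rw [sub_sub_cancel, norm_mul, Complex.norm_real, Real.norm_of_nonneg hr0.le]
      have h2 := hC _ (hmem t ht') (by
        rw [norm_sub_rev, h1]
        exact (mul_le_mul_of_nonneg_left (hM t ht') hr0.le).trans_lt hr2)
      rw [h1] at h2
      have h3 : (r * ‖1 - t * x‖) ^ (-(1 / 2) : ℝ) ≤ (r * c) ^ (-(1 / 2) : ℝ) :=
        Real.rpow_le_rpow_of_nonpos (by positivity)
          (mul_le_mul_of_nonneg_left (hmin ht') hr0.le) (by norm_num)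
      rw [norm_mul, norm_neg, norm_mul, Complex.norm_real, Real.norm_of_nonneg hr0.le]
      have h4 : r ^ (-(1 / 2) : ℝ) * r = r ^ (1 / 2 : ℝ) := by
        rw [← Real.rpow_add_one hr0.ne']; norm_num
      calc _ ≤ C * (r * c) ^ (-(1 / 2) : ℝ) * (r * ‖x‖) := by
            gcongr; exact h2.trans (by gcongr)
        _ = C * c ^ (-(1 / 2) : ℝ) * ‖x‖ * (r ^ (-(1 / 2) : ℝ) * r) := by
            rw [Real.mul_rpow hr0.le hc0.le]; ring
        _ = _ := by rw [h4]
  have hzero : Tendsto (fun r : ℝ => C * c ^ (-(1 / 2) : ℝ) * ‖x‖ * r ^ (1 / 2 : ℝ)) (𝓝[>] 0)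
      (𝓝 0) := by
    have : Continuous fun r : ℝ => C * c ^ (-(1 / 2) : ℝ) * ‖x‖ * r ^ (1 / 2 : ℝ) :=
      continuous_const.mul (Real.continuous_rpow_const (by norm_num))
    exact (this.tendsto' 0 0 (by norm_num)).mono_left nhdsWithin_le_nhds
  have hdiff : Tendsto (fun r : ℝ => Z s (1 - r * (1 - x)) - Z s (1 - r)) (𝓝[>] 0) (𝓝 0) := by
    refine squeeze_zero_norm' ?_ hzero
    filter_upwards [Ioo_mem_nhdsGT (show (0 : ℝ) < min 1 (δ / (1 + ‖x‖)) by positivity)] with r hr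
    exact hbound r hr.1 hr.2
  simpa using hdiff.add (tendsto_Z_radial s)

lemma continuousOn_pullback_ray (s : ℂ) {x : ℂ} (hx : x ∈ cutAtOne) :
    ContinuousOn (fun r : ℝ => pullback s (1 - r * (1 - x))) (Ioc 0 1) :=
  (differentiableOn_pullback s).continuousOn.comp (by fun_prop)
    fun r hr => ray_to_one_mem hx hr.1

lemma norm_ray_to_one (x : ℂ) {r : ℝ} (hr : 0 ≤ r) : ‖1 - (1 - r * (1 - x))‖ = r * ‖1 - x‖ := by
  rw [sub_sub_cancel, norm_mul, Complex.norm_real, Real.norm_of_nonneg hr]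

lemma integrableOn_rpow_neg_half : IntegrableOn (fun r : ℝ => r ^ (-(1 / 2) : ℝ)) (Ioc 0 1) := by
  rw [← intervalIntegrable_iff_integrableOn_Ioc_of_le (by norm_num)]
  exact intervalIntegral.intervalIntegrable_rpow' (by norm_num)

/-- `Z s x` minus its value at `1`, as an integral along the segment from `x` to `1`, and its size,
for `x` near `1`. -/
lemma Z_sub_eq_integral (s : ℂ) : ∃ C δ : ℝ, 0 < δ ∧ ∀ x ∈ cutAtOne, ‖x - 1‖ < δ →
    Z s x - zetaSeries s 1 = (1 - x) * ∫ r in Ioc (0 : ℝ) 1, pullback s (1 - r * (1 - x)) ∧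
    ‖Z s x - zetaSeries s 1‖ ≤ C * ‖1 - x‖ ^ (1 / 2 : ℝ) := by
  obtain ⟨C, δ, hC0, hδ, hC⟩ := exists_norm_pullback_le s
  refine ⟨C * ∫ r in Ioc (0 : ℝ) 1, r ^ (-(1 / 2) : ℝ), δ, hδ, fun x hx hx1 => ?_⟩
  have hx0 : 0 < ‖1 - x‖ := by
    rw [norm_sub_rev]; exact norm_pos_iff.2 (sub_one_ne_zero_of_mem hx)
  have hbound : ∀ r ∈ Ioc (0 : ℝ) 1, ‖pullback s (1 - r * (1 - x))‖ ≤
      r ^ (-(1 / 2) : ℝ) * (C * ‖1 - x‖ ^ (-(1 / 2) : ℝ)) := by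
    intro r hr
    have h1 := hC _ (ray_to_one_mem hx hr.1) (by
      rw [norm_sub_rev, norm_ray_to_one x hr.1.le, norm_sub_rev 1 x]
      exact (mul_le_of_le_one_left (norm_nonneg _) hr.2).trans_lt hx1)
    rw [norm_ray_to_one x hr.1.le, Real.mul_rpow hr.1.le hx0.le] at h1
    exact h1.trans (le_of_eq (by ring))
  have hbae : ∀ᵐ r : ℝ ∂(volume.restrict (Ioc (0 : ℝ) 1)), ‖pullback s (1 - r * (1 - x))‖ ≤
      r ^ (-(1 / 2) : ℝ) * (C * ‖1 - x‖ ^ (-(1 / 2) : ℝ)) :=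
    (ae_restrict_iff' measurableSet_Ioc).2 (ae_of_all _ hbound)
  have hint : IntegrableOn (fun r : ℝ => pullback s (1 - r * (1 - x))) (Ioc 0 1) :=
    Integrable.mono' (integrableOn_rpow_neg_half.mul_const _)
      ((continuousOn_pullback_ray s hx).aestronglyMeasurable measurableSet_Ioc) hbae
  have hmain : Z s x - zetaSeries s 1 =
      (1 - x) * ∫ r in Ioc (0 : ℝ) 1, pullback s (1 - r * (1 - x)) := by
    have hd : ∀ r ∈ Ioc (0 : ℝ) 1, HasDerivAt (fun r : ℝ => Z s (1 - r * (1 - x)))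
        ((1 - x) * pullback s (1 - r * (1 - x))) r := by
      intro r hr
      have h1 : HasDerivAt (fun r : ℝ => 1 - (r : ℂ) * (1 - x)) (-(1 - x)) r := by
        have h2 : HasDerivAt (fun t : ℝ => (t : ℂ)) 1 r := (hasDerivAt_id r).ofReal_comp
        simpa using ((h2.mul_const (1 - x)).const_sub 1)
      refine ((hasDerivAt_Z s (ray_to_one_mem hx hr.1)).comp r h1).congr_deriv ?_
      ring
    have h := intervalIntegral.integral_eq_sub_of_hasDerivAt_of_tendsto (a := 0) (b := 1)
      (fa := zetaSeries s 1) (fb := Z s x) zero_lt_one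
      (fun r hr => hd r (Ioo_subset_Ioc_self hr))
      ((intervalIntegrable_iff_integrableOn_Ioc_of_le zero_le_one).2 (hint.const_mul (1 - x)))
      (tendsto_Z_ray s hx) (by
        have hc := (hd 1 ⟨zero_lt_one, le_rfl⟩).continuousAt.tendsto
        simp only [Complex.ofReal_one, one_mul, sub_sub_cancel] at hc
        exact hc.mono_left nhdsWithin_le_nhds)
    rw [intervalIntegral.integral_of_le zero_le_one, integral_const_mul] at h
    exact h.symm
  refine ⟨hmain, ?_⟩
  have h1 := norm_integral_le_of_norm_le (integrableOn_rpow_neg_half.mul_const _) hbae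
  rw [integral_mul_const] at h1
  have h2 : ‖1 - x‖ * ‖1 - x‖ ^ (-(1 / 2) : ℝ) = ‖1 - x‖ ^ (1 / 2 : ℝ) := by
    rw [mul_comm, ← Real.rpow_add_one hx0.ne']; norm_num
  rw [hmain, norm_mul]
  calc _ ≤ ‖1 - x‖ * ((∫ r in Ioc (0 : ℝ) 1, r ^ (-(1 / 2) : ℝ)) *
        (C * ‖1 - x‖ ^ (-(1 / 2) : ℝ))) := by gcongr
    _ = (C * ∫ r in Ioc (0 : ℝ) 1, r ^ (-(1 / 2) : ℝ)) *
        (‖1 - x‖ * ‖1 - x‖ ^ (-(1 / 2) : ℝ)) := by ring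
    _ = _ := by rw [h2]

lemma tendsto_Z_sub (s : ℂ) :
    Tendsto (fun x => Z s x - zetaSeries s 1) (𝓝[cutAtOne] 1) (𝓝 0) := by
  obtain ⟨C, δ, hδ, h⟩ := Z_sub_eq_integral s
  have hz : Tendsto (fun x : ℂ => C * ‖1 - x‖ ^ (1 / 2 : ℝ)) (𝓝[cutAtOne] 1) (𝓝 0) := by
    have : Continuous fun x : ℂ => C * ‖1 - x‖ ^ (1 / 2 : ℝ) :=
      continuous_const.mul ((Real.continuous_rpow_const (by norm_num)).comp (by fun_prop))
    exact (this.tendsto' 1 0 (by norm_num)).mono_left nhdsWithin_le_nhds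
  refine squeeze_zero_norm' ?_ hz
  filter_upwards [eventually_near_one hδ] with x hx
  exact (h x hx.1 hx.2).2

/-! ### Asymptotics of the integral -/

/-- The logarithm of `logVar` varies slowly along the segment from `x` to `1`. -/
lemma norm_log_logVar_sub_le {x : ℂ} (hx : x ∈ cutAtOne) (hx1 : ‖x - 1‖ < 1 / 4)
    (hL : 1 < (logVar x).re) {r : ℝ} (hr0 : 0 < r) (hr1 : r ≤ 1) :
    0 < (logVar (1 - r * (1 - x))).re ∧
    ‖Complex.log (logVar (1 - r * (1 - x))) - Complex.log (logVar x)‖ ≤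
      (8 - Real.log r) / ((logVar x).re - 1) := by
  set z := 1 - r * (1 - x) with hz
  have hzm : z ∈ cutAtOne := ray_to_one_mem hx hr0
  have hzn : ‖1 - z‖ = r * ‖1 - x‖ := norm_ray_to_one x hr0.le
  have hz1 : ‖z - 1‖ < 1 / 4 := by
    rw [norm_sub_rev, hzn, norm_sub_rev 1 x]
    exact (mul_le_of_le_one_left (norm_nonneg _) hr1).trans_lt hx1
  have hx0 : 0 < ‖1 - x‖ := by
    rw [norm_sub_rev]; exact norm_pos_iff.2 (sub_one_ne_zero_of_mem hx)
  have hbds : ∀ y : ℂ, ‖y - 1‖ < 1 / 4 → 3 / 4 < ‖y‖ ∧ ‖y‖ < 5 / 4 := by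
    intro y hy
    have h1 := norm_sub_norm_le (1 : ℂ) y
    have h2 := norm_sub_norm_le y (1 : ℂ)
    rw [norm_one] at h1 h2
    rw [norm_sub_rev] at h1
    constructor <;> linarith
  obtain ⟨ha, hb⟩ := hbds x hx1
  obtain ⟨hc, hd⟩ := hbds z hz1
  have hratio : ∀ u v : ℝ, 3 / 4 < u → u < 5 / 4 → 3 / 4 < v → v < 5 / 4 →
      Real.log u - Real.log v ≤ 1 := by
    intro u v hu1 hu2 hv1 hv2
    rw [← Real.log_div (by linarith) (by linarith), Real.log_le_iff_le_exp (by
      apply div_pos <;> linarith)]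
    have := Real.add_one_le_exp (1 : ℝ)
    refine le_trans ?_ this
    rw [div_le_iff₀ (by linarith)]
    linarith
  have h1 := hratio _ _ ha hb hc hd
  have h2 := hratio _ _ hc hd ha hb
  have hre : (logVar z).re = (logVar x).re - Real.log r + (Real.log ‖z‖ - Real.log ‖x‖) := by
    rw [re_logVar hzm hz1, re_logVar hx hx1, hzn, Real.log_mul hr0.ne' hx0.ne']
    ring
  have hlog : Real.log r ≤ 0 := Real.log_nonpos hr0.le hr1
  have hge : (logVar x).re - 1 ≤ (logVar z).re := by rw [hre]; linarith
  refine ⟨by linarith, ?_⟩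
  have hm : 0 < (logVar x).re - 1 := by linarith
  -- `8 = 1 + 7`: `1` bounds the logarithm of the ratio of `‖z‖` and `‖x‖`, and `7 > 2π` bounds the
  -- difference of imaginary parts.
  have hdiff : ‖logVar z - logVar x‖ ≤ 8 - Real.log r := by
    refine (Complex.norm_le_abs_re_add_abs_im _).trans ?_
    have h3 : |(logVar z - logVar x).re| ≤ 1 - Real.log r := by
      rw [Complex.sub_re, hre, abs_le]
      constructor <;> linarith
    have h4 : |(logVar z - logVar x).im| ≤ 7 := by
      have h5 := abs_im_logVar_lt hzm hz1
      have h6 := abs_im_logVar_lt hx hx1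
      rw [Complex.sub_im]
      refine (abs_sub _ _).trans ?_
      have := Real.pi_lt_d2
      linarith
    linarith
  have hconv : Convex ℝ {w : ℂ | (logVar x).re - 1 ≤ w.re} := convex_halfSpace_re_ge _
  have hmv := hconv.norm_image_sub_le_of_norm_hasDerivWithin_le (f := Complex.log)
    (f' := fun w => w⁻¹) (C := ((logVar x).re - 1)⁻¹) (x := logVar x) (y := logVar z)
    (fun w hw => (Complex.hasDerivAt_log (Or.inl (hm.trans_le hw))).hasDerivWithinAt)
    (fun w hw => by
      rw [norm_inv]
      exact inv_anti₀ hm (le_trans hw (Complex.re_le_norm w)))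
    (show (logVar x).re - 1 ≤ (logVar x).re by linarith) hge
  refine hmv.trans ?_
  rw [div_eq_inv_mul]
  gcongr

lemma cpow_div_cpow_eq_exp {u v : ℂ} (s : ℂ) (hu : u ≠ 0) (hv : v ≠ 0) :
    u ^ s / v ^ s = Complex.exp ((Complex.log u - Complex.log v) * s) := by
  rw [Complex.cpow_def_of_ne_zero hu, Complex.cpow_def_of_ne_zero hv, ← Complex.exp_sub]
  ring_nf

lemma ne_zero_of_re_pos {u : ℂ} (hu : 0 < u.re) : u ≠ 0 := by
  rintro rfl
  simp at hu

/-- For fixed `r`, replacing `logVar x` by its value at `1 - r(1-x)` changes the power by a factor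
tending to `1`, so the integrand tends to the constant of `tendsto_pullback_div`. Dominated
convergence applies because that factor is at most `e^4 r^{-1/2}`. -/
lemma tendsto_integral_pullback_div (s : ℂ) :
    Tendsto (fun x => ∫ r in Ioc (0 : ℝ) 1, pullback s (1 - r * (1 - x)) / logVar x ^ s)
      (𝓝[cutAtOne] 1) (𝓝 (-(Complex.Gamma (1 + s))⁻¹)) := by
  set c := -(Complex.Gamma (1 + s))⁻¹ with hc
  have hreL : Tendsto (fun x => (logVar x).re) (𝓝[cutAtOne] 1) atTop :=
    tendsto_re_stripFilter.comp tendsto_logVar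
  have hlimit : c = ∫ r in Ioc (0 : ℝ) 1, c := by simp
  have hev1 := (tendsto_pullback_div s).norm.eventually (gt_mem_nhds (lt_add_one ‖c‖))
  rw [eventually_nhdsWithin_iff, Metric.eventually_nhds_iff] at hev1
  obtain ⟨δ, hδ, hδc⟩ := hev1
  have hev := ((eventually_near_one (show (0 : ℝ) < min δ (1 / 4) by positivity)).and
    (hreL.eventually (eventually_ge_atTop (2 * ‖s‖ + 2))))
  rw [hlimit]
  refine tendsto_integral_filter_of_dominated_convergence
    (fun r => ((‖c‖ + 1) * Real.exp 4) * r ^ (-(1 / 2) : ℝ)) ?_ ?_ ?_ ?_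
  · filter_upwards [eventually_mem_nhdsWithin] with x hx
    exact ((continuousOn_pullback_ray s hx).div_const _).aestronglyMeasurable measurableSet_Ioc
  · filter_upwards [hev] with x hx
    obtain ⟨⟨hxm, hx1⟩, hL⟩ := hx
    refine (ae_restrict_iff' measurableSet_Ioc).2 (ae_of_all _ fun r hr => ?_)
    have hx2 := hx1.trans_le (min_le_right _ _)
    have hs := norm_nonneg s
    obtain ⟨h1, h2⟩ := norm_log_logVar_sub_le hxm hx2 (by linarith) hr.1 hr.2
    have hLx : logVar x ≠ 0 := ne_zero_of_re_pos (by linarith)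
    have hLz := ne_zero_of_re_pos h1
    set z := 1 - r * (1 - x) with hz
    have hz1 : dist z 1 < δ := by
      rw [dist_eq_norm, norm_sub_rev, norm_ray_to_one x hr.1.le, norm_sub_rev 1 x]
      exact (mul_le_of_le_one_left (norm_nonneg _) hr.2).trans_lt (hx1.trans_le (min_le_left _ _))
    have h3 := hδc hz1 (ray_to_one_mem hxm hr.1)
    have hzs : logVar z ^ s ≠ 0 := by simp [Complex.cpow_eq_zero_iff, hLz]
    have h4 : pullback s z / logVar x ^ s =
        (pullback s z / logVar z ^ s) * (logVar z ^ s / logVar x ^ s) := by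
      rw [div_mul_div_cancel₀ hzs]
    rw [h4, norm_mul, mul_assoc]
    refine mul_le_mul h3.le ?_ (norm_nonneg _) (by positivity)
    rw [cpow_div_cpow_eq_exp s hLz hLx]
    refine (Complex.norm_exp_le_exp_norm _).trans ?_
    rw [Real.rpow_def_of_pos hr.1, ← Real.exp_add, Real.exp_le_exp, norm_mul]
    -- The threshold `2‖s‖ + 2` on `Re logVar x` is chosen for this.
    have h5 : (8 - Real.log r) / ((logVar x).re - 1) * ‖s‖ ≤ (8 - Real.log r) / 2 := by
      have hlog : Real.log r ≤ 0 := Real.log_nonpos hr.1.le hr.2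
      rw [div_mul_eq_mul_div, div_le_div_iff₀ (by linarith) (by norm_num)]
      nlinarith
    calc _ ≤ (8 - Real.log r) / ((logVar x).re - 1) * ‖s‖ := by gcongr
      _ ≤ _ := h5
      _ = _ := by ring
  · exact integrableOn_rpow_neg_half.const_mul _
  · refine (ae_restrict_iff' measurableSet_Ioc).2 (ae_of_all _ fun r hr => ?_)
    have hzt : Tendsto (fun x : ℂ => 1 - r * (1 - x)) (𝓝[cutAtOne] 1) (𝓝[cutAtOne] 1) := by
      refine tendsto_nhdsWithin_iff.2 ⟨?_, eventually_mem_nhdsWithin.mono fun x hx =>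
        ray_to_one_mem hx hr.1⟩
      have : Continuous fun x : ℂ => 1 - r * (1 - x) := by fun_prop
      exact (this.tendsto' 1 1 (by simp)).mono_left nhdsWithin_le_nhds
    have h1 := (tendsto_pullback_div s).comp hzt
    have h2 : Tendsto (fun x => Complex.log (logVar (1 - r * (1 - x))) - Complex.log (logVar x))
        (𝓝[cutAtOne] 1) (𝓝 0) := by
      have hz : Tendsto (fun x => (8 - Real.log r) / ((logVar x).re - 1)) (𝓝[cutAtOne] 1)
          (𝓝 0) := Tendsto.const_div_atTop (tendsto_atTop_add_const_right _ _ hreL) _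
      refine squeeze_zero_norm' ?_ hz
      filter_upwards [hev] with x hx
      obtain ⟨⟨hxm, hx1⟩, hL⟩ := hx
      have hs := norm_nonneg s
      exact (norm_log_logVar_sub_le hxm (hx1.trans_le (min_le_right _ _)) (by linarith)
        hr.1 hr.2).2
    have h3 := h1.mul ((h2.mul_const s).cexp)
    rw [zero_mul, Complex.exp_zero, mul_one] at h3
    refine h3.congr' ?_
    filter_upwards [hev] with x hx
    obtain ⟨⟨hxm, hx1⟩, hL⟩ := hx
    have hs := norm_nonneg s
    have hLz := ne_zero_of_re_pos (norm_log_logVar_sub_le hxm (hx1.trans_le (min_le_right _ _))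
      (by linarith) hr.1 hr.2).1
    have hLx : logVar x ≠ 0 := ne_zero_of_re_pos (by linarith)
    have hzs : logVar (1 - r * (1 - x)) ^ s ≠ 0 := by simp [Complex.cpow_eq_zero_iff, hLz]
    rw [← cpow_div_cpow_eq_exp s hLz hLx]
    simp only [Function.comp]
    rw [div_mul_div_cancel₀ hzs]

lemma compl_Ioi_eq_insert : ((Complex.ofReal '' Ioi 1)ᶜ : Set ℂ) = insert 1 cutAtOne := by
  ext x
  simp only [cutAtOne, mem_compl_iff, mem_image, mem_Ioi, mem_Ici, mem_insert_iff, not_exists,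
    not_and]
  constructor
  · intro h
    by_cases hx : x = 1
    · exact Or.inl hx
    · refine Or.inr fun r hr hrx => ?_
      rcases hr.eq_or_lt with rfl | hr'
      · exact hx (by rw [← hrx]; simp)
      · exact h r hr' hrx
  · rintro (rfl | h) r hr hrx
    · have : r = 1 := by exact_mod_cast hrx
      linarith
    · exact h r hr.le hrx

/-- The asymptotic behaviour of the integral at `1`. -/
theorem isEquivalent_Z_sub {s : ℂ} (hs : ∀ k : ℕ, s ≠ -((k : ℂ) + 1)) :
    (fun x => Z s x - subOneMulZeta s) ~[𝓝[(Complex.ofReal '' Ioi 1)ᶜ] 1]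
      fun x => -1 / Complex.Gamma (1 + s) * (1 - x) * (-Complex.log (1 / x - 1)) ^ s := by
  have hΓ : Complex.Gamma (1 + s) ≠ 0 := by
    refine Complex.Gamma_ne_zero fun m h => hs m ?_
    linear_combination h
  -- At `x = 1` the difference of the two functions is `0`, so the point can be removed.
  rw [compl_Ioi_eq_insert, IsEquivalent, isLittleO_insert (by simp [Z, zetaSeries_one_eq])]
  change IsEquivalent (𝓝[cutAtOne] 1) _ _
  obtain ⟨C, δ, hδ, h⟩ := Z_sub_eq_integral s
  have hreL : Tendsto (fun x => (logVar x).re) (𝓝[cutAtOne] 1) atTop :=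
    tendsto_re_stripFilter.comp tendsto_logVar
  have hlim := (tendsto_integral_pullback_div s).const_mul (-Complex.Gamma (1 + s))
  rw [neg_mul_neg, mul_inv_cancel₀ hΓ] at hlim
  have hev : ∀ᶠ x in 𝓝[cutAtOne] (1 : ℂ), x ∈ cutAtOne ∧ ‖x - 1‖ < δ ∧ logVar x ^ s ≠ 0 := by
    filter_upwards [eventually_near_one hδ, hreL.eventually (eventually_gt_atTop 0)] with x hx hL
    exact ⟨hx.1, hx.2, by simp [Complex.cpow_eq_zero_iff, ne_zero_of_re_pos hL]⟩
  have hne : ∀ x ∈ cutAtOne, (1 - x) ≠ 0 := fun x hx => by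
    rw [← neg_sub]; exact neg_ne_zero.2 (sub_one_ne_zero_of_mem hx)
  refine isEquivalent_of_tendsto_one ?_
  refine hlim.congr' ?_
  filter_upwards [hev] with x hx
  have h1 := hne x hx.1
  have h2 := hx.2.2
  rw [integral_div, ← zetaSeries_one_eq, Pi.div_apply, (h x hx.1 hx.2.1).1]
  change _ = _ / (_ * logVar x ^ s)
  generalize (∫ r in Ioc (0 : ℝ) 1, pullback s (1 - r * (1 - x))) = I
  field_simp

/-! ### Line integrals and admissible paths -/

/-- The line integral of a function with a primitive, along a continuous curve of bounded
variation. -/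
lemma hasLineIntegral_of_hasDerivAt {f F : ℂ → ℂ} {U : Set ℂ} (hU : IsOpen U)
    (hF : ∀ z ∈ U, HasDerivAt F (f z) z) (hf : ContinuousOn f U) {γ : ℝ → ℂ} {a b : ℝ}
    (hγ : ContinuousOn γ (Icc a b)) (hγU : ∀ t ∈ Icc a b, γ t ∈ U)
    (hbv : BoundedVariationOn γ (Icc a b)) :
    HasLineIntegral f γ a b (F (γ b) - F (γ a)) := by
  intro ε hε
  set V := (eVariationOn γ (Icc a b)).toReal with hV
  have hV0 : 0 ≤ V := ENNReal.toReal_nonneg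
  set e := ε / (V + 1) with he
  have he0 : 0 < e := by positivity
  have hK : IsCompact (γ '' Icc a b) := isCompact_Icc.image_of_continuousOn hγ
  obtain ⟨ρ, hρ, hρU⟩ := hK.exists_cthickening_subset_open hU
    (by rintro _ ⟨t, ht, rfl⟩; exact hγU t ht)
  have huc := Metric.uniformContinuousOn_iff.1
    (hK.cthickening.uniformContinuousOn_of_continuous (hf.mono hρU)) e he0
  obtain ⟨η, hη, hηf⟩ := huc
  have hγuc := Metric.uniformContinuousOn_iff.1
    (isCompact_Icc.uniformContinuousOn_of_continuous hγ) (min η ρ) (lt_min hη hρ)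
  obtain ⟨δ, hδ, hδγ⟩ := hγuc
  refine ⟨δ, hδ, fun n t τ ht0 htn ht => ?_⟩
  -- `t` is arbitrary beyond `n`; freezing it there gives the globally monotone sequence that the
  -- variation bound requires.
  set u : ℕ → ℝ := fun i => t (min i n) with hu
  have hmono : Monotone u := by
    refine monotone_nat_of_le_succ fun i => ?_
    simp only [hu]
    rcases lt_or_ge i n with hi | hi
    · rw [min_eq_left hi.le, min_eq_left (Nat.succ_le_of_lt hi)]
      exact (ht i hi).1.trans (ht i hi).2.1
    · rw [min_eq_right hi, min_eq_right (by omega)]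
  have hu_mem : ∀ i, u i ∈ Icc a b := by
    intro i
    have h0 : u 0 = a := by simp [hu, ht0]
    have hn : u n = b := by simp [hu, htn]
    refine ⟨h0 ▸ hmono (Nat.zero_le i), ?_⟩
    rcases le_total i n with hi | hi
    · exact hn ▸ hmono hi
    · simp [hu, min_eq_right hi, htn]
  have htu : ∀ i ≤ n, t i = u i := fun i hi => by simp [hu, min_eq_left hi]
  have hsum : ∑ i ∈ Finset.range n, ‖γ (t (i + 1)) - γ (t i)‖ ≤ V := by
    have h1 := eVariationOn.sum_le (f := γ) (s := Icc a b) (n := n) hmono hu_mem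
    have h2 : ∑ i ∈ Finset.range n, edist (γ (u (i + 1))) (γ (u i)) =
        ENNReal.ofReal (∑ i ∈ Finset.range n, ‖γ (t (i + 1)) - γ (t i)‖) := by
      rw [ENNReal.ofReal_sum_of_nonneg fun i _ => norm_nonneg _]
      refine Finset.sum_congr rfl fun i hi => ?_
      have hi' := Finset.mem_range.1 hi
      rw [edist_dist, dist_eq_norm, htu i hi'.le, htu (i + 1) hi']
    rw [h2] at h1
    exact (ENNReal.ofReal_le_iff_le_toReal hbv).1 h1
  have hstep : ∀ i < n, ‖f (γ (τ i)) * (γ (t (i + 1)) - γ (t i)) -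
      (F (γ (t (i + 1))) - F (γ (t i)))‖ ≤ e * ‖γ (t (i + 1)) - γ (t i)‖ := by
    intro i hi
    obtain ⟨h1, h2, h3⟩ := ht i hi
    have hm1 : t i ∈ Icc a b := by rw [htu i hi.le]; exact hu_mem i
    have hm2 : t (i + 1) ∈ Icc a b := by rw [htu (i + 1) hi]; exact hu_mem (i + 1)
    have hm : τ i ∈ Icc a b := ⟨hm1.1.trans h1, h2.trans hm2.2⟩
    have hb1 : γ (t i) ∈ Metric.ball (γ (τ i)) (min η ρ) :=
      hδγ _ hm1 _ hm (by rw [Real.dist_eq, abs_lt]; constructor <;> linarith)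
    have hb2 : γ (t (i + 1)) ∈ Metric.ball (γ (τ i)) (min η ρ) :=
      hδγ _ hm2 _ hm (by rw [Real.dist_eq, abs_lt]; constructor <;> linarith)
    have hτK : γ (τ i) ∈ γ '' Icc a b := mem_image_of_mem γ hm
    have hballc : ∀ z ∈ Metric.ball (γ (τ i)) (min η ρ), z ∈ Metric.cthickening ρ (γ '' Icc a b) :=
      fun z hz => Metric.mem_cthickening_of_dist_le z _ ρ _ hτK
        ((Metric.mem_ball.1 hz).le.trans (min_le_right _ _))
    -- Mean value inequality for `f(γ(τ_i)) z - F(z)`, whose derivative is at most `e` on the ball;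
    -- each term then misses the increment of `F` by at most `e` times the chord.
    have hmv := (convex_ball (γ (τ i)) (min η ρ)).norm_image_sub_le_of_norm_hasDerivWithin_le
      (f := fun z => f (γ (τ i)) * z - F z) (f' := fun z => f (γ (τ i)) - f z) (C := e)
      (fun z hz => (((hasDerivAt_id z).const_mul (f (γ (τ i)))).sub
        (hF z (hρU (hballc z hz)))).hasDerivWithinAt.congr_deriv (by simp))
      (fun z hz => by
        have := hηf _ (Metric.self_subset_cthickening _ hτK) z (hballc z hz) (by
          rw [dist_comm]; exact (Metric.mem_ball.1 hz).trans_le (min_le_left _ _))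
        rw [← dist_eq_norm]
        exact this.le) hb1 hb2
    refine le_trans (le_of_eq ?_) hmv
    congr 1
    ring
  have htel : F (γ b) - F (γ a) = ∑ i ∈ Finset.range n, (F (γ (t (i + 1))) - F (γ (t i))) := by
    rw [Finset.sum_range_sub (fun i => F (γ (t i))), ht0, htn]
  rw [htel, ← Finset.sum_sub_distrib]
  calc _ ≤ ∑ i ∈ Finset.range n, e * ‖γ (t (i + 1)) - γ (t i)‖ :=
        norm_sum_le_of_le _ fun i hi => hstep i (Finset.mem_range.1 hi)
    _ = e * ∑ i ∈ Finset.range n, ‖γ (t (i + 1)) - γ (t i)‖ := by rw [Finset.mul_sum]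
    _ ≤ e * V := by gcongr
    _ < e * (V + 1) := by gcongr; linarith
    _ = ε := by rw [he]; field_simp

lemma cutPlane_subset : cutPlane ⊆ cutAtOne := by
  rintro x hx ⟨r, hr, rfl⟩
  exact hx ⟨r, Or.inr hr, rfl⟩

lemma mem_cutAtOne_of_mem_ends {x : ℂ} (hx : x ∈ cutPlaneWithEnds) (hx1 : x ≠ 1) :
    x ∈ cutAtOne := by
  rintro ⟨r, hr, rfl⟩
  rcases (mem_Ici.1 hr).eq_or_lt with rfl | h
  · exact hx1 (by simp)
  · exact hx ⟨r, Or.inr h, rfl⟩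

/-- The integral from `x` to `1`, expressed through `Z`. -/
lemma hasPathIntegral_Z (s : ℂ) {x : ℂ} (hx : x ∈ cutPlaneWithEnds) (γ : Path x (1 : ℂ))
    (hγ : IsAdmissible γ) :
    HasPathIntegral (fun z => polylog s (z / (z - 1))) γ (Z s x - subOneMulZeta s) := by
  have hcont : Continuous γ.extend := γ.continuous_extend
  have hmem : ∀ t : ℝ, 0 < t → t < 1 → γ.extend t ∈ cutPlane := by
    intro t h0 h1
    rw [Path.extend_apply γ ⟨h0.le, h1.le⟩]
    refine hγ.2 _ (fun h => ?_) (fun h => ?_)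
    · exact h0.ne' (congrArg Subtype.val h)
    · exact h1.ne (congrArg Subtype.val h)
  -- Endpoint limits. At the point `1`, `Z` is continuous only from within the cut plane, where the
  -- open path lies; any other endpoint, including `0`, is a point of holomorphy.
  have hlim : ∀ (l : Filter ℝ) (r : ℝ), Tendsto id l (𝓝 r) → (∀ᶠ t in l, 0 < t ∧ t < 1) →
      γ.extend r ∈ cutPlaneWithEnds →
      Tendsto (fun t => Z s (γ.extend t)) l (𝓝 (Z s (γ.extend r))) := by
    intro l r hl hev hr
    have hg : Tendsto γ.extend l (𝓝[cutAtOne] (γ.extend r)) :=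
      tendsto_nhdsWithin_iff.2 ⟨(hcont.tendsto r).comp hl,
        hev.mono fun t ht => cutPlane_subset (hmem t ht.1 ht.2)⟩
    by_cases h1 : γ.extend r = 1
    · rw [h1] at hg ⊢
      have := (tendsto_Z_sub s).comp hg
      have h2 : Z s 1 = zetaSeries s 1 := by simp [Z]
      rw [h2]
      simpa using this.add_const (zetaSeries s 1)
    · exact ((hasDerivAt_Z s (mem_cutAtOne_of_mem_ends hr h1)).continuousAt.tendsto.mono_left
        nhdsWithin_le_nhds).comp hg
  have hbv : BoundedVariationOn γ.extend univ := by
    have h1 := eVariationOn.comp_le_of_monotoneOn (t := (univ : Set ℝ)) (s := univ) γ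
      (φ := projIcc (0 : ℝ) 1 zero_le_one) ((monotone_projIcc _).monotoneOn _) (fun _ _ => trivial)
    exact ne_top_of_le_ne_top hγ.1 h1
  refine ⟨fun a b => Z s (γ.extend a) - Z s (γ.extend b), fun a b ha hab hb => ?_, ?_⟩
  · have h := hasLineIntegral_of_hasDerivAt (f := pullback s) (F := fun z => -Z s z)
      isOpen_cutAtOne (fun z hz => ((hasDerivAt_Z s hz).neg).congr_deriv (neg_neg _))
      (differentiableOn_pullback s).continuousOn (γ := γ.extend) (a := a) (b := b)
      hcont.continuousOn (fun t ht => cutPlane_subset (hmem t (ha.trans_le ht.1)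
        (ht.2.trans_lt hb))) (hbv.mono (subset_univ _))
    rw [neg_sub_neg] at h
    exact h
  · have hx1 : (1 : ℂ) ∈ cutPlaneWithEnds := by
      rintro ⟨r, hr, h⟩
      have : r = 1 := by exact_mod_cast h
      subst this
      rcases hr with hr | hr
      · exact absurd (mem_Iio.1 hr) (by norm_num)
      · exact lt_irrefl _ (mem_Ioi.1 hr)
    have h0 := hlim (𝓝[>] 0) 0 nhdsWithin_le_nhds (Ioo_mem_nhdsGT one_pos) (by simpa using hx)
    have h1 := hlim (𝓝[<] 1) 1 nhdsWithin_le_nhds (Ioo_mem_nhdsLT one_pos) (by simpa using hx1)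
    have h2 := (h0.comp tendsto_fst).sub (h1.comp (tendsto_snd (f := 𝓝[>] (0 : ℝ))))
    have h3 : Z s 1 = subOneMulZeta s := by rw [← zetaSeries_one_eq]; simp [Z]
    rw [Path.extend_zero, Path.extend_one, h3] at h2
    exact h2

lemma exists_isAdmissible {x : ℂ} (hx : x ∈ cutPlaneWithEnds) :
    ∃ γ : Path x (1 : ℂ), IsAdmissible γ := by
  -- The straight segment would be constant for `x = 1`. Here a real value at `0 < t < 1` forces `x`
  -- into `[0,1]`, and then `0 < t² ≤ g t ≤ 1 - t + t² < 1`.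
  let g : ℝ → ℂ := fun t => (1 - t) * x + t ^ 2
  have hg : Continuous g := by fun_prop
  let γ : Path x (1 : ℂ) :=
    { toFun := fun t => g t
      continuous_toFun := hg.comp continuous_subtype_val
      source' := by simp [g]
      target' := by simp [g] }
  have hγ : ∀ t : unitInterval, γ t = g t := fun t => rfl
  refine ⟨γ, ?_, fun t ht0 ht1 => ?_⟩
  · have hlip : LipschitzOnWith (Real.toNNReal (‖x‖ + 2)) g (Icc 0 1) := by
      refine LipschitzOnWith.of_dist_le_mul fun a ha b hb => ?_
      rw [Real.coe_toNNReal _ (by positivity), dist_eq_norm, Real.dist_eq]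
      have : g a - g b = ((a - b : ℝ) : ℂ) * ((a + b : ℝ) - x) := by
        simp only [g]; push_cast; ring
      rw [this, norm_mul, Complex.norm_real, Real.norm_eq_abs, mul_comm]
      gcongr
      refine (norm_sub_le _ _).trans ?_
      rw [Complex.norm_real, Real.norm_of_nonneg (add_nonneg ha.1 hb.1)]
      linarith [ha.2, hb.2]
    have hbv : BoundedVariationOn (fun t : unitInterval => (t : ℝ)) univ := by
      have hm : MonotoneOn (id : ℝ → ℝ) (Icc 0 1) := monotone_id.monotoneOn _
      have h1 : BoundedVariationOn (id : ℝ → ℝ) (Icc 0 1) := by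
        have := hm.eVariationOn_eq (a := 0) (b := 1) (left_mem_Icc.2 zero_le_one)
          (right_mem_Icc.2 zero_le_one)
        rw [inter_self] at this
        rw [BoundedVariationOn, this]
        exact ENNReal.ofReal_ne_top
      have h2 := eVariationOn.comp_le_of_monotoneOn (t := (univ : Set unitInterval))
        (s := Icc (0 : ℝ) 1) id (φ := Subtype.val) ((Subtype.mono_coe _).monotoneOn _)
        (fun t _ => t.2)
      exact ne_top_of_le_ne_top h1 h2
    exact hlip.comp_boundedVariationOn (fun t _ => t.2) hbv
  · have h0 : (0 : ℝ) < t := lt_of_le_of_ne t.2.1 fun h => ht0 (Subtype.ext h.symm)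
    have h1 : (t : ℝ) < 1 := lt_of_le_of_ne t.2.2 fun h => ht1 (Subtype.ext h)
    rw [hγ]
    rintro ⟨r, hr, h⟩
    have h1' : (1 - (t : ℝ)) ≠ 0 := (sub_pos.2 h1).ne'
    have hxr : x = (((r - (t : ℝ) ^ 2) / (1 - (t : ℝ)) : ℝ) : ℂ) := by
      have : (1 - ((t : ℝ) : ℂ)) ≠ 0 := by exact_mod_cast h1'
      push_cast
      rw [eq_div_iff this, h]
      simp only [g]
      ring
    set y : ℝ := (r - (t : ℝ) ^ 2) / (1 - (t : ℝ)) with hy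
    have hyr : r = (1 - t) * y + (t : ℝ) ^ 2 := by rw [hy]; field_simp; ring
    have hy0 : 0 ≤ y := by
      by_contra hneg
      exact hx ⟨y, Or.inl (not_le.1 hneg), hxr.symm⟩
    have hy1 : y ≤ 1 := by
      by_contra hneg
      exact hx ⟨y, Or.inr (not_le.1 hneg), hxr.symm⟩
    rcases hr with hr | hr
    · have hr' : r ≤ 0 := hr
      nlinarith [mul_nonneg (sub_pos.2 h1).le hy0]
    · have hr' : 1 ≤ r := hr
      nlinarith [mul_le_mul_of_nonneg_left hy1 (sub_pos.2 h1).le]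

end

end ZetaParam

theorem theorem3p3 (s : ℂ) :
    -- `Li_s` and `Z(s, ·)` are well defined on the plane cut along `[1, ∞)`
    ZetaParam.IsContinuation (ZetaParam.polylogSeries s) (ZetaParam.polylog s) ∧
    ZetaParam.IsContinuation (ZetaParam.zetaSeries s) (ZetaParam.Z s) ∧
    -- `E x` is the integral from `x` to `1` of `Li_s (z / (z - 1))`
    ∃ E : ℂ → ℂ,
      (∀ x ∈ ZetaParam.cutPlaneWithEnds,
        (∃ γ : Path x (1 : ℂ), ZetaParam.IsAdmissible γ) ∧
        ∀ γ : Path x (1 : ℂ), ZetaParam.IsAdmissible γ →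
          ZetaParam.HasPathIntegral (fun z => ZetaParam.polylog s (z / (z - 1))) γ (E x)) ∧
      (∀ x ∈ ZetaParam.cutPlaneWithEnds, ZetaParam.Z s x = ZetaParam.subOneMulZeta s + E x) ∧
      ((∀ k : ℕ, s ≠ -((k : ℂ) + 1)) →
        E ~[𝓝[(Complex.ofReal '' Set.Ioi 1)ᶜ] 1]
          fun x => -1 / Complex.Gamma (1 + s) * (1 - x) * (-Complex.log (1 / x - 1)) ^ s) :=
  ⟨ZetaParam.isContinuation_polylog s, ZetaParam.isContinuation_Z s,
    -- With this `E` the identity for `Z` is trivial; the content is that every admissible path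
    -- gives this value, which depends on `x` alone.
    fun x => ZetaParam.Z s x - ZetaParam.subOneMulZeta s,
    fun _ hx => ⟨ZetaParam.exists_isAdmissible hx, ZetaParam.hasPathIntegral_Z s hx⟩,
    fun _ _ => (add_sub_cancel _ _).symm, ZetaParam.isEquivalent_Z_sub⟩
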